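/- **Conventions.** Work in the hyperbolic plane $\mathbb H^2$. For a collection $\mathcal G$ of pairwise disjoint geodesics, an *ortho geodesic* of $\mathcal G$ is a non-degenerate geodesic segment that is orthogonal at each of its two endpoints to an element of $\mathcal G$. The *ortho spectrum* $\mathcal O(\mathcal G)$ is the set of lengths of the ortho geodesics of $\mathcal G$, counted with multiplicity. For a group $\Gamma$ of isometries preserving $\mathcal G$, $\mathcal O(\mathcal G/\Gamma)$ counts each $\Gamma$-orbit of ortho geodesics once. A *hyperbolic orbifold* $D/\Gamma$ is given by a nonempty open convex region $D\subset\mathbb H^2$ whose boundary is the union of a collection $\mathcal G$ of pairwise disjoint geodesics, and a group $\Gamma$ of orientation-preserving isometries that preserves $D$ and acts properly discontinuously. It carries the quotient metric, its ortho spectrum is $\mathcal O(\mathcal G/\Gamma)$, and the ortho spectrum of the boundary of its universal covering is $\mathcal O(\mathcal G)$. Two subsets of the vertex set of the cycle graph $C_{2n}$ are *congruent* if a graph automorphism maps one onto the other. **Construction.** Let $\gamma$ be an elliptic isometry and $g$ a geodesic such that, for all $i\in\mathbb Z$, either $\gamma^i g=g$ or $\gamma^i g\cap g=\emptyset$, and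 all $\gamma^ig\neq g$ lie in the same component of $\mathbb H^2\setminus g$. Suppose there is a least integer $m\ge1$ with $\gamma^m g=g$, and let $n$ be an integer with $2n\mid m$. Let $H$ be the half-plane bounded by $g$ that contains no $\gamma^ig$, and let $\mathcal G_0$ be a collection of pairwise disjoint geodesics contained in $\overline H$. For a set $X$ of $n$ vertices of $C_{2n}$ with complement $\overline X$, put $\mathcal G_X=\bigcup\gamma^i\mathcal G_0$, the union over all $i\in\mathbb Z$ whose class modulo $2n$ lies in $X$, and define $\mathcal G_{\overline X}$ likewise. Let $H_X$ be a connected component of the complement of the geodesics of $\mathcal G_X$ whose boundary contains all of $\mathcal G_X$, and let $H_{\overline X}$ be one for $\mathcal G_{\overline X}$ (these regions are assumed to exist). **Statement.** 1. There are non-isometric hyperbolic orbifolds, each with a cone point and with non-empty ortho spectrum, that have the same ortho spectrum and whose universal coverings' boundaries have the same ortho spectrum. 2. For all data as in the construction, $\gamma$ has finite order, $H_X/\langle\gamma^{2n}\rangle$ and $H_{\overline X}/\langle\gamma^{2n}\rangle$ are hyperbolic orbifolds with boundary geodesics coming from $\mathcal G_X$ and $\mathcal G_{\overline X}$, and $$\mathcal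 O(\mathcal G_X/\langle\gamma^{2n}\rangle)=\mathcal O(\mathcal G_{\overline X}/\langle\gamma^{2n}\rangle),\qquad \mathcal O(\mathcal G_X)=\mathcal O(\mathcal G_{\overline X}).$$ If moreover $\mathcal G_0\ne\emptyset$, $X$ is not congruent to $\overline X$, and either $m>2n$ (that is, $\gamma^{2n}$ acts non-trivially) or $\mathcal G_0=\{g\}$, then $H_X/\langle\gamma^{2n}\rangle$ and $H_{\overline X}/\langle\gamma^{2n}\rangle$ are not isometric, neither without nor with their boundary. 3. For all $n,k\ge1$ and every set $X$ of $n$ vertices of $C_{2n}$ there are data as in the construction with $m=2nk$ and $\mathcal G_0=\{g\}$. 4. There are an $n$ and a set $X$ of $n$ vertices of $C_{2n}$ that is not congruent to its complement. -/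

import Mathlib

open scoped UpperHalfPlane MatrixGroups Pointwise

namespace OrthoSpec

/-! ### Geodesics of the hyperbolic plane `ℍ` (upper half-plane model) -/

/-- The vertical geodesic ending at the real point `a`. -/
def verticalLine (a : ℝ) : Set ℍ := {z | z.re = a}

/-- The half-circle orthogonal to the real axis, of centre `a` and radius `r`. -/
def halfCircle (a r : ℝ) : Set ℍ := {z | (z.re - a) ^ 2 + z.im ^ 2 = r ^ 2}

/-- Complete geodesics of `ℍ`. -/
def IsGeodesic (g : Set ℍ) : Prop :=
  (∃ a : ℝ, g = verticalLine a) ∨ ∃ a r : ℝ, 0 < r ∧ g = halfCircle a r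

/-- `v` is a (nonzero) normal vector of the geodesic `g` at its point `z`. -/
def IsNormalAt (g : Set ℍ) (z : ℍ) (v : ℂ) : Prop :=
  z ∈ g ∧ ((∃ a : ℝ, g = verticalLine a ∧ v = 1) ∨
    ∃ a r : ℝ, 0 < r ∧ g = halfCircle a r ∧ v = (z : ℂ) - (a : ℂ))

/-- The geodesics `g` and `h` meet orthogonally at `z`. The model is conformal, so the angle is the
Euclidean one. -/
def OrthogonalAt (g h : Set ℍ) (z : ℍ) : Prop :=
  ∃ v w : ℂ, IsNormalAt g z v ∧ IsNormalAt h z w ∧ inner ℝ v w = 0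

/-- A set is geodesically convex if it contains the geodesic segment between any two of its
points. -/
def IsGeodConvex (D : Set ℍ) : Prop :=
  ∀ x ∈ D, ∀ y ∈ D, ∀ z : ℍ, dist x z + dist z y = dist x y → z ∈ D

/-- `C` is a connected component of `S`. -/
def IsComponentOf (C S : Set ℍ) : Prop := ∃ z ∈ S, C = connectedComponentIn S z

/-! ### Ortho spectrum -/

/-- The unordered pair `s` consists of the two endpoints of an ortho geodesic of length `L` of the
collection `𝒢`: a non-degenerate geodesic segment that is orthogonal, at each of its endpoints, to
an element of `𝒢`. (A segment is recorded by its endpoints, which determine it.) -/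
def IsOrthoGeodesic (𝒢 : Set (Set ℍ)) (L : ℝ) (s : Sym2 ℍ) : Prop :=
  ∃ x y : ℍ, s = s(x, y) ∧ x ≠ y ∧ dist x y = L ∧
    ∃ c : Set ℍ, IsGeodesic c ∧ (∃ g ∈ 𝒢, OrthogonalAt c g x) ∧ (∃ h ∈ 𝒢, OrthogonalAt c h y)

/-- The ortho spectrum of the collection `𝒢` modulo a group `Γ` of isometries, given by its
multiplicity function: the length `L` is counted once for every `Γ`-orbit of ortho geodesics of
length `L`. For trivial `Γ` this is the ortho spectrum of the collection `𝒢`. -/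
noncomputable def orthoSpectrum (𝒢 : Set (Set ℍ)) (Γ : Subgroup SL(2, ℝ)) (L : ℝ) : Cardinal :=
  Cardinal.mk {O : Set (Sym2 ℍ) | ∃ s, IsOrthoGeodesic 𝒢 L s ∧
    O = {t | ∃ A ∈ Γ, t = Sym2.map (fun z => A • z) s}}

/-! ### Hyperbolic orbifolds and their isometries -/

/-- `D / Γ` is a hyperbolic orbifold with totally geodesic boundary, whose orbifold universal
covering is the convex region `D` (together with its boundary), bounded by the collection `𝒢` of
pairwise disjoint geodesics, and whose group of covering transformations is (the image in the
isometry group of) `Γ`. -/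
structure IsHypOrbifold (D : Set ℍ) (𝒢 : Set (Set ℍ)) (Γ : Subgroup SL(2, ℝ)) : Prop where
  isOpen : IsOpen D
  nonempty : D.Nonempty
  convex : IsGeodConvex D
  geodesic : ∀ g ∈ 𝒢, IsGeodesic g
  disjoint : 𝒢.PairwiseDisjoint id
  frontier_eq : frontier D = ⋃₀ 𝒢
  invariant : ∀ A ∈ Γ, A • D = D
  properlyDiscontinuous : ProperlyDiscontinuousSMul Γ ℍ

/-- The points of the quotient `S / Γ`: the `Γ`-orbits of points of `S`. -/
def quotientPoints (S : Set ℍ) (Γ : Subgroup SL(2, ℝ)) : Set (Set ℍ) :=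
  {O | ∃ x ∈ S, O = MulAction.orbit Γ x}

/-- The quotient distance: the distance between two orbits. -/
noncomputable def quotientDist (O P : Set ℍ) : ℝ := sInf {r | ∃ x ∈ O, ∃ y ∈ P, dist x y = r}

/-- `S₁ / Γ₁` and `S₂ / Γ₂` are isometric: there is a distance-preserving bijection between them. -/
def QuotientsIsometric (S₁ : Set ℍ) (Γ₁ : Subgroup SL(2, ℝ)) (S₂ : Set ℍ)
    (Γ₂ : Subgroup SL(2, ℝ)) : Prop :=
  ∃ F : quotientPoints S₁ Γ₁ ≃ quotientPoints S₂ Γ₂,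
    ∀ O P : quotientPoints S₁ Γ₁,
      quotientDist (F O : Set ℍ) (F P : Set ℍ) = quotientDist (O : Set ℍ) (P : Set ℍ)

/-! ### Subsets of the cycle graph -/

/-- Two vertex sets of the cycle of length `N` are congruent if a graph automorphism maps one onto
the other. -/
def Congruent {N : ℕ} (X Y : Finset (Fin N)) : Prop :=
  ∃ σ : SimpleGraph.cycleGraph N ≃g SimpleGraph.cycleGraph N, σ '' (X : Set (Fin N)) = Y

/-- The preimage of `X` in the vertex set `ℤ` of the universal covering of the cycle. -/
def liftToInt {N : ℕ} (X : Finset (Fin N)) : Set ℤ := {i | ∃ a ∈ X, i ≡ (a : ℤ) [ZMOD (N : ℤ)]}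

/-! ### The construction -/

/-- The collection `⋃ γ ^ i (𝒢₀)`, where `i` runs through the preimage of `X` in `ℤ`. -/
def translates (γ : SL(2, ℝ)) (𝒢₀ : Set (Set ℍ)) {N : ℕ} (X : Finset (Fin N)) : Set (Set ℍ) :=
  {ℓ | ∃ i ∈ liftToInt X, ∃ ℓ₀ ∈ 𝒢₀, ℓ = γ ^ i • ℓ₀}

/-- `D` is a connected component of the complement of the union of `𝒢`, and its boundary contains
all of `𝒢`. -/
def IsRegionOf (D : Set ℍ) (𝒢 : Set (Set ℍ)) : Prop :=
  IsComponentOf D (⋃₀ 𝒢)ᶜ ∧ ⋃₀ 𝒢 ⊆ frontier D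

/-- For every `i`, the geodesics `g` and `γ ^ i g` are disjoint or equal, and all `γ ^ i g` other
than `g` lie in one and the same component of the complement of `g`. -/
def TranslateCondition (g : Set ℍ) (γ : SL(2, ℝ)) : Prop :=
  (∀ i : ℤ, Disjoint g (γ ^ i • g) ∨ γ ^ i • g = g) ∧
    ∃ K : Set ℍ, IsComponentOf K gᶜ ∧ ∀ i : ℤ, γ ^ i • g = g ∨ γ ^ i • g ⊆ K

/-- The data of the construction: an elliptic isometry `γ`, a geodesic `g`, the half-plane `H`
bounded by `g` that contains no translate of `g`, the least `m ≥ 1` with `γ ^ m g = g`, a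
collection `𝒢₀` of disjoint geodesics in the (closed) half-plane `H`, an `n`-element set `X` of
vertices of the cycle of length `2 n`, where `2 n ∣ m`, and the regions `D` and `D'` that belong to
`X` and to its complement. -/
structure EllipticData (n m : ℕ) (X : Finset (Fin (2 * n))) (γ : SL(2, ℝ)) (g H : Set ℍ)
    (𝒢₀ : Set (Set ℍ)) (D D' : Set ℍ) : Prop where
  elliptic : γ.val.IsElliptic
  geodesic : IsGeodesic g
  condition : TranslateCondition g γ
  halfPlane : IsComponentOf H gᶜ
  disjoint_halfPlane : ∀ i : ℤ, Disjoint (γ ^ i • g) H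
  period : IsLeast {j : ℕ | 0 < j ∧ γ ^ j • g = g} m
  dvd : 2 * n ∣ m
  collection_geodesic : ∀ ℓ ∈ 𝒢₀, IsGeodesic ℓ
  collection_subset : ∀ ℓ ∈ 𝒢₀, ℓ ⊆ closure H
  collection_disjoint : 𝒢₀.PairwiseDisjoint id
  card : X.card = n
  region : IsRegionOf D (translates γ 𝒢₀ X)
  region_compl : IsRegionOf D' (translates γ 𝒢₀ Xᶜ)

end OrthoSpec

/-! Everything takes place in the hyperboloid model based at the fixed point `z₀` of γ: a point is a
pair (T, W) with T² = 1 + |W|², the coordinate W is a homeomorphism onto ℂ, rotations about `z₀`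
multiply W by a unit number, and geodesics are zero sets of linear forms aT + ⟨b, W⟩ with |b| > |a|.
There g is T = ⟨c, W⟩ with |c| > 1, and disjointness of its translates forces |c| cos(π/m) ≤ 1.
Hence 𝒢₀ lies in an open sector of angle 2π/m, and its m different translates lie in disjoint
sectors (`EllipticData.exists_rotationData`, `RotationData.rot_zpow_eq`).

Equal spectra: the endpoints of an ortho geodesic give an unordered pair of sector indices modulo
2n, and powers of γ translate this pair. A translation-invariant set of pairs has as many members
inside X as inside the complement of X, because |X| = n: the weight 1 for pairs inside, -1 for pairs
outside and 0 for mixed pairs averages to zero over translations (`card_pairs_eq`). So each pair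
inside X can be translated into the complement with distinct pairs staying distinct
(`exists_pair_translation`). Moving ortho geodesics by the matching powers of γ injects orbits into
orbits, and exchanging X with its complement gives equality (`RotationData.orthoSpectrum_le`).

Non-isometry: an isometry of the quotients is shown to be induced by a rotation or reflection about
`z₀`. If the group acts by rotations of order k ≥ 2, the cone point is preserved because it is the
only point that is not the midpoint of arbitrarily short segments; quotient distances then determine
the inner products of the powers W^k, so these transform by an orthogonal map, and so does W modulo
the group (`IsRotationGroup.exists_of_isometric`). If the action is trivial and 𝒢₀ = {g}, then `z₀`
is recognised by its distance to three boundary geodesics (`RotationData.not_isometric_of_eq`). In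
both cases the boundaries correspond. Their directions form one pattern, narrower than a sector,
repeated at the positions of X and of its complement; matching two such figures requires an integer
shift of positions (`exists_translate_eq`), so X is congruent to its complement. -/

namespace OrthoSpec

/-! ### Hyperboloid coordinates -/

/-- The time coordinate of `z` on the hyperboloid with base point `z₀`. -/
noncomputable def coordT (z₀ z : ℍ) : ℝ :=
  ((z.re - z₀.re) ^ 2 + z.im ^ 2 + z₀.im ^ 2) / (2 * z.im * z₀.im)

/-- The space coordinate of `z` on the hyperboloid with base point `z₀`. -/
noncomputable def coordW (z₀ z : ℍ) : ℂ :=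
  ⟨((z.re - z₀.re) ^ 2 + z.im ^ 2 - z₀.im ^ 2) / (2 * z.im * z₀.im), -(z.re - z₀.re) / z.im⟩

/-- A linear form in the hyperboloid coordinates. -/
noncomputable def linForm (z₀ : ℍ) (a : ℝ) (b : ℂ) (z : ℍ) : ℝ :=
  a * coordT z₀ z + inner ℝ b (coordW z₀ z)

/-- The function on `ℍ` given by the real binary quadratic form with coefficients `q`. -/
noncomputable def quadForm (q : ℝ × ℝ × ℝ) (z : ℍ) : ℝ :=
  (q.1 * (z.re ^ 2 + z.im ^ 2) + q.2.1 * z.re + q.2.2) / z.im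

/-- The discriminant of a binary quadratic form. -/
def formDisc (q : ℝ × ℝ × ℝ) : ℝ := q.2.1 ^ 2 - 4 * q.1 * q.2.2

lemma inner_eq_re_im (u v : ℂ) : inner ℝ u v = u.re * v.re + u.im * v.im := by
  simp [Complex.inner]; ring

lemma coordT_sq (z₀ z : ℍ) : coordT z₀ z ^ 2 = 1 + ‖coordW z₀ z‖ ^ 2 := by
  have h := z.im_ne_zero
  have h0 := z₀.im_ne_zero
  rw [← Complex.normSq_eq_norm_sq, Complex.normSq_apply]
  simp only [coordT, coordW]
  field_simp
  ring

lemma coordT_pos (z₀ z : ℍ) : 0 < coordT z₀ z := by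
  have h := z.im_pos
  have h0 := z₀.im_pos
  unfold coordT
  positivity

lemma coordT_eq_sqrt (z₀ z : ℍ) : coordT z₀ z = √(1 + ‖coordW z₀ z‖ ^ 2) := by
  rw [← coordT_sq, Real.sqrt_sq (coordT_pos _ _).le]

lemma one_le_coordT (z₀ z : ℍ) : 1 ≤ coordT z₀ z := by
  have h := coordT_sq z₀ z
  have := coordT_pos z₀ z
  nlinarith [norm_nonneg (coordW z₀ z)]

@[simp] lemma coordT_self (z : ℍ) : coordT z z = 1 := by
  have h := z.im_ne_zero
  unfold coordT
  field_simp
  ring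

@[simp] lemma coordW_self (z : ℍ) : coordW z z = 0 := by
  apply Complex.ext <;> simp [coordW]

lemma cosh_dist_eq (z₀ z w : ℍ) : Real.cosh (dist z w) =
    coordT z₀ z * coordT z₀ w - inner ℝ (coordW z₀ z) (coordW z₀ w) := by
  have h := z.im_ne_zero
  have h' := w.im_ne_zero
  have h0 := z₀.im_ne_zero
  rw [UpperHalfPlane.cosh_dist, dist_eq_norm, ← Complex.normSq_eq_norm_sq, Complex.normSq_apply,
    inner_eq_re_im]
  simp only [coordT, coordW, Complex.sub_re, Complex.sub_im, UpperHalfPlane.coe_re,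
    UpperHalfPlane.coe_im]
  field_simp
  ring

lemma cosh_dist_base (z₀ z : ℍ) : Real.cosh (dist z₀ z) = coordT z₀ z := by
  rw [cosh_dist_eq z₀]; simp

lemma coordW_eq_zero_iff {z₀ z : ℍ} : coordW z₀ z = 0 ↔ z = z₀ := by
  constructor
  · intro h
    have h1 : Real.cosh (dist z₀ z) = 1 := by
      rw [cosh_dist_base, coordT_eq_sqrt, h]; simp
    by_contra h2
    exact (Real.one_lt_cosh.2 (dist_ne_zero.2 (Ne.symm h2))).ne' h1
  · rintro rfl; simp

lemma continuous_coordT (z₀ : ℍ) : Continuous (coordT z₀) := by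
  unfold coordT
  have h0 := z₀.im_ne_zero
  exact Continuous.div (by fun_prop) (by fun_prop) fun z => by
    have := z.im_ne_zero; positivity

lemma continuous_quadForm (q : ℝ × ℝ × ℝ) : Continuous (quadForm q) := by
  unfold quadForm
  exact Continuous.div (by fun_prop) (by fun_prop) fun z => z.im_ne_zero

/-- The point with given space coordinate on the hyperboloid. -/
noncomputable def ofCoord (z₀ : ℍ) (w : ℂ) : ℍ :=
  ⟨⟨z₀.re - z₀.im * w.im / (√(1 + ‖w‖ ^ 2) - w.re), z₀.im / (√(1 + ‖w‖ ^ 2) - w.re)⟩, by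
    have : w.re < √(1 + ‖w‖ ^ 2) := by
      apply lt_of_le_of_lt (Complex.re_le_norm w)
      apply Real.lt_sqrt_of_sq_lt
      linarith
    exact div_pos z₀.im_pos (by linarith)⟩

/-- The space coordinate is a homeomorphism onto the plane. -/
noncomputable def coordHomeo (z₀ : ℍ) : ℍ ≃ₜ ℂ where
  toFun := coordW z₀
  invFun := ofCoord z₀
  left_inv z := by
    have h := z.im_ne_zero
    have h0 := z₀.im_ne_zero
    have key : √(1 + ‖coordW z₀ z‖ ^ 2) - (coordW z₀ z).re = z₀.im / z.im := by
      rw [← coordT_eq_sqrt]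
      simp only [coordT, coordW]
      field_simp
      ring
    apply UpperHalfPlane.ext_re_im
    · simp only [ofCoord, UpperHalfPlane.mk_re, key]
      simp only [coordW]
      field_simp
      ring
    · simp only [ofCoord, UpperHalfPlane.mk_im, key]
      field_simp
  right_inv w := by
    have h0 := z₀.im_ne_zero
    have h1 : w.re < √(1 + ‖w‖ ^ 2) := by
      apply lt_of_le_of_lt (Complex.re_le_norm w)
      apply Real.lt_sqrt_of_sq_lt
      linarith
    have h2 : √(1 + ‖w‖ ^ 2) - w.re ≠ 0 := by linarith
    have h3 : √(1 + ‖w‖ ^ 2) ^ 2 = 1 + (w.re * w.re + w.im * w.im) := by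
      rw [Real.sq_sqrt (by positivity), ← Complex.normSq_eq_norm_sq, Complex.normSq_apply]
    apply Complex.ext
    · simp only [ofCoord, coordW, UpperHalfPlane.mk_re, UpperHalfPlane.mk_im]
      field_simp
      ring_nf
      rw [h3]
      ring
    · simp only [ofCoord, coordW, UpperHalfPlane.mk_re, UpperHalfPlane.mk_im]
      field_simp
      ring
  continuous_toFun := by
    have h0 := z₀.im_ne_zero
    have : coordW z₀ = fun z => Complex.equivRealProdCLM.symm
        (((z.re - z₀.re) ^ 2 + z.im ^ 2 - z₀.im ^ 2) / (2 * z.im * z₀.im),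
          -(z.re - z₀.re) / z.im) := by
      ext z
      apply Complex.ext <;> simp [coordW]
    change Continuous (coordW z₀)
    rw [this]
    refine Complex.equivRealProdCLM.symm.continuous.comp (Continuous.prodMk ?_ ?_)
    · exact Continuous.div (by fun_prop) (by fun_prop) fun z => by
        have := z.im_ne_zero; positivity
    · exact Continuous.div (by fun_prop) (by fun_prop) fun z => z.im_ne_zero
  continuous_invFun := by
    have hc : Continuous fun w : ℂ => √(1 + ‖w‖ ^ 2) - w.re := by fun_prop
    have hne : ∀ w : ℂ, √(1 + ‖w‖ ^ 2) - w.re ≠ 0 := fun w => by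
      have : w.re < √(1 + ‖w‖ ^ 2) := by
        apply lt_of_le_of_lt (Complex.re_le_norm w)
        apply Real.lt_sqrt_of_sq_lt
        linarith
      linarith
    refine UpperHalfPlane.isEmbedding_coe.continuous_iff.mpr ?_
    have : (UpperHalfPlane.coe ∘ ofCoord z₀) = fun w => Complex.equivRealProdCLM.symm
        (z₀.re - z₀.im * w.im / (√(1 + ‖w‖ ^ 2) - w.re),
          z₀.im / (√(1 + ‖w‖ ^ 2) - w.re)) := by
      ext w
      apply Complex.ext <;> simp [ofCoord]
    change Continuous (UpperHalfPlane.coe ∘ ofCoord z₀)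
    rw [this]
    refine Complex.equivRealProdCLM.symm.continuous.comp (Continuous.prodMk ?_ ?_)
    · exact continuous_const.sub (Continuous.div (by fun_prop) hc hne)
    · exact Continuous.div (by fun_prop) hc hne

@[simp] lemma coordHomeo_apply (z₀ z : ℍ) : coordHomeo z₀ z = coordW z₀ z := rfl

@[simp] lemma coordW_symm (z₀ : ℍ) (w : ℂ) : coordW z₀ ((coordHomeo z₀).symm w) = w :=
  (coordHomeo z₀).apply_symm_apply w

@[simp] lemma coordT_symm (z₀ : ℍ) (w : ℂ) :
    coordT z₀ ((coordHomeo z₀).symm w) = √(1 + ‖w‖ ^ 2) := by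
  rw [coordT_eq_sqrt, coordW_symm]

lemma coordW_injective (z₀ : ℍ) : Function.Injective (coordW z₀) := (coordHomeo z₀).injective

lemma continuous_coordW (z₀ : ℍ) : Continuous (coordW z₀) := (coordHomeo z₀).continuous

lemma continuous_linForm (z₀ : ℍ) (a : ℝ) (b : ℂ) : Continuous (linForm z₀ a b) := by
  unfold linForm
  have := continuous_coordT z₀
  have := continuous_coordW z₀
  fun_prop

/-- Both sides are the linear functions on Minkowski space, and the discriminant is the Minkowski
square of the normal vector. `quadForm` needs no base point and suits the action of `SL(2, ℝ)`;
`linForm` suits rotations about `z₀`. -/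
lemma exists_linForm_eq_quadForm (z₀ : ℍ) (q : ℝ × ℝ × ℝ) : ∃ a b,
    ‖b‖ ^ 2 - a ^ 2 = formDisc q ∧ ∀ z, quadForm q z = linForm z₀ a b z := by
  have h0 := z₀.im_ne_zero
  refine ⟨quadForm q z₀, ⟨(q.1 * z₀.im ^ 2 - q.1 * z₀.re ^ 2 - q.2.1 * z₀.re - q.2.2) / z₀.im,
    - q.2.1 - 2 * q.1 * z₀.re⟩, ?_, fun z => ?_⟩
  · rw [← Complex.normSq_eq_norm_sq, Complex.normSq_apply]
    simp only [quadForm, formDisc]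
    field_simp
    ring
  · have h := z.im_ne_zero
    simp only [quadForm, linForm, inner_eq_re_im, coordT, coordW]
    field_simp
    ring

lemma exists_quadForm_eq_linForm (z₀ : ℍ) (a : ℝ) (b : ℂ) : ∃ q,
    ‖b‖ ^ 2 - a ^ 2 = formDisc q ∧ ∀ z, quadForm q z = linForm z₀ a b z := by
  have h0 := z₀.im_ne_zero
  refine ⟨((a + b.re) / (2 * z₀.im), - b.im - (a + b.re) / z₀.im * z₀.re,
    (a - b.re) * z₀.im / 2 + (a + b.re) / (2 * z₀.im) * z₀.re ^ 2 + b.im * z₀.re), ?_, fun z => ?_⟩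
  · rw [← Complex.normSq_eq_norm_sq, Complex.normSq_apply]
    simp only [formDisc]
    field_simp
    ring
  · have h := z.im_ne_zero
    simp only [quadForm, linForm, inner_eq_re_im, coordT, coordW]
    field_simp
    ring

@[simp] lemma linForm_self (z₀ : ℍ) (a : ℝ) (b : ℂ) : linForm z₀ a b z₀ = a := by
  simp [linForm]

/-! ### Geodesics as zero sets -/

lemma verticalLine_eq (a : ℝ) : verticalLine a = {z | quadForm (0, 1, -a) z = 0} := by
  ext z
  have := z.im_ne_zero
  simp [verticalLine, quadForm, this, ← sub_eq_add_neg, sub_eq_zero]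

/-- With leading coefficient 1/2 the discriminant is r² and the gradient of the numerator is exactly
the normal vector z - a of `IsNormalAt`. -/
lemma halfCircle_eq (a r : ℝ) :
    halfCircle a r = {z | quadForm (1 / 2, -a, (a ^ 2 - r ^ 2) / 2) z = 0} := by
  ext z
  have := z.im_ne_zero
  simp only [halfCircle, quadForm, Set.mem_ofPred_eq, div_eq_zero_iff, this, or_false]
  constructor <;> intro h <;> linarith

lemma quadForm_smul (t : ℝ) (q : ℝ × ℝ × ℝ) (z : ℍ) : quadForm (t • q) z = t * quadForm q z := by
  simp only [quadForm, Prod.smul_fst, Prod.smul_snd, smul_eq_mul]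
  ring

lemma zeroSet_smul {t : ℝ} (ht : t ≠ 0) (q : ℝ × ℝ × ℝ) :
    {z | quadForm (t • q) z = 0} = {z | quadForm q z = 0} := by
  ext z
  simp [quadForm_smul, ht]

lemma exists_normalForm {q : ℝ × ℝ × ℝ} (hq : 0 < formDisc q) : ∃ t : ℝ, t ≠ 0 ∧
    ((∃ a : ℝ, t • q = (0, 1, -a)) ∨
      ∃ a r : ℝ, 0 < r ∧ t • q = (1 / 2, -a, (a ^ 2 - r ^ 2) / 2)) := by
  obtain ⟨p, s, t⟩ := q
  simp only [formDisc] at hq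
  by_cases hp : p = 0
  · subst hp
    have hs : s ≠ 0 := by rintro rfl; simp at hq
    exact ⟨1 / s, by simpa, Or.inl ⟨-t / s, by simp [hs]; ring⟩⟩
  · have hd : 0 < (s ^ 2 - 4 * p * t) / (4 * p ^ 2) := by positivity
    refine ⟨1 / (2 * p), by simpa, Or.inr
      ⟨-s / (2 * p), √((s ^ 2 - 4 * p * t) / (4 * p ^ 2)), Real.sqrt_pos.2 hd, ?_⟩⟩
    rw [Real.sq_sqrt hd.le]
    simp only [Prod.smul_mk, smul_eq_mul, Prod.mk.injEq]
    refine ⟨?_, ?_, ?_⟩ <;> field_simp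
    ring

lemma isGeodesic_iff {g : Set ℍ} :
    IsGeodesic g ↔ ∃ q, 0 < formDisc q ∧ g = {z | quadForm q z = 0} := by
  constructor
  · rintro (⟨a, rfl⟩ | ⟨a, r, hr, rfl⟩)
    · exact ⟨(0, 1, -a), by simp [formDisc], verticalLine_eq a⟩
    · exact ⟨_, by simp only [formDisc]; nlinarith [sq_pos_of_pos hr], halfCircle_eq a r⟩
  · rintro ⟨q, hq, rfl⟩
    obtain ⟨t, ht, ⟨a, h⟩ | ⟨a, r, hr, h⟩⟩ := exists_normalForm hq
    · exact Or.inl ⟨a, by rw [← zeroSet_smul ht, h, verticalLine_eq]⟩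
    · exact Or.inr ⟨a, r, hr, by rw [← zeroSet_smul ht, h, halfCircle_eq]⟩

/-! ### Orthogonality through the polar form of the discriminant -/

/-- The polar form of the discriminant. -/
def formPolar (q q' : ℝ × ℝ × ℝ) : ℝ := q.2.1 * q'.2.1 - 2 * q.1 * q'.2.2 - 2 * q.2.2 * q'.1

/-- The Euclidean gradient of the numerator of `quadForm q`. -/
noncomputable def formGrad (q : ℝ × ℝ × ℝ) (z : ℍ) : ℂ := ⟨2 * q.1 * z.re + q.2.1, 2 * q.1 * z.im⟩

/-- This makes orthogonality an algebraic condition on two forms that does not involve the point, so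
that invariance under `SL(2, ℝ)` follows from `formPolar_act`. -/
lemma inner_formGrad {q q' : ℝ × ℝ × ℝ} {z : ℍ} (h : quadForm q z = 0) (h' : quadForm q' z = 0) :
    inner ℝ (formGrad q z) (formGrad q' z) = formPolar q q' := by
  have := z.im_ne_zero
  simp only [quadForm, div_eq_zero_iff, this, or_false] at h h'
  simp only [inner_eq_re_im, formGrad, formPolar]
  linear_combination 2 * q'.1 * h + 2 * q.1 * h'

lemma IsNormalAt.exists_form {g : Set ℍ} {z : ℍ} {v : ℂ} (h : IsNormalAt g z v) :
    ∃ q, 0 < formDisc q ∧ g = {z | quadForm q z = 0} ∧ quadForm q z = 0 ∧ formGrad q z = v := by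
  obtain ⟨hz, ⟨a, rfl, rfl⟩ | ⟨a, r, hr, rfl, rfl⟩⟩ := h
  · refine ⟨_, by simp [formDisc], verticalLine_eq a, by rwa [verticalLine_eq] at hz, ?_⟩
    apply Complex.ext <;> simp [formGrad]
  · refine ⟨_, ?_, halfCircle_eq a r, by rwa [halfCircle_eq] at hz, ?_⟩
    · simp only [formDisc]; nlinarith [sq_pos_of_pos hr]
    · apply Complex.ext <;> simp [formGrad, sub_eq_add_neg]

lemma exists_isNormalAt {q : ℝ × ℝ × ℝ} {z : ℍ} (hq : 0 < formDisc q) (hz : quadForm q z = 0) :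
    ∃ t : ℝ, IsNormalAt {z | quadForm q z = 0} z (t • formGrad q z) := by
  obtain ⟨t, ht, H⟩ := exists_normalForm hq
  have hg : t • formGrad q z = formGrad (t • q) z := by
    apply Complex.ext <;> simp [formGrad] <;> ring
  refine ⟨t, hz, ?_⟩
  rw [hg, ← zeroSet_smul ht]
  obtain ⟨a, h⟩ | ⟨a, r, hr, h⟩ := H <;> rw [h]
  · exact Or.inl ⟨a, (verticalLine_eq a).symm, by apply Complex.ext <;> simp [formGrad]⟩
  · exact Or.inr ⟨a, r, hr, (halfCircle_eq a r).symm, by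
      apply Complex.ext <;> simp [formGrad, sub_eq_add_neg]⟩

lemma orthogonalAt_iff {g h : Set ℍ} {z : ℍ} : OrthogonalAt g h z ↔
    ∃ q q', 0 < formDisc q ∧ 0 < formDisc q' ∧ g = {z | quadForm q z = 0} ∧
      h = {z | quadForm q' z = 0} ∧ quadForm q z = 0 ∧ quadForm q' z = 0 ∧ formPolar q q' = 0 := by
  constructor
  · rintro ⟨v, w, hv, hw, hvw⟩
    obtain ⟨q, hq, hg, hz, rfl⟩ := hv.exists_form
    obtain ⟨q', hq', hg', hz', rfl⟩ := hw.exists_form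
    exact ⟨q, q', hq, hq', hg, hg', hz, hz', by rw [← inner_formGrad hz hz', hvw]⟩
  · rintro ⟨q, q', hq, hq', rfl, rfl, hz, hz', hp⟩
    obtain ⟨t, ht⟩ := exists_isNormalAt hq hz
    obtain ⟨t', ht'⟩ := exists_isNormalAt hq' hz'
    refine ⟨_, _, ht, ht', ?_⟩
    rw [inner_smul_left, inner_smul_right, inner_formGrad hz hz', hp]
    simp

/-! ### The action of `SL(2, ℝ)` -/

/-- The action of `SL(2, ℝ)` on binary quadratic forms. -/
def formAct (A : SL(2, ℝ)) (q : ℝ × ℝ × ℝ) : ℝ × ℝ × ℝ :=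
  (q.1 * A 1 1 ^ 2 - q.2.1 * A 1 0 * A 1 1 + q.2.2 * A 1 0 ^ 2,
    -2 * q.1 * A 0 1 * A 1 1 + q.2.1 * (A 0 0 * A 1 1 + A 0 1 * A 1 0) - 2 * q.2.2 * A 0 0 * A 1 0,
    q.1 * A 0 1 ^ 2 - q.2.1 * A 0 0 * A 0 1 + q.2.2 * A 0 0 ^ 2)

lemma det_eq_one (A : SL(2, ℝ)) : A 0 0 * A 1 1 - A 0 1 * A 1 0 = 1 := by
  have := A.det_coe
  rwa [Matrix.det_fin_two] at this

lemma formPolar_act (A : SL(2, ℝ)) (q q' : ℝ × ℝ × ℝ) :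
    formPolar (formAct A q) (formAct A q') = formPolar q q' := by
  have h := det_eq_one A
  have : formPolar (formAct A q) (formAct A q') =
      (A 0 0 * A 1 1 - A 0 1 * A 1 0) ^ 2 * formPolar q q' := by
    simp only [formPolar, formAct]; ring
  rw [this, h]; ring

lemma formDisc_act (A : SL(2, ℝ)) (q : ℝ × ℝ × ℝ) : formDisc (formAct A q) = formDisc q := by
  have h1 (q) : formDisc q = formPolar q q := by simp only [formDisc, formPolar]; ring
  rw [h1, h1, formPolar_act]

lemma sl_denom_normSq_pos (A : SL(2, ℝ)) (z : ℍ) :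
    0 < (A 1 0 * z.re + A 1 1) ^ 2 + (A 1 0 * z.im) ^ 2 := by
  have h := det_eq_one A
  by_cases hc : A 1 0 = 0
  · have : A 1 1 ≠ 0 := by intro h1; simp [hc, h1] at h
    rw [hc]; simp; positivity
  · have := z.im_ne_zero
    positivity

lemma sl_smul_im (A : SL(2, ℝ)) (z : ℍ) :
    (A • z).im = z.im / ((A 1 0 * z.re + A 1 1) ^ 2 + (A 1 0 * z.im) ^ 2) := by
  have h := det_eq_one A
  have hp := sl_denom_normSq_pos A z
  rw [← UpperHalfPlane.coe_im, UpperHalfPlane.coe_specialLinearGroup_apply, Complex.div_im]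
  simp [Complex.normSq_apply]
  rw [← sub_div]
  congr 1
  · linear_combination z.im * h
  · ring

lemma sl_smul_re (A : SL(2, ℝ)) (z : ℍ) :
    (A • z).re = ((A 0 0 * z.re + A 0 1) * (A 1 0 * z.re + A 1 1) + A 0 0 * A 1 0 * z.im ^ 2) /
      ((A 1 0 * z.re + A 1 1) ^ 2 + (A 1 0 * z.im) ^ 2) := by
  rw [← UpperHalfPlane.coe_re, UpperHalfPlane.coe_specialLinearGroup_apply, Complex.div_re]
  simp [Complex.normSq_apply]
  rw [← add_div]
  congr 1 <;> ring

lemma quadForm_act (A : SL(2, ℝ)) (q : ℝ × ℝ × ℝ) (z : ℍ) :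
    quadForm (formAct A q) (A • z) = quadForm q z := by
  have h := det_eq_one A
  have hp := (sl_denom_normSq_pos A z).ne'
  have hz := z.im_ne_zero
  have hd : (A 0 0 * A 1 1 - A 0 1 * A 1 0) ^ 2 = 1 := by rw [h]; ring
  simp only [quadForm, sl_smul_im, sl_smul_re, formAct]
  generalize hN : (A 1 0 * z.re + A 1 1) ^ 2 + (A 1 0 * z.im) ^ 2 = N at *
  have key : ((A 0 0 * z.re + A 0 1) * (A 1 0 * z.re + A 1 1) + A 0 0 * A 1 0 * z.im ^ 2) ^ 2
      + z.im ^ 2 = ((A 0 0 * z.re + A 0 1) ^ 2 + (A 0 0 * z.im) ^ 2) * N := by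
    rw [← hN]; linear_combination -z.im ^ 2 * hd
  rw [div_div_eq_mul_div, div_left_inj' hz, div_pow, div_pow, ← add_div, key]
  field_simp
  rw [← hN]
  linear_combination (q.1 * (z.re ^ 2 + z.im ^ 2) + z.re * q.2.1 + q.2.2) * hd

lemma smul_zeroSet (A : SL(2, ℝ)) (q : ℝ × ℝ × ℝ) :
    A • {z | quadForm q z = 0} = {z | quadForm (formAct A q) z = 0} := by
  ext z
  rw [Set.mem_smul_set_iff_inv_smul_mem, Set.mem_ofPred_eq, Set.mem_ofPred_eq]
  conv_rhs => rw [← smul_inv_smul A z, quadForm_act]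

lemma IsGeodesic.smul {g : Set ℍ} (hg : IsGeodesic g) (A : SL(2, ℝ)) : IsGeodesic (A • g) := by
  obtain ⟨q, hq, rfl⟩ := isGeodesic_iff.1 hg
  exact isGeodesic_iff.2 ⟨formAct A q, by rwa [formDisc_act], smul_zeroSet A q⟩

lemma OrthogonalAt.smul {g h : Set ℍ} {z : ℍ} (H : OrthogonalAt g h z) (A : SL(2, ℝ)) :
    OrthogonalAt (A • g) (A • h) (A • z) := by
  obtain ⟨q, q', hq, hq', rfl, rfl, hz, hz', hp⟩ := orthogonalAt_iff.1 H
  exact orthogonalAt_iff.2 ⟨formAct A q, formAct A q', by rwa [formDisc_act], by rwa [formDisc_act],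
    smul_zeroSet A q, smul_zeroSet A q', by rwa [quadForm_act], by rwa [quadForm_act],
    by rwa [formPolar_act]⟩

/-! ### Rotations about the base point -/

lemma coordW_eq (z₀ z : ℍ) : coordW z₀ z =
    ((z : ℂ) - z₀) * (starRingEnd ℂ (z : ℂ) - z₀) / (2 * z.im * z₀.im) := by
  have h := z.im_ne_zero
  have h0 := z₀.im_ne_zero
  have e : (2 * z.im * z₀.im : ℂ) = ((2 * z.im * z₀.im : ℝ) : ℂ) := by push_cast; ring
  rw [e]
  apply Complex.ext
  · rw [Complex.div_ofReal_re]
    simp [coordW]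
    field_simp
    ring
  · rw [Complex.div_ofReal_im]
    simp [coordW]
    field_simp
    ring

/-- An isometry fixing the base point acts on the space coordinate as a rotation. -/
lemma exists_rotation {A : SL(2, ℝ)} {z₀ : ℍ} (h : A • z₀ = z₀) :
    ∃ ρ : ℂ, ‖ρ‖ = 1 ∧ ∀ z, coordW z₀ (A • z) = ρ * coordW z₀ z := by
  have hdet : (A 0 0 : ℂ) * A 1 1 - A 0 1 * A 1 0 = 1 := by exact_mod_cast det_eq_one A
  have hj (z : ℍ) : (A 1 0 : ℂ) * z + A 1 1 ≠ 0 := by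
    intro h0
    have h1 := sl_denom_normSq_pos A z
    have h2 : A 1 0 * z.re + A 1 1 = 0 := by simpa using congrArg Complex.re h0
    have h3 : A 1 0 * z.im = 0 := by simpa using congrArg Complex.im h0
    rw [h2, h3] at h1
    simp at h1
  have hj' (z : ℍ) : (A 1 0 : ℂ) * starRingEnd ℂ (z : ℂ) + A 1 1 ≠ 0 := by
    intro h0
    apply hj z
    simpa using congrArg (starRingEnd ℂ) h0
  have hnorm (z : ℍ) : ‖(A 1 0 : ℂ) * z + A 1 1‖ ^ 2 =
      (A 1 0 * z.re + A 1 1) ^ 2 + (A 1 0 * z.im) ^ 2 := by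
    rw [← Complex.normSq_eq_norm_sq, Complex.normSq_apply]
    simp
    ring
  have hsub (u v : ℂ) (hu : (A 1 0 : ℂ) * u + A 1 1 ≠ 0) (hv : (A 1 0 : ℂ) * v + A 1 1 ≠ 0) :
      (A 0 0 * u + A 0 1) / (A 1 0 * u + A 1 1) - (A 0 0 * v + A 0 1) / (A 1 0 * v + A 1 1) =
        (u - v) / (((A 1 0 : ℂ) * u + A 1 1) * (A 1 0 * v + A 1 1)) := by
    rw [div_sub_div _ _ hu hv]
    congr 1
    linear_combination (u - v) * hdet
  have hz₀ : (z₀ : ℂ) = (A 0 0 * z₀ + A 0 1) / (A 1 0 * z₀ + A 1 1) := by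
    conv_lhs => rw [← h, UpperHalfPlane.coe_specialLinearGroup_apply]
    simp
  -- With j(z) = cz + d one has Az - Av = (z - v) / (j(z) j(v)). In the product formula `coordW_eq`
  -- the factors j(z) and its conjugate cancel against the imaginary part, leaving 1 / j(z₀)². Its
  -- modulus is 1 because the fixed point keeps its imaginary part.
  refine ⟨(((A 1 0 : ℂ) * z₀ + A 1 1) ^ 2)⁻¹, ?_, fun z => ?_⟩
  · have h1 := sl_smul_im A z₀
    rw [h, ← hnorm, eq_div_iff (by have := norm_ne_zero_iff.2 (hj z₀); positivity)] at h1
    have h2 : ‖(A 1 0 : ℂ) * z₀ + A 1 1‖ ^ 2 = 1 := by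
      have := z₀.im_ne_zero
      apply mul_left_cancel₀ this
      rw [h1, mul_one]
    rw [norm_inv, norm_pow, h2, inv_one]
  · have him : ((A • z).im : ℂ) = z.im /
        (((A 1 0 : ℂ) * z + A 1 1) * (A 1 0 * starRingEnd ℂ (z : ℂ) + A 1 1)) := by
      rw [sl_smul_im, ← hnorm]
      have : (A 1 0 : ℂ) * starRingEnd ℂ (z : ℂ) + A 1 1 =
        starRingEnd ℂ ((A 1 0 : ℂ) * z + A 1 1) := by simp
      rw [this, Complex.mul_conj, Complex.normSq_eq_norm_sq]
      push_cast
      rfl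
    have hcoe : ((A • z : ℍ) : ℂ) = (A 0 0 * z + A 0 1) / (A 1 0 * z + A 1 1) := by
      rw [UpperHalfPlane.coe_specialLinearGroup_apply]; simp
    have hz1 : (z.im : ℂ) ≠ 0 := by exact_mod_cast z.im_ne_zero
    have hz2 : (z₀.im : ℂ) ≠ 0 := by exact_mod_cast z₀.im_ne_zero
    have e1 : ((A • z : ℍ) : ℂ) - z₀ =
        (z - z₀) / (((A 1 0 : ℂ) * z + A 1 1) * (A 1 0 * z₀ + A 1 1)) := by
      rw [← hsub _ _ (hj z) (hj z₀), ← hz₀, hcoe]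
    have e2 : starRingEnd ℂ ((A • z : ℍ) : ℂ) - z₀ = (starRingEnd ℂ (z : ℂ) - z₀) /
        (((A 1 0 : ℂ) * starRingEnd ℂ (z : ℂ) + A 1 1) * (A 1 0 * z₀ + A 1 1)) := by
      rw [← hsub _ _ (hj' z) (hj z₀), ← hz₀, hcoe]
      simp
    rw [coordW_eq, coordW_eq, e1, e2, him]
    have a1 := hj z
    have a2 := hj' z
    have a3 := hj z₀
    generalize (A 1 0 : ℂ) * z + A 1 1 = j1 at *
    generalize (A 1 0 : ℂ) * starRingEnd ℂ (z : ℂ) + A 1 1 = j2 at *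
    generalize (A 1 0 : ℂ) * z₀ + A 1 1 = j3 at *
    field_simp

/-! ### Convexity and connectedness -/

lemma norm_coordW_sq (x z : ℍ) : ‖coordW x z‖ ^ 2 = Real.sinh (dist x z) ^ 2 := by
  rw [Real.sinh_sq, cosh_dist_base, coordT_sq]; ring

/-- On the hyperboloid a point of a segment is the combination of the endpoints with coefficients
sinh d(z, y) / sinh d(x, y) and sinh d(x, z) / sinh d(x, y). Forms are linear there, which makes
half-planes geodesically convex. -/
lemma exists_combination {x y z : ℍ} (h : dist x z + dist z y = dist x y) :
    ∃ α β : ℝ, 0 ≤ α ∧ 0 ≤ β ∧ 0 < α + β ∧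
      ∀ q, quadForm q z = α * quadForm q x + β * quadForm q y := by
  rcases eq_or_ne x y with rfl | hxy
  · have h1 : dist x z = 0 := by
      have := dist_nonneg (x := x) (y := z)
      have := dist_nonneg (x := z) (y := x)
      rw [dist_self] at h
      linarith
    obtain rfl := dist_eq_zero.1 h1
    exact ⟨1, 0, zero_le_one, le_rfl, by norm_num, fun q => by ring⟩
  have hd : 0 < Real.sinh (dist x y) := Real.sinh_pos_iff.2 (dist_pos.2 hxy)
  have hd1 : 0 ≤ Real.sinh (dist x z) := Real.sinh_nonneg_iff.2 dist_nonneg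
  have hd2 : 0 ≤ Real.sinh (dist z y) := Real.sinh_nonneg_iff.2 dist_nonneg
  have ezy : dist z y = dist x y - dist x z := by linarith
  have hT : coordT x z = Real.sinh (dist z y) / Real.sinh (dist x y) * 1 +
      Real.sinh (dist x z) / Real.sinh (dist x y) * coordT x y := by
    rw [← cosh_dist_base, ← cosh_dist_base, ezy, Real.sinh_sub]
    field_simp
    ring
  have hin : inner ℝ (coordW x z) (coordW x y) =
      Real.sinh (dist x z) * Real.sinh (dist x y) := by
    have h1 := cosh_dist_eq x z y
    rw [← cosh_dist_base, ← cosh_dist_base, ezy, Real.cosh_sub] at h1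
    linarith
  have hW : coordW x z = (Real.sinh (dist x z) / Real.sinh (dist x y)) • coordW x y := by
    rw [← sub_eq_zero, ← norm_eq_zero, ← sq_eq_zero_iff, norm_sub_sq_real, norm_smul,
      inner_smul_right, hin, mul_pow, norm_coordW_sq, norm_coordW_sq, Real.norm_eq_abs, sq_abs]
    field_simp
    ring
  have hpos : 0 < Real.sinh (dist z y) / Real.sinh (dist x y) +
      Real.sinh (dist x z) / Real.sinh (dist x y) := by
    rw [← add_div]
    apply div_pos _ hd
    rcases eq_or_ne x z with rfl | hxz
    · simpa using hd
    · have : 0 < Real.sinh (dist x z) := Real.sinh_pos_iff.2 (dist_pos.2 hxz)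
      linarith
  refine ⟨_, _, div_nonneg hd2 hd.le, div_nonneg hd1 hd.le, hpos, fun q => ?_⟩
  obtain ⟨a, b, -, hab⟩ := exists_linForm_eq_quadForm x q
  rw [hab, hab, hab, linForm_self, linForm, linForm, hT, hW, inner_smul_right]
  ring

/-! ### Connectedness via the cone of positive definite forms -/

/-- The point of `ℍ` on the ray spanned by a positive definite form. -/
noncomputable def ofCone (p : ℝ × ℝ × ℝ) : ℍ :=
  if h : 0 < p.2.2 ∧ 0 < p.1 * p.2.2 - p.2.1 ^ 2 then
    ⟨⟨p.2.1 / p.2.2, √(p.1 * p.2.2 - p.2.1 ^ 2) / p.2.2⟩, div_pos (Real.sqrt_pos.2 h.2) h.1⟩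
  else UpperHalfPlane.I

/-- The cone of positive definite forms, as an intersection of half-spaces. -/
def posCone : Set (ℝ × ℝ × ℝ) := {p | 0 < p.2.2 ∧ ∀ s : ℝ, 0 < p.1 + 2 * s * p.2.1 + s ^ 2 * p.2.2}

lemma posCone_disc {p : ℝ × ℝ × ℝ} (hp : p ∈ posCone) : 0 < p.1 * p.2.2 - p.2.1 ^ 2 := by
  have h := hp.2 (-p.2.1 / p.2.2)
  have h1 := hp.1
  have h2 : p.1 + 2 * (-p.2.1 / p.2.2) * p.2.1 + (-p.2.1 / p.2.2) ^ 2 * p.2.2 =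
      (p.1 * p.2.2 - p.2.1 ^ 2) / p.2.2 := by field_simp; ring
  rw [h2] at h
  exact (div_pos_iff_of_pos_right h1).1 h

lemma ofCone_of_mem {p : ℝ × ℝ × ℝ} (hp : p ∈ posCone) : (ofCone p : ℂ) =
    ⟨p.2.1 / p.2.2, √(p.1 * p.2.2 - p.2.1 ^ 2) / p.2.2⟩ := by
  rw [ofCone, dif_pos ⟨hp.1, posCone_disc hp⟩]

lemma quadForm_ofCone {p : ℝ × ℝ × ℝ} (hp : p ∈ posCone) (q : ℝ × ℝ × ℝ) :
    quadForm q (ofCone p) =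
      (q.1 * p.1 + q.2.1 * p.2.1 + q.2.2 * p.2.2) / √(p.1 * p.2.2 - p.2.1 ^ 2) := by
  have h1 := hp.1.ne'
  have h2 := (Real.sqrt_pos.2 (posCone_disc hp)).ne'
  have h3 := Real.sq_sqrt (posCone_disc hp).le
  simp only [quadForm, ← UpperHalfPlane.coe_re, ← UpperHalfPlane.coe_im, ofCone_of_mem hp]
  rw [div_pow, div_pow, h3]
  field_simp
  ring

lemma continuousOn_ofCone : ContinuousOn ofCone posCone := by
  rw [UpperHalfPlane.isEmbedding_coe.continuousOn_iff]
  have : ContinuousOn (fun p : ℝ × ℝ × ℝ => Complex.equivRealProdCLM.symm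
      (p.2.1 / p.2.2, √(p.1 * p.2.2 - p.2.1 ^ 2) / p.2.2)) posCone := by
    refine Complex.equivRealProdCLM.symm.continuous.comp_continuousOn ?_
    refine ContinuousOn.prodMk ?_ ?_
    · exact ContinuousOn.div (by fun_prop) (by fun_prop) fun p hp => hp.1.ne'
    · exact ContinuousOn.div (by fun_prop) (by fun_prop) fun p hp => hp.1.ne'
  refine this.congr fun p hp => ?_
  simp only [Function.comp_apply, ofCone_of_mem hp]
  apply Complex.ext <;> simp

lemma exists_mem_posCone (z : ℍ) : ∃ p ∈ posCone, ofCone p = z := by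
  have h := z.im_ne_zero
  have h1 := z.im_pos
  have hp : ((z.re ^ 2 + z.im ^ 2) / z.im, z.re / z.im, 1 / z.im) ∈ posCone := by
    refine ⟨by positivity, fun s => ?_⟩
    have : (z.re ^ 2 + z.im ^ 2) / z.im + 2 * s * (z.re / z.im) + s ^ 2 * (1 / z.im) =
      ((z.re + s) ^ 2 + z.im ^ 2) / z.im := by field_simp; ring
    simp only [this]
    positivity
  refine ⟨_, hp, ?_⟩
  apply UpperHalfPlane.ext
  rw [ofCone_of_mem hp]
  have e : (z.re ^ 2 + z.im ^ 2) / z.im * (1 / z.im) - (z.re / z.im) ^ 2 = 1 := by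
    field_simp; ring
  apply Complex.ext
  · simp [h]
  · simp only [e, Real.sqrt_one, UpperHalfPlane.coe_im]
    field_simp

/-- Intersections of half-planes and geodesics are connected. -/
lemma isPreconnected_forms (Q Q' : Set (ℝ × ℝ × ℝ)) :
    IsPreconnected {z | (∀ q ∈ Q, 0 < quadForm q z) ∧ ∀ q ∈ Q', quadForm q z = 0} := by
  set L : ℝ × ℝ × ℝ → ℝ × ℝ × ℝ → ℝ := fun q p => q.1 * p.1 + q.2.1 * p.2.1 + q.2.2 * p.2.2 with hL
  set C : Set (ℝ × ℝ × ℝ) := {p | p ∈ posCone ∧ (∀ q ∈ Q, 0 < L q p) ∧ ∀ q ∈ Q', L q p = 0} with hC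
  have hcomb {a b x y : ℝ} (ha : 0 ≤ a) (hb : 0 ≤ b) (hab : a + b = 1) (hx : 0 < x) (hy : 0 < y) :
      0 < a * x + b * y := by
    rcases ha.eq_or_lt with rfl | ha
    · obtain rfl : b = 1 := by linarith
      simpa
    · have := mul_pos ha hx
      have := mul_nonneg hb hy.le
      linarith
  -- Every condition is linear in p, including positive definiteness as spelled out in `posCone`.
  -- This is the projective model, where intersections of half-planes and geodesics are convex.
  have hconv : Convex ℝ C := by
    rintro p ⟨hp1, hp2, hp3⟩ p' ⟨hp1', hp2', hp3'⟩ a b ha hb hab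
    refine ⟨⟨hcomb ha hb hab hp1.1 hp1'.1, fun s => ?_⟩, fun q hq => ?_, fun q hq => ?_⟩
    · have := hcomb ha hb hab (hp1.2 s) (hp1'.2 s)
      simp only [Prod.fst_add, Prod.snd_add, Prod.smul_fst, Prod.smul_snd, smul_eq_mul]
      linarith
    · have := hcomb ha hb hab (hp2 q hq) (hp2' q hq)
      simp only [hL, Prod.fst_add, Prod.snd_add, Prod.smul_fst, Prod.smul_snd, smul_eq_mul] at *
      linarith
    · have h1 := hp3 q hq
      have h2 := hp3' q hq
      simp only [hL, Prod.fst_add, Prod.snd_add, Prod.smul_fst, Prod.smul_snd, smul_eq_mul] at *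
      linear_combination a * h1 + b * h2
  have himg : {z | (∀ q ∈ Q, 0 < quadForm q z) ∧ ∀ q ∈ Q', quadForm q z = 0} = ofCone '' C := by
    ext z
    constructor
    · rintro ⟨h1, h2⟩
      obtain ⟨p, hp, rfl⟩ := exists_mem_posCone z
      have hs := Real.sqrt_pos.2 (posCone_disc hp)
      refine ⟨p, ⟨hp, fun q hq => ?_, fun q hq => ?_⟩, rfl⟩
      · have := h1 q hq
        rw [quadForm_ofCone hp] at this
        exact (div_pos_iff_of_pos_right hs).1 this
      · have := h2 q hq
        rw [quadForm_ofCone hp, div_eq_zero_iff] at this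
        exact this.resolve_right hs.ne'
    · rintro ⟨p, ⟨hp, h1, h2⟩, rfl⟩
      have hs := Real.sqrt_pos.2 (posCone_disc hp)
      refine ⟨fun q hq => ?_, fun q hq => ?_⟩
      · rw [quadForm_ofCone hp]; exact div_pos (h1 q hq) hs
      · rw [quadForm_ofCone hp]
        have := h2 q hq
        simp only [hL] at this
        rw [this, zero_div]
  rw [himg]
  exact hconv.isPreconnected.image _ (continuousOn_ofCone.mono fun p hp => hp.1)

/-! ### Regions bounded by geodesics -/

lemma pos_of_isPreconnected {S : Set ℍ} (hS : IsPreconnected S) {f : ℍ → ℝ}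
    (hf : Continuous f) (h0 : ∀ z ∈ S, f z ≠ 0) {x : ℍ} (hx : x ∈ S) (hfx : 0 < f x) :
    ∀ z ∈ S, 0 < f z := by
  intro z hz
  by_contra! h
  obtain ⟨y, hy, hy0⟩ := hS.intermediate_value hz hx hf.continuousOn ⟨h, hfx.le⟩
  exact h0 y hy hy0

lemma quadForm_neg (q : ℝ × ℝ × ℝ) (z : ℍ) : quadForm (-q) z = -quadForm q z := by
  have := quadForm_smul (-1) q z
  rwa [neg_one_smul, neg_one_mul] at this

lemma formDisc_neg (q : ℝ × ℝ × ℝ) : formDisc (-q) = formDisc q := by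
  simp [formDisc]

lemma zeroSet_neg (q : ℝ × ℝ × ℝ) : {z | quadForm (-q) z = 0} = {z | quadForm q z = 0} := by
  simp [quadForm_neg]

lemma isPreconnected_halfPlane (q : ℝ × ℝ × ℝ) : IsPreconnected {z | 0 < quadForm q z} := by
  simpa using isPreconnected_forms {q} ∅

lemma isPreconnected_zeroSet (q : ℝ × ℝ × ℝ) : IsPreconnected {z | quadForm q z = 0} := by
  simpa using isPreconnected_forms ∅ {q}

lemma exists_pos_form {g S : Set ℍ} (hg : IsGeodesic g) (hS : IsPreconnected S) {x : ℍ}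
    (hx : x ∈ S) (hd : Disjoint S g) :
    ∃ q, 0 < formDisc q ∧ g = {z | quadForm q z = 0} ∧ ∀ z ∈ S, 0 < quadForm q z := by
  obtain ⟨q, hq, rfl⟩ := isGeodesic_iff.1 hg
  have h0 : ∀ z ∈ S, quadForm q z ≠ 0 := fun z hz h => Set.disjoint_left.1 hd hz h
  rcases (h0 x hx).lt_or_gt with h | h
  · refine ⟨-q, by rwa [formDisc_neg], (zeroSet_neg q).symm, ?_⟩
    refine pos_of_isPreconnected hS (continuous_quadForm _) ?_ hx ?_
    · intro z hz; rw [quadForm_neg]; simpa using h0 z hz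
    · rw [quadForm_neg]; linarith
  · exact ⟨q, hq, rfl, pos_of_isPreconnected hS (continuous_quadForm _) h0 hx h⟩

lemma IsComponentOf.exists_form {g K : Set ℍ} (hg : IsGeodesic g) (hK : IsComponentOf K gᶜ) :
    ∃ q, 0 < formDisc q ∧ g = {z | quadForm q z = 0} ∧ K = {z | 0 < quadForm q z} := by
  obtain ⟨x, hx, rfl⟩ := hK
  obtain ⟨q, hq, hgq, hpos⟩ := exists_pos_form hg isPreconnected_connectedComponentIn
    (mem_connectedComponentIn hx)
    (Set.disjoint_left.2 fun z hz => connectedComponentIn_subset _ _ hz)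
  refine ⟨q, hq, hgq, Set.Subset.antisymm hpos ?_⟩
  refine (isPreconnected_halfPlane q).subset_connectedComponentIn
    (hpos x (mem_connectedComponentIn hx)) fun z hz hz' => ?_
  rw [hgq] at hz'
  exact (ne_of_gt hz) hz'

/-- In coordinates based at the zero p the form is ⟨b, W⟩ with b ≠ 0, so it is negative along the
ray in direction -b. -/
lemma mem_closure_neg {q : ℝ × ℝ × ℝ} (hq : 0 < formDisc q) {p : ℍ} (hp : quadForm q p = 0) :
    p ∈ closure {z | quadForm q z < 0} := by
  obtain ⟨a, b, hab, h⟩ := exists_linForm_eq_quadForm p q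
  have ha : a = 0 := by rw [← linForm_self p a b, ← h, hp]
  subst ha
  have hb : b ≠ 0 := by rintro rfl; simp at hab; linarith
  have hc : Filter.Tendsto (fun s : ℝ => (coordHomeo p).symm (-(s • b)))
      (nhdsWithin 0 (Set.Ioi 0)) (nhds p) := by
    have h1 : Continuous fun s : ℝ => (coordHomeo p).symm (-(s • b)) :=
      (coordHomeo p).symm.continuous.comp (by fun_prop)
    have h2 : (coordHomeo p).symm (-((0 : ℝ) • b)) = p := by
      rw [Homeomorph.symm_apply_eq]; simp
    have h3 := h1.tendsto 0
    rw [h2] at h3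
    exact h3.mono_left nhdsWithin_le_nhds
  refine mem_closure_of_tendsto hc ?_
  filter_upwards [self_mem_nhdsWithin] with s hs
  have hs : 0 < s := hs
  simp only [h, linForm, coordW_symm, inner_neg_right, inner_smul_right,
    zero_mul, zero_add, real_inner_self_eq_norm_sq]
  have := norm_pos_iff.2 hb
  have : 0 < s * ‖b‖ ^ 2 := by positivity
  linarith

lemma IsGeodesic.nonempty {g : Set ℍ} (hg : IsGeodesic g) : g.Nonempty := by
  obtain ⟨a, rfl⟩ | ⟨a, r, hr, rfl⟩ := hg
  · exact ⟨⟨⟨a, 1⟩, one_pos⟩, rfl⟩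
  · refine ⟨⟨⟨a, r⟩, hr⟩, ?_⟩
    simp [halfCircle]

/-- The witness has W = -v, where v is the sum of the two unit normals. Both inner products with v
equal the norm times t = 1 + cos(angle) ≥ 1/2, whereas T = √(1 + 2t) ≤ 4t; this is where the factor
4 comes from. -/
lemma exists_common_nonpos {a a' : ℝ} {b b' : ℂ} (ha : 0 < a) (ha' : 0 < a') (hb : 4 * a < ‖b‖)
    (hb' : 4 * a' < ‖b'‖) (h : -(‖b‖ * ‖b'‖) / 2 ≤ inner ℝ b b') (z : ℍ) :
    ∃ w, linForm z a b w ≤ 0 ∧ linForm z a' b' w ≤ 0 := by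
  have hn : 0 < ‖b‖ := by linarith
  have hn' : 0 < ‖b'‖ := by linarith
  set t : ℝ := 1 + inner ℝ b b' / (‖b‖ * ‖b'‖) with ht
  have ht1 : 1 / 2 ≤ t := by
    have : -(1 / 2) ≤ inner ℝ b b' / (‖b‖ * ‖b'‖) := by
      rw [le_div_iff₀ (by positivity)]; linarith
    linarith
  set v : ℂ := ‖b‖⁻¹ • b + ‖b'‖⁻¹ • b' with hv
  have hv1 : inner ℝ b v = ‖b‖ * t := by
    rw [hv, inner_add_right, inner_smul_right, inner_smul_right, real_inner_self_eq_norm_sq, ht]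
    field_simp
  have hv2 : inner ℝ b' v = ‖b'‖ * t := by
    rw [hv, inner_add_right, inner_smul_right, inner_smul_right, real_inner_self_eq_norm_sq, ht,
      real_inner_comm]
    field_simp
    ring
  have hv3 : ‖v‖ ^ 2 = 2 * t := by
    rw [← real_inner_self_eq_norm_sq]
    nth_rw 1 [hv]
    rw [inner_add_left, inner_smul_left, inner_smul_left, hv1, hv2]
    simp
    field_simp
    ring
  have hT : √(1 + ‖-v‖ ^ 2) ≤ 4 * t := by
    rw [Real.sqrt_le_left (by linarith), norm_neg, hv3]
    nlinarith
  have hT0 := Real.sqrt_nonneg (1 + ‖-v‖ ^ 2)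
  refine ⟨(coordHomeo z).symm (-v), ?_, ?_⟩
  · rw [linForm, coordT_symm, coordW_symm, inner_neg_right, hv1]
    nlinarith
  · rw [linForm, coordT_symm, coordW_symm, inner_neg_right, hv2]
    nlinarith

/-- If all pairs of the three unit vectors had inner product below -1/2, the square of their sum
would be negative. -/
lemma exists_pair_inner (b : Fin 3 → ℂ) (hb : ∀ i, b i ≠ 0) :
    ∃ i j, i ≠ j ∧ -(‖b i‖ * ‖b j‖) / 2 ≤ inner ℝ (b i) (b j) := by
  by_contra! h
  have hn (i) : 0 < ‖b i‖ := norm_pos_iff.2 (hb i)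
  have key (i j) (hij : i ≠ j) : inner ℝ (‖b i‖⁻¹ • b i) (‖b j‖⁻¹ • b j) < -1 / 2 := by
    have := h i j hij
    rw [inner_smul_left, inner_smul_right]
    have h1 := hn i
    have h2 := hn j
    simp only [conj_trivial]
    rw [← mul_assoc, ← mul_inv, inv_mul_lt_iff₀ (by positivity)]
    linarith
  have h1 (i) : inner ℝ (‖b i‖⁻¹ • b i) (‖b i‖⁻¹ • b i) = 1 := by
    rw [real_inner_self_eq_norm_sq, norm_smul, norm_inv, norm_norm, inv_mul_cancel₀ (hn i).ne']
    norm_num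
  generalize hu : (fun i => ‖b i‖⁻¹ • b i) = u at *
  have hu' (i) : ‖b i‖⁻¹ • b i = u i := by rw [← hu]
  simp only [hu'] at key h1
  have h3 : 0 ≤ inner ℝ (u 0 + u 1 + u 2) (u 0 + u 1 + u 2) := real_inner_self_nonneg
  simp only [inner_add_left, inner_add_right, h1] at h3
  have := key 0 1 (by decide)
  have := key 1 0 (by decide)
  have := key 0 2 (by decide)
  have := key 2 0 (by decide)
  have := key 1 2 (by decide)
  have := key 2 1 (by decide)
  linarith

/-- A family of pairwise disjoint half-planes is locally finite, in the sense that the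
complement of their union is open. -/
lemma isOpen_iInter_pos {ι : Type*} (q : ι → ℝ × ℝ × ℝ)
    (hdis : ∀ i j, i ≠ j → ∀ z, quadForm (q i) z ≤ 0 → 0 < quadForm (q j) z) :
    IsOpen {z | ∀ i, 0 < quadForm (q i) z} := by
  rw [isOpen_iff_mem_nhds]
  intro z hz
  choose a b hab h using fun i => exists_linForm_eq_quadForm z (q i)
  have ha (i) : 0 < a i := by
    have := hz i
    rwa [h, linForm_self] at this
  -- A form with ‖b i‖ ≤ 4 a i stays positive as long as ‖W‖ < 1/4, so only the other ones can
  -- obstruct a neighbourhood of z. Among three of those, two have normals at an angle of at most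
  -- 120°, so that their half-planes would meet.
  have hfin : {i | 4 * a i < ‖b i‖}.Finite := by
    by_contra hinf
    obtain ⟨t, ht, hcard⟩ := (Set.not_finite.1 hinf).exists_subset_card_eq 3
    obtain ⟨e⟩ : Nonempty (Fin 3 ≃ t) := ⟨(Finset.equivFinOfCardEq hcard).symm⟩
    have he (k) : 4 * a (e k) < ‖b (e k)‖ := ht (e k).2
    obtain ⟨k, l, hkl, hin⟩ := exists_pair_inner (fun k => b (e k)) fun k h0 => by
      have := he k
      rw [h0, norm_zero] at this
      linarith [ha (e k)]
    obtain ⟨w, hw, hw'⟩ := exists_common_nonpos (ha (e k)) (ha (e l)) (he k) (he l) hin z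
    rw [← h] at hw hw'
    have := hdis (e k) (e l) (fun h => hkl (e.injective (Subtype.ext h))) w hw
    linarith
  have h1 : ∀ᶠ w in nhds z, ∀ i ∈ {i | 4 * a i < ‖b i‖}, 0 < quadForm (q i) w :=
    (Filter.eventually_all_finite hfin).2 fun i _ =>
      (continuous_quadForm (q i)).continuousAt.eventually (lt_mem_nhds (hz i))
  have h2 : ∀ᶠ w in nhds z, ‖coordW z w‖ < 1 / 4 := by
    have := ((continuous_coordW z).norm).tendsto z
    rw [coordW_self, norm_zero] at this
    exact this.eventually (gt_mem_nhds (by norm_num))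
  filter_upwards [h1, h2] with w hw1 hw2 i
  by_cases hi : 4 * a i < ‖b i‖
  · exact hw1 i hi
  · rw [h, linForm]
    have h3 := abs_le.1 (abs_real_inner_le_norm (b i) (coordW z w))
    have h4 := one_le_coordT z w
    have h5 := ha i
    have h6 : ‖b i‖ * ‖coordW z w‖ ≤ 4 * a i * ‖coordW z w‖ := by
      gcongr; linarith
    nlinarith [h3.1]

/-- Since all of `𝒢` lies in the closure of `D`, each geodesic is strictly on the positive side of
every other one. The disjointness of the closed outer half-planes replaces any assumption of local
finiteness on `𝒢`. -/
lemma IsRegionOf.exists_forms {D : Set ℍ} {𝒢 : Set (Set ℍ)} (hD : IsRegionOf D 𝒢)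
    (hg : ∀ ℓ ∈ 𝒢, IsGeodesic ℓ) (hd : 𝒢.PairwiseDisjoint id) :
    ∃ q : 𝒢 → ℝ × ℝ × ℝ, (∀ i, 0 < formDisc (q i) ∧ i.1 = {z | quadForm (q i) z = 0}) ∧
      D = {z | ∀ i, 0 < quadForm (q i) z} ∧
      ∀ i j, i ≠ j → ∀ z, quadForm (q i) z ≤ 0 → 0 < quadForm (q j) z := by
  obtain ⟨⟨x, hx, rfl⟩, hfr⟩ := hD
  set D := connectedComponentIn (⋃₀ 𝒢)ᶜ x with hDdef
  have hDsub : D ⊆ (⋃₀ 𝒢)ᶜ := connectedComponentIn_subset _ _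
  have hxD : x ∈ D := mem_connectedComponentIn hx
  choose q hq hZ hpos using fun i : 𝒢 => exists_pos_form (hg i i.2)
    (isPreconnected_connectedComponentIn (x := x) (F := (⋃₀ 𝒢)ᶜ)) hxD
    (Set.disjoint_left.2 fun z hz hz' => hDsub hz ⟨i, i.2, hz'⟩)
  have hcl (i : 𝒢) : closure D ⊆ {z | 0 ≤ quadForm (q i) z} :=
    closure_minimal (fun z hz => (hpos i z hz).le)
      (isClosed_le continuous_const (continuous_quadForm _))
  have hother (i j : 𝒢) (hij : i ≠ j) : ∀ z ∈ j.1, 0 < quadForm (q i) z := by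
    intro z hz
    refine lt_of_le_of_ne (hcl i (hfr ⟨j, j.2, hz⟩).1) fun h => ?_
    refine Set.disjoint_left.1 (hd j.2 i.2 (fun h => hij (Subtype.ext h.symm))) hz ?_
    change z ∈ i.1
    rw [hZ i]
    exact h.symm
  refine ⟨q, fun i => ⟨hq i, hZ i⟩, Set.Subset.antisymm (fun z hz i => hpos i z hz) ?_, ?_⟩
  · have : {z | ∀ i, 0 < quadForm (q i) z} =
        {z | (∀ q' ∈ Set.range q, 0 < quadForm q' z) ∧ ∀ q' ∈ (∅ : Set (ℝ × ℝ × ℝ)),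
          quadForm q' z = 0} := by
      ext; simp only [Set.forall_mem_range, Set.mem_ofPred_eq, Set.mem_empty_iff_false,
        false_imp_iff, implies_true, and_true]
    rw [this]
    refine (isPreconnected_forms _ _).subset_connectedComponentIn ?_ ?_
    · exact ⟨Set.forall_mem_range.2 fun i => hpos i x hxD, fun _ h => h.elim⟩
    · rintro z ⟨hz, -⟩ ⟨ℓ, hℓ, hzℓ⟩
      have h1 := hz _ ⟨⟨ℓ, hℓ⟩, rfl⟩
      have h2 := hZ ⟨ℓ, hℓ⟩
      simp only at h2
      rw [h2] at hzℓ
      exact h1.ne' hzℓ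
  · intro i j hij z hz
    rcases hz.eq_or_lt with hz | hz
    · exact hother j i hij.symm z (by rw [hZ i]; exact hz)
    -- The half-plane where `q i` is negative misses the geodesic j. So if `q j` were negative
    -- somewhere on it, it would be so everywhere, and by closure `q j` would be nonpositive on the
    -- geodesic i, against `hother`.
    · by_contra! hneg
      have hne : ∀ w ∈ {w | 0 < quadForm (-q i) w}, quadForm (-q j) w ≠ 0 := by
        intro w hw h0
        simp only [Set.mem_ofPred_eq, quadForm_neg] at hw
        rw [quadForm_neg, neg_eq_zero] at h0
        have := hother i j hij w (by rw [hZ j]; exact h0)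
        linarith
      have hz' : z ∈ {w | 0 < quadForm (-q i) w} := by
        simp only [Set.mem_ofPred_eq, quadForm_neg]; linarith
      have hlt : 0 < quadForm (-q j) z := by
        refine lt_of_le_of_ne ?_ (hne z hz').symm
        rw [quadForm_neg]; linarith
      have hsub := pos_of_isPreconnected (isPreconnected_halfPlane (-q i))
        (continuous_quadForm _) hne hz' hlt
      obtain ⟨p, hp⟩ := (hg i i.2).nonempty
      have hp0 : quadForm (q i) p = 0 := by rw [hZ i] at hp; exact hp
      have h1 : p ∈ closure {z | quadForm (q i) z < 0} := mem_closure_neg (hq i) hp0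
      have h2 : closure {z | quadForm (q i) z < 0} ⊆ {z | quadForm (q j) z ≤ 0} := by
        refine closure_minimal (fun w hw => ?_)
          (isClosed_le (continuous_quadForm _) continuous_const)
        have := hsub w (by simp only [Set.mem_ofPred_eq, quadForm_neg] at hw ⊢; linarith)
        rw [quadForm_neg] at this
        simp only [Set.mem_ofPred_eq]
        linarith
      have h3 : quadForm (q j) p ≤ 0 := h2 h1
      have h4 := hother j i hij.symm p hp
      linarith

variable {D : Set ℍ} {𝒢 : Set (Set ℍ)}

lemma IsRegionOf.isOpen (hD : IsRegionOf D 𝒢) (hg : ∀ ℓ ∈ 𝒢, IsGeodesic ℓ)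
    (hd : 𝒢.PairwiseDisjoint id) : IsOpen D := by
  obtain ⟨q, hq, rfl, h⟩ := hD.exists_forms hg hd
  exact isOpen_iInter_pos q h

lemma IsRegionOf.nonempty (hD : IsRegionOf D 𝒢) : D.Nonempty := by
  obtain ⟨⟨x, hx, rfl⟩, -⟩ := hD
  exact ⟨x, mem_connectedComponentIn hx⟩

lemma IsRegionOf.isGeodConvex (hD : IsRegionOf D 𝒢) (hg : ∀ ℓ ∈ 𝒢, IsGeodesic ℓ)
    (hd : 𝒢.PairwiseDisjoint id) : IsGeodConvex D := by
  obtain ⟨q, hq, rfl, -⟩ := hD.exists_forms hg hd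
  intro x hx y hy z hz i
  obtain ⟨α, β, hα, hβ, hαβ, h⟩ := exists_combination hz
  have h1 := hx i
  have h2 := hy i
  rw [h]
  rcases hα.eq_or_lt with rfl | hα
  · have := mul_pos (show 0 < β by linarith) h2
    linarith
  · have := mul_pos hα h1
    have := mul_nonneg hβ h2.le
    linarith

lemma IsRegionOf.frontier_eq (hD : IsRegionOf D 𝒢) (hg : ∀ ℓ ∈ 𝒢, IsGeodesic ℓ)
    (hd : 𝒢.PairwiseDisjoint id) : frontier D = ⋃₀ 𝒢 := by
  refine Set.Subset.antisymm ?_ hD.2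
  have ho := hD.isOpen hg hd
  obtain ⟨q, hq, rfl, -⟩ := hD.exists_forms hg hd
  rw [ho.frontier_eq]
  rintro z ⟨hz, hz'⟩
  by_contra hzG
  refine hz' fun i => lt_of_le_of_ne ?_ fun h => hzG ⟨i, i.2, ?_⟩
  · have : closure {z | ∀ i, 0 < quadForm (q i) z} ⊆ {z | 0 ≤ quadForm (q i) z} :=
      closure_minimal (fun z hz => (hz i).le) (isClosed_le continuous_const (continuous_quadForm _))
    exact this hz
  · rw [(hq i).2]; exact h.symm

/-- Points with a negative form accumulate at each boundary geodesic, so passing to the closure does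
not swallow it. This allows orbifolds with and without boundary to be treated alike. -/
lemma IsRegionOf.frontier_closure_eq (hD : IsRegionOf D 𝒢) (hg : ∀ ℓ ∈ 𝒢, IsGeodesic ℓ)
    (hd : 𝒢.PairwiseDisjoint id) : frontier (closure D) = ⋃₀ 𝒢 := by
  refine Set.Subset.antisymm (frontier_closure_subset.trans (hD.frontier_eq hg hd).subset) ?_
  obtain ⟨q, hq, hDq, -⟩ := hD.exists_forms hg hd
  rintro z ⟨ℓ, hℓ, hz⟩
  rw [isClosed_closure.frontier_eq]
  refine ⟨(hD.2 ⟨ℓ, hℓ, hz⟩).1, fun hint => ?_⟩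
  have hz0 : quadForm (q ⟨ℓ, hℓ⟩) z = 0 := by
    have := (hq ⟨ℓ, hℓ⟩).2
    simp only at this
    rw [this] at hz
    exact hz
  obtain ⟨w, hw1, hw2⟩ := mem_closure_iff.1 (mem_closure_neg (hq ⟨ℓ, hℓ⟩).1 hz0) _
    isOpen_interior hint
  have hcl : closure D ⊆ {z | 0 ≤ quadForm (q ⟨ℓ, hℓ⟩) z} := by
    rw [hDq]
    exact closure_minimal (fun z hz => (hz _).le)
      (isClosed_le continuous_const (continuous_quadForm _))
  have h1 : 0 ≤ quadForm (q ⟨ℓ, hℓ⟩) w := hcl (interior_subset hw1)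
  have h2 : quadForm (q ⟨ℓ, hℓ⟩) w < 0 := hw2
  linarith

/-! ### Directions -/

/-- The unit complex number at angle `2 π t / m`. -/
noncomputable def unitDir (m : ℕ) (t : ℝ) : ℂ :=
  Complex.exp ((2 * Real.pi * t / m : ℝ) * Complex.I)

@[simp] lemma norm_unitDir (m : ℕ) (t : ℝ) : ‖unitDir m t‖ = 1 := Complex.norm_exp_ofReal_mul_I _

lemma unitDir_add (m : ℕ) (s t : ℝ) : unitDir m (s + t) = unitDir m s * unitDir m t := by
  rw [unitDir, unitDir, unitDir, ← Complex.exp_add]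
  congr 1
  push_cast
  ring

@[simp] lemma unitDir_zero (m : ℕ) : unitDir m 0 = 1 := by simp [unitDir]

lemma unitDir_neg (m : ℕ) (t : ℝ) : unitDir m (-t) = (unitDir m t)⁻¹ := by
  rw [unitDir, unitDir, ← Complex.exp_neg]
  congr 1
  push_cast
  ring

lemma conj_unitDir (m : ℕ) (t : ℝ) : starRingEnd ℂ (unitDir m t) = unitDir m (-t) := by
  rw [unitDir, unitDir, ← Complex.exp_conj]
  congr 1
  simp only [map_mul, Complex.conj_ofReal, Complex.conj_I]
  push_cast
  ring

lemma unitDir_eq_one_iff {m : ℕ} (hm : m ≠ 0) {t : ℝ} : unitDir m t = 1 ↔ ∃ k : ℤ, t = k * m := by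
  have h1 : (2 * Real.pi * Complex.I : ℂ) ≠ 0 := Complex.two_pi_I_ne_zero
  have h2 : (m : ℂ) ≠ 0 := by exact_mod_cast hm
  rw [unitDir, Complex.exp_eq_one_iff]
  refine exists_congr fun k => ?_
  have e : ((2 * Real.pi * t / m : ℝ) : ℂ) * Complex.I = (t / m : ℂ) * (2 * Real.pi * Complex.I) := by
    push_cast; ring
  rw [e, mul_left_inj' h1, div_eq_iff h2]
  norm_cast

lemma unitDir_intCast (m : ℕ) (j : ℤ) : unitDir m j = unitDir m 1 ^ j := by
  rw [unitDir, unitDir, ← Complex.exp_int_mul]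
  congr 1
  push_cast
  ring

lemma unitDir_zpow (m : ℕ) (t : ℝ) (i : ℤ) : unitDir m t ^ i = unitDir m (i * t) := by
  rw [unitDir, unitDir, ← Complex.exp_int_mul]
  congr 1
  push_cast
  ring

lemma exists_unitDir {m : ℕ} (hm : m ≠ 0) {u : ℂ} (hu : ‖u‖ = 1) : ∃ t, u = unitDir m t := by
  have h2 : (m : ℝ) ≠ 0 := by exact_mod_cast hm
  have := Real.pi_ne_zero
  refine ⟨m * u.arg / (2 * Real.pi), ?_⟩
  have e : 2 * Real.pi * (m * u.arg / (2 * Real.pi)) / m = u.arg := by field_simp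
  rw [unitDir, e]
  conv_lhs => rw [← Complex.norm_mul_exp_arg_mul_I u, hu]
  simp

lemma inner_mul_unit {ρ : ℂ} (hρ : ‖ρ‖ = 1) (u v : ℂ) : inner ℝ (ρ * u) (ρ * v) = inner ℝ u v := by
  have h : ρ.re * ρ.re + ρ.im * ρ.im = 1 := by
    rw [← Complex.normSq_apply, Complex.normSq_eq_norm_sq, hρ]; norm_num
  simp only [inner_eq_re_im, Complex.mul_re, Complex.mul_im]
  linear_combination (u.re * v.re + u.im * v.im) * h

/-- `t` is a direction of `w`, measured from the direction of `c` in units of `2 π / m`. -/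
def IsDir (m : ℕ) (c w : ℂ) (t : ℝ) : Prop := w = ‖w‖ * (c / ‖c‖ * unitDir m t)

lemma exists_isDir {m : ℕ} (hm : m ≠ 0) {c : ℂ} (hc : c ≠ 0) (w : ℂ) : ∃ t, IsDir m c w t := by
  have hc' : (‖c‖ : ℂ) ≠ 0 := by exact_mod_cast norm_ne_zero_iff.2 hc
  rcases eq_or_ne w 0 with rfl | hw
  · exact ⟨0, by simp [IsDir]⟩
  have hw' : (‖w‖ : ℂ) ≠ 0 := by exact_mod_cast norm_ne_zero_iff.2 hw
  have hn : ‖w / ‖w‖ * (‖c‖ / c)‖ = 1 := by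
    simp [norm_ne_zero_iff.2 hw, norm_ne_zero_iff.2 hc]
  obtain ⟨t, ht⟩ := exists_unitDir hm hn
  refine ⟨t, ?_⟩
  rw [IsDir, ← ht]
  field_simp

lemma IsDir.mul {m : ℕ} {c w : ℂ} {t : ℝ} (h : IsDir m c w t) (s : ℝ) :
    IsDir m c (unitDir m s * w) (s + t) := by
  rw [IsDir, norm_mul, norm_unitDir, one_mul, unitDir_add]
  conv_lhs => rw [h]
  ring

lemma inner_dir (m : ℕ) {c : ℂ} (hc : c ≠ 0) (r t : ℝ) :
    inner ℝ c (r * (c / ‖c‖ * unitDir m t)) = r * ‖c‖ * Real.cos (2 * Real.pi * t / m) := by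
  have hc' := norm_ne_zero_iff.2 hc
  have h1 : (r : ℂ) * (c / ‖c‖ * unitDir m t) = (r / ‖c‖ : ℝ) • (c * unitDir m t) := by
    rw [Complex.real_smul]; push_cast; ring
  have h2 : inner ℝ c (c * unitDir m t) = ‖c‖ ^ 2 * Real.cos (2 * Real.pi * t / m) := by
    have e1 : (unitDir m t).re = Real.cos (2 * Real.pi * t / m) := by
      rw [unitDir, Complex.exp_ofReal_mul_I_re]
    rw [← e1, inner_eq_re_im, ← Complex.normSq_eq_norm_sq, Complex.normSq_apply]
    simp only [Complex.mul_re, Complex.mul_im]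
    ring
  rw [h1, inner_smul_right, h2]
  field_simp

/-- A half-plane spans a sector of angle at most `2 π / m`. -/
lemma IsDir.exists_abs_sub_lt {m : ℕ} (hm : 2 ≤ m) {c w : ℂ} (hc : c ≠ 0)
    (hcos : ‖c‖ * Real.cos (Real.pi / m) ≤ 1) {t : ℝ} (ht : IsDir m c w t)
    (h : √(1 + ‖w‖ ^ 2) ≤ inner ℝ c w) : ∃ k : ℤ, |t - k * m| < 1 / 2 := by
  have hm0 : (0 : ℝ) < m := by exact_mod_cast (by omega : 0 < m)
  have hm1 : (2 : ℝ) ≤ m := by exact_mod_cast hm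
  have hpi := Real.pi_pos
  have hw : ‖w‖ < inner ℝ c w := lt_of_lt_of_le (Real.lt_sqrt_of_sq_lt (by linarith)) h
  have hw0 : 0 < ‖w‖ := by
    rcases eq_or_ne w 0 with rfl | hw0
    · simp at hw
    · exact norm_pos_iff.2 hw0
  have hc0 := norm_pos_iff.2 hc
  have hin : inner ℝ c w = ‖w‖ * ‖c‖ * Real.cos (2 * Real.pi * t / m) := by
    conv_lhs => rw [ht]
    exact inner_dir m hc _ _
  have h1 : 1 < ‖c‖ * Real.cos (2 * Real.pi * t / m) := by
    rw [hin, mul_assoc] at hw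
    exact (lt_mul_iff_one_lt_right hw0).1 hw
  have h2 : Real.cos (Real.pi / m) < Real.cos (2 * Real.pi * t / m) :=
    lt_of_mul_lt_mul_left (hcos.trans_lt h1) hc0.le
  -- Up to full turns, which are multiples of m in the unit of t, the angle 2πt/m has a cosine
  -- larger than cos(π/m), so it is smaller than π/m in absolute value.
  refine ⟨round (t / m), ?_⟩
  set k := round (t / m) with hk
  have h3 : |t / m - k| ≤ 1 / 2 := abs_sub_round _
  have h4 : Real.cos (2 * Real.pi * t / m) = Real.cos |2 * Real.pi * (t / m - k)| := by
    rw [Real.cos_abs, ← Real.cos_sub_int_mul_two_pi _ k]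
    congr 1; ring
  rw [h4] at h2
  have h5 : |2 * Real.pi * (t / m - k)| = 2 * Real.pi * |t / m - k| := by
    rw [abs_mul, abs_of_pos (by positivity)]
  have h6 : |2 * Real.pi * (t / m - k)| < Real.pi / m := by
    by_contra! hle
    have := Real.cos_le_cos_of_nonneg_of_le_pi (by positivity) (by rw [h5]; nlinarith) hle
    linarith
  have h7 : t - k * m = m * (t / m - k) := by field_simp
  rw [h7, abs_mul, abs_of_pos hm0]
  rw [h5, lt_div_iff₀ hm0] at h6
  nlinarith

/-! ### The coordinates of the construction -/

/-- The construction in hyperboloid coordinates with base point the fixed point of `γ`. -/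
structure RotationData (m : ℕ) (γ : SL(2, ℝ)) (𝒢₀ : Set (Set ℍ)) (z₀ : ℍ) (ρ c : ℂ) : Prop where
  two_le : 2 ≤ m
  norm_rot : ‖ρ‖ = 1
  rot : ∀ z, coordW z₀ (γ • z) = ρ * coordW z₀ z
  prim : IsPrimitiveRoot ρ m
  one_lt : 1 < ‖c‖
  cos_le : ‖c‖ * Real.cos (Real.pi / m) ≤ 1
  geodesic : ∀ ℓ ∈ 𝒢₀, IsGeodesic ℓ
  disjoint : 𝒢₀.PairwiseDisjoint id
  sector : ∀ ℓ ∈ 𝒢₀, ∀ z ∈ ℓ, coordT z₀ z ≤ inner ℝ c (coordW z₀ z)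

lemma coordW_zpow {γ : SL(2, ℝ)} {z₀ : ℍ} {ρ : ℂ} (hρ : ‖ρ‖ = 1)
    (h : ∀ z, coordW z₀ (γ • z) = ρ * coordW z₀ z) (i : ℤ) (z : ℍ) :
    coordW z₀ (γ ^ i • z) = ρ ^ i * coordW z₀ z := by
  have h0 : ρ ≠ 0 := norm_ne_zero_iff.1 (by rw [hρ]; exact one_ne_zero)
  induction i with
  | zero => simp
  | succ i ih => rw [add_comm, zpow_one_add, mul_smul, h, ih, zpow_one_add₀ h0]; ring
  | pred i ih =>
    have h1 : γ ^ (-(i : ℤ)) • z = γ • γ ^ (-(i : ℤ) - 1) • z := by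
      rw [smul_smul, ← zpow_one_add]; congr 2; ring
    rw [h1, h] at ih
    rw [zpow_sub_one₀ h0]
    field_simp
    linear_combination ih

lemma coordT_zpow {γ : SL(2, ℝ)} {z₀ : ℍ} {ρ : ℂ} (hρ : ‖ρ‖ = 1)
    (h : ∀ z, coordW z₀ (γ • z) = ρ * coordW z₀ z) (i : ℤ) (z : ℍ) :
    coordT z₀ (γ ^ i • z) = coordT z₀ z := by
  rw [coordT_eq_sqrt, coordT_eq_sqrt, coordW_zpow hρ h]
  simp [hρ]

lemma inner_zpow_smul {γ : SL(2, ℝ)} {z₀ : ℍ} {ρ : ℂ} (hρ : ‖ρ‖ = 1)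
    (h : ∀ z, coordW z₀ (γ • z) = ρ * coordW z₀ z) (i : ℤ) (c : ℂ) (z : ℍ) :
    inner ℝ c (coordW z₀ ((γ ^ i)⁻¹ • z)) = inner ℝ (ρ ^ i * c) (coordW z₀ z) := by
  have h0 : ρ ≠ 0 := norm_ne_zero_iff.1 (by rw [hρ]; exact one_ne_zero)
  rw [← inner_mul_unit (ρ := ρ ^ i) (by simp [hρ]), ← coordW_zpow hρ h, smul_inv_smul]

lemma zpow_smul_geodesic {γ : SL(2, ℝ)} {z₀ : ℍ} {ρ : ℂ} (hρ : ‖ρ‖ = 1)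
    (h : ∀ z, coordW z₀ (γ • z) = ρ * coordW z₀ z) (i : ℤ) (c : ℂ) :
    γ ^ i • {z | coordT z₀ z = inner ℝ c (coordW z₀ z)} =
      {z | coordT z₀ z = inner ℝ (ρ ^ i * c) (coordW z₀ z)} := by
  ext z
  rw [Set.mem_smul_set_iff_inv_smul_mem, Set.mem_ofPred_eq, Set.mem_ofPred_eq,
    inner_zpow_smul hρ h, ← zpow_neg, coordT_zpow hρ h]

lemma exists_radius {κ : ℝ} (hκ : 1 < κ) : ∃ τ : ℝ, 0 < τ ∧ √(1 + τ ^ 2) = τ * κ := by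
  have h : 0 < κ ^ 2 - 1 := by nlinarith
  refine ⟨(√(κ ^ 2 - 1))⁻¹, by positivity, ?_⟩
  rw [Real.sqrt_eq_iff_mul_self_eq (by positivity) (by positivity)]
  have h1 := Real.sq_sqrt h.le
  have h2 := (Real.sqrt_pos.2 h).ne'
  field_simp
  rw [h1]; ring

/-- The point of a geodesic closest to the base point. -/
lemma exists_nearest {c : ℂ} (hc : 1 < ‖c‖) (z₀ : ℍ) : ∃ z, ∃ τ : ℝ, 0 < τ ∧
    coordW z₀ z = τ • c ∧ coordT z₀ z = τ * ‖c‖ ^ 2 := by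
  obtain ⟨τ, hτ, h⟩ := exists_radius hc
  refine ⟨(coordHomeo z₀).symm ((τ / ‖c‖) • c), τ / ‖c‖, by positivity, coordW_symm _ _, ?_⟩
  have h1 : ‖(τ / ‖c‖) • c‖ = τ := by
    rw [norm_smul, Real.norm_of_nonneg (by positivity)]
    field_simp
  rw [coordT_symm, h1, h]
  field_simp

lemma eq_of_inner_eq {c c' : ℂ} (hn : ‖c'‖ = ‖c‖) (h : ‖c‖ ^ 2 ≤ inner ℝ c' c) : c' = c := by
  rw [← sub_eq_zero, ← norm_eq_zero, ← sq_eq_zero_iff]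
  have := norm_sub_sq_real c' c
  rw [hn] at this
  nlinarith [sq_nonneg ‖c' - c‖]

/-- A geodesic is determined by its normal vector. -/
lemma normal_eq {z₀ : ℍ} {c c' : ℂ} (hc : 1 < ‖c‖) (hn : ‖c'‖ = ‖c‖)
    (h : {z | coordT z₀ z = inner ℝ c (coordW z₀ z)} ⊆
      {z | coordT z₀ z ≤ inner ℝ c' (coordW z₀ z)}) : c' = c := by
  obtain ⟨z, τ, hτ, hW, hT⟩ := exists_nearest hc z₀
  have h1 : coordT z₀ z ≤ inner ℝ c' (coordW z₀ z) := by
    apply h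
    simp only [Set.mem_ofPred_eq]
    rw [hW, hT, inner_smul_right, real_inner_self_eq_norm_sq]
  rw [hW, hT, inner_smul_right] at h1
  exact eq_of_inner_eq hn (le_of_mul_le_mul_left h1 hτ)

/-! ### From the construction to rotation data -/

lemma exists_fixed_point {γ : SL(2, ℝ)} (h : γ.val.IsElliptic) : ∃ z : ℍ, γ • z = z := by
  set G := Matrix.SpecialLinearGroup.mapGL ℝ γ with hG
  have hell : G.IsElliptic := by
    have : (G : Matrix (Fin 2) (Fin 2) ℝ) = γ.val := by
      ext i j; simp [hG]
    rw [Matrix.GeneralLinearGroup.IsElliptic, this]; exact h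
  refine ⟨UpperHalfPlane.fixedPt G hell, ?_⟩
  have h1 := (UpperHalfPlane.gl_smul_eq_self_iff_eq_fixedPt (g := G)
    (z := UpperHalfPlane.fixedPt G hell) (by simp [hG]) hell).2 rfl
  exact h1

/-- The geometric hypotheses are compressed into a unit number ρ and a normal vector c. Normal
vectors are determined by geodesics, so γ^i g = g exactly when ρ^i = 1; hence ρ is a primitive m-th
root of unity. -/
lemma EllipticData.exists_rotationData {n m : ℕ} {X : Finset (Fin (2 * n))} {γ : SL(2, ℝ)}
    {g H : Set ℍ} {𝒢₀ : Set (Set ℍ)} {D D' : Set ℍ} (E : EllipticData n m X γ g H 𝒢₀ D D') :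
    ∃ z₀ ρ c, RotationData m γ 𝒢₀ z₀ ρ c ∧ g = {z | coordT z₀ z = inner ℝ c (coordW z₀ z)} := by
  obtain ⟨z₀, hfix⟩ := exists_fixed_point E.elliptic
  obtain ⟨ρ, hρ, hrot⟩ := exists_rotation hfix
  have hρ0 : ρ ≠ 0 := norm_ne_zero_iff.1 (by rw [hρ]; exact one_ne_zero)
  obtain ⟨⟨hm0, hmg⟩, hmin⟩ := E.period
  have hm2 : 2 ≤ m := by
    have h1 := E.dvd
    rcases Nat.eq_zero_or_pos n with rfl | hn
    · rw [mul_zero, zero_dvd_iff] at h1; omega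
    · have := Nat.le_of_dvd hm0 h1; omega
  have hγg : γ • g ≠ g := by
    intro h
    have := hmin (show 1 ∈ _ from ⟨one_pos, by simpa using h⟩)
    omega
  have hdisj : Disjoint g (γ • g) := by
    have := E.condition.1 1
    rw [zpow_one] at this
    exact this.resolve_right hγg
  have hz₀ : z₀ ∉ g := fun h => Set.disjoint_left.1 hdisj h ⟨z₀, h, hfix⟩
  obtain ⟨q, hq, hgq, hHq⟩ := E.halfPlane.exists_form E.geodesic
  obtain ⟨a, b, hab, hlin⟩ := exists_linForm_eq_quadForm z₀ q
  have ha : a ≠ 0 := by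
    intro ha
    apply hz₀
    rw [hgq]
    simp [hlin, ha]
  set c : ℂ := -(a⁻¹ • b) with hc
  have hlin' (z) : quadForm q z = a * (coordT z₀ z - inner ℝ c (coordW z₀ z)) := by
    rw [hlin, linForm, hc, inner_neg_left, inner_smul_left]
    simp only [conj_trivial]
    field_simp
    ring
  have hc1 : 1 < ‖c‖ := by
    rw [hc, norm_neg, norm_smul, norm_inv, Real.norm_eq_abs, inv_mul_eq_div,
      one_lt_div (abs_pos.2 ha), ← abs_of_nonneg (norm_nonneg b)]
    exact sq_lt_sq.1 (by linarith)
  have hg : g = {z | coordT z₀ z = inner ℝ c (coordW z₀ z)} := by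
    rw [hgq]; ext z; simp [hlin', ha, sub_eq_zero]
  have hpow (i : ℤ) : γ ^ i • g = g ↔ ρ ^ i = 1 := by
    rw [hg, zpow_smul_geodesic hρ hrot]
    constructor
    · intro h
      have := normal_eq (c' := ρ ^ i * c) hc1 (by simp [hρ]) (h.superset.trans fun z hz => hz.le)
      have hc0 : c ≠ 0 := norm_ne_zero_iff.1 (by linarith)
      exact mul_right_cancel₀ hc0 (by rw [this, one_mul])
    · intro h
      rw [h, one_mul]
  have hprim : IsPrimitiveRoot ρ m := by
    refine IsPrimitiveRoot.mk_of_lt ρ hm0 ?_ fun l hl hlm h => ?_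
    · have := (hpow m).1 (by simpa using hmg)
      simpa using this
    · have := hmin (show l ∈ _ from ⟨hl, by simpa using (hpow l).2 (by simpa using h)⟩)
      omega
  have hρ1 : ρ ≠ 1 := by
    intro h
    have := (hpow 1).2 (by simpa using h)
    exact hγg (by simpa using this)
  have hc0 : c ≠ 0 := norm_ne_zero_iff.1 (by linarith)
  -- `H` is the side of `g` away from `z₀`: otherwise the point of γg nearest to `z₀` would lie in
  -- `H`, which is disjoint from all translates.
  have hane : a < 0 := by
    by_contra! ha'
    have ha' := lt_of_le_of_ne ha' ha.symm
    have hn : ‖ρ * c‖ = ‖c‖ := by simp [hρ]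
    obtain ⟨z, τ, hτ, hW, hT⟩ := exists_nearest (c := ρ * c) (by rwa [hn]) z₀
    have h1 : z ∈ γ ^ (1 : ℤ) • g := by
      rw [hg, zpow_smul_geodesic hρ hrot, zpow_one, Set.mem_ofPred_eq, hT, hW, inner_smul_right,
        real_inner_self_eq_norm_sq]
    refine Set.disjoint_left.1 (E.disjoint_halfPlane 1) h1 ?_
    rw [hHq, Set.mem_ofPred_eq, hlin', hT, hW, inner_smul_right, ← mul_sub]
    refine mul_pos ha' (mul_pos hτ (sub_pos.2 ?_))
    by_contra! hle
    have := eq_of_inner_eq (c' := c) (c := ρ * c) hn.symm hle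
    exact hρ1 (mul_right_cancel₀ hc0 (by rw [← this, one_mul]))
  -- Otherwise `g` has a point at angle π/m from c, direction 1/2 in the unit of `unitDir`. By
  -- symmetry the image of `g` under the rotation by 2π/m passes through the same point, and this
  -- rotation is a power of γ because ρ generates the m-th roots of unity.
  have hcos : ‖c‖ * Real.cos (Real.pi / m) ≤ 1 := by
    by_contra! hlt
    obtain ⟨τ, hτ, h⟩ := exists_radius hlt
    have hm0' : (m : ℝ) ≠ 0 := by exact_mod_cast hm0.ne'
    have : NeZero m := ⟨hm0.ne'⟩
    have hu1 : unitDir m 1 ^ m = 1 := by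
      have := unitDir_zpow m 1 m
      rw [zpow_natCast] at this
      rw [this, unitDir_eq_one_iff hm0.ne']
      exact ⟨1, by simp⟩
    obtain ⟨j, -, hj⟩ := hprim.eq_pow_of_pow_eq_one hu1
    have hu2 : unitDir m 1 ≠ 1 := by
      rw [Ne, unitDir_eq_one_iff hm0.ne']
      rintro ⟨k, hk⟩
      have hk' : (1 : ℤ) = k * m := by exact_mod_cast hk
      have h3 : (m : ℤ) ∣ 1 := ⟨k, by linarith⟩
      have := Int.le_of_dvd one_pos h3
      omega
    have hd : Disjoint g (γ ^ (j : ℤ) • g) := by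
      refine (E.condition.1 j).resolve_right fun h => hu2 ?_
      rw [hpow, zpow_natCast, hj] at h
      exact h
    have hnorm : ‖(τ : ℂ) * (c / ‖c‖ * unitDir m (1 / 2))‖ = τ := by
      have := norm_ne_zero_iff.2 hc0
      simp [abs_of_pos hτ, this]
    have e1 : 2 * Real.pi * (1 / 2) / m = Real.pi / m := by ring
    have e2 : 2 * Real.pi * (-(1 / 2)) / m = -(Real.pi / m) := by ring
    have hmem : (coordHomeo z₀).symm (τ * (c / ‖c‖ * unitDir m (1 / 2))) ∈ g := by
      rw [hg, Set.mem_ofPred_eq, coordT_symm, coordW_symm, hnorm, h, inner_dir m hc0, e1]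
      ring
    refine Set.disjoint_left.1 hd hmem ?_
    rw [hg, zpow_smul_geodesic hρ hrot, Set.mem_ofPred_eq, coordT_symm, coordW_symm, hnorm, h,
        zpow_natCast, hj]
    have e3 : (τ : ℂ) * (c / ‖c‖ * unitDir m (1 / 2)) =
        unitDir m 1 * (τ * (c / ‖c‖ * unitDir m (-(1 / 2)))) := by
      have : unitDir m (1 / 2) = unitDir m 1 * unitDir m (-(1 / 2)) := by
        rw [← unitDir_add]; norm_num
      rw [this]; ring
    rw [e3, inner_mul_unit (norm_unitDir m 1), inner_dir m hc0, e2, Real.cos_neg]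
    ring
  refine ⟨z₀, ρ, c, ⟨hm2, hρ, hrot, hprim, hc1, hcos, E.collection_geodesic, E.collection_disjoint,
    fun ℓ hℓ z hz => ?_⟩, hg⟩
  have hcl : closure H ⊆ {z | 0 ≤ quadForm q z} := by
    rw [hHq]
    exact closure_minimal (fun z (hz : 0 < quadForm q z) => hz.le)
      (isClosed_le continuous_const (continuous_quadForm _))
  have h1 : 0 ≤ quadForm q z := hcl (E.collection_subset ℓ hℓ hz)
  rw [hlin'] at h1
  have := nonpos_of_mul_nonneg_right h1 hane
  linarith

lemma liftToInt_add {N : ℕ} {X : Finset (Fin N)} {i k : ℤ} (hi : i ∈ liftToInt X)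
    (hk : (N : ℤ) ∣ k) : i + k ∈ liftToInt X := by
  obtain ⟨a, ha, h⟩ := hi
  refine ⟨a, ha, ?_⟩
  have h1 : i + k ≡ i + 0 [ZMOD N] := (Int.modEq_zero_iff_dvd.2 hk).add_left i
  rw [add_zero] at h1
  exact h1.trans h

lemma smul_translates {γ : SL(2, ℝ)} {𝒢₀ : Set (Set ℍ)} {N : ℕ} {X : Finset (Fin N)} {k : ℤ}
    (hk : (N : ℤ) ∣ k) : γ ^ k • ⋃₀ translates γ 𝒢₀ X = ⋃₀ translates γ 𝒢₀ X := by
  have key (k : ℤ) (hk : (N : ℤ) ∣ k) :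
      γ ^ k • ⋃₀ translates γ 𝒢₀ X ⊆ ⋃₀ translates γ 𝒢₀ X := by
    rintro _ ⟨z, ⟨_, ⟨i, hi, ℓ₀, hℓ₀, rfl⟩, hz⟩, rfl⟩
    refine ⟨_, ⟨i + k, liftToInt_add hi hk, ℓ₀, hℓ₀, rfl⟩, ?_⟩
    rw [add_comm, zpow_add, mul_smul]
    exact Set.smul_mem_smul_set hz
  refine Set.Subset.antisymm (key k hk) ?_
  have h := key (-k) hk.neg_right
  rw [zpow_neg] at h
  rwa [Set.subset_smul_set_iff]

/-- A matrix acting trivially is 1 or -1, so only its square is known. Applied to γ^m, this shows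
that γ has finite order. -/
lemma sl_sq_eq_one {A : SL(2, ℝ)} (h : ∀ z : ℍ, A • z = z) : A * A = 1 := by
  have h1 := sl_smul_im A ⟨⟨0, 1⟩, one_pos⟩
  have h2 := sl_smul_im A ⟨⟨0, 2⟩, two_pos⟩
  have h3 := sl_smul_re A ⟨⟨0, 1⟩, one_pos⟩
  have p1 := sl_denom_normSq_pos A ⟨⟨0, 1⟩, one_pos⟩
  have p2 := sl_denom_normSq_pos A ⟨⟨0, 2⟩, two_pos⟩
  have hdet := det_eq_one A
  rw [h] at h1 h2 h3
  rw [eq_div_iff p1.ne'] at h1 h3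
  rw [eq_div_iff p2.ne'] at h2
  simp only [UpperHalfPlane.mk_re, UpperHalfPlane.mk_im] at h1 h2 h3
  have hc : A 1 0 = 0 := by nlinarith
  rw [hc] at h1 h3 hdet
  have hd : A 1 1 ^ 2 = 1 := by linarith
  have hd0 : A 1 1 ≠ 0 := by intro h; rw [h] at hd; norm_num at hd
  have hb : A 0 1 = 0 := by
    have : A 0 1 * A 1 1 = 0 := by linarith
    exact (mul_eq_zero.1 this).resolve_right hd0
  have ha : A 0 0 = A 1 1 := by
    apply mul_right_cancel₀ hd0
    nlinarith
  ext i j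
  fin_cases i <;> fin_cases j <;> simp [Matrix.mul_apply, Fin.sum_univ_two, hb, hc, ha] <;> nlinarith

/-! ### Sectors, the base point and invariance of the regions -/

namespace RotationData

variable {m : ℕ} {γ : SL(2, ℝ)} {𝒢₀ : Set (Set ℍ)} {z₀ : ℍ} {ρ c : ℂ}

lemma c_ne_zero (R : RotationData m γ 𝒢₀ z₀ ρ c) : c ≠ 0 :=
  norm_ne_zero_iff.1 (by linarith [R.one_lt])

lemma rot_ne_zero (R : RotationData m γ 𝒢₀ z₀ ρ c) : ρ ≠ 0 :=
  norm_ne_zero_iff.1 (by rw [R.norm_rot]; exact one_ne_zero)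

lemma mem_sector (R : RotationData m γ 𝒢₀ z₀ ρ c) {i : ℤ} {ℓ : Set ℍ} (hℓ : ℓ ∈ 𝒢₀) {z : ℍ}
    (hz : z ∈ γ ^ i • ℓ) : coordT z₀ z ≤ inner ℝ (ρ ^ i * c) (coordW z₀ z) := by
  rw [← inner_zpow_smul R.norm_rot R.rot, ← coordT_zpow R.norm_rot R.rot (-i), zpow_neg]
  exact R.sector ℓ hℓ _ (Set.mem_smul_set_iff_inv_smul_mem.1 hz)

/-- ρ may be any primitive m-th root of unity, so γ^i puts the sector of c at position i * j on the
circle rather than at i. The exponents j and j', inverse to each other modulo m, convert between the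
two labellings. -/
lemma exists_exponents (R : RotationData m γ 𝒢₀ z₀ ρ c) :
    ∃ j j' : ℤ, ρ = unitDir m j ∧ ρ ^ j' = unitDir m 1 ∧ (m : ℤ) ∣ j * j' - 1 := by
  have hm : m ≠ 0 := by have := R.two_le; omega
  have : NeZero m := ⟨hm⟩
  have hu : unitDir m 1 = Complex.exp (2 * Real.pi * Complex.I / m) := by
    rw [unitDir]; congr 1; push_cast; ring
  have hprim : IsPrimitiveRoot (unitDir m 1) m := by
    rw [hu]; exact Complex.isPrimitiveRoot_exp m hm
  obtain ⟨j, -, hj⟩ := hprim.eq_pow_of_pow_eq_one R.prim.pow_eq_one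
  obtain ⟨j', -, hj'⟩ := R.prim.eq_pow_of_pow_eq_one hprim.pow_eq_one
  refine ⟨j, j', ?_, by rw [zpow_natCast, hj'], ?_⟩
  · rw [unitDir_intCast, zpow_natCast, hj]
  · rw [← hprim.zpow_eq_one_iff_dvd, zpow_sub_one₀ (hprim.ne_zero hm), zpow_mul, zpow_natCast _ j, hj,
      zpow_natCast, hj', mul_inv_cancel₀ (hprim.ne_zero hm)]

lemma exists_direction (R : RotationData m γ 𝒢₀ z₀ ρ c) {j : ℤ} (hj : ρ = unitDir m j) {i : ℤ}
    {w : ℂ} (hw : √(1 + ‖w‖ ^ 2) ≤ inner ℝ (ρ ^ i * c) w) {t : ℝ} (ht : IsDir m c w t) :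
    ∃ k : ℤ, |t - i * j - k * m| < 1 / 2 := by
  have hi : ρ ^ i = unitDir m (i * j) := by rw [hj, unitDir_zpow]
  have hd : IsDir m c (unitDir m (-(i * j)) * w) (-(i * j) + t) := ht.mul _
  obtain ⟨k, hk⟩ := hd.exists_abs_sub_lt R.two_le R.c_ne_zero R.cos_le (by
    rw [norm_mul, norm_unitDir, one_mul]
    refine hw.trans (le_of_eq ?_)
    rw [hi, ← inner_mul_unit (norm_unitDir m (-(i * j))) _ w, ← mul_assoc, ← unitDir_add]
    simp)
  refine ⟨k, ?_⟩
  have : t - i * j - k * m = -(i * j) + t - k * m := by ring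
  rw [this]; exact hk

/-- A direction of the common point is within 1/2 of an integer congruent to i * j and of one
congruent to i' * j modulo m; two such integers are equal. -/
lemma rot_zpow_eq (R : RotationData m γ 𝒢₀ z₀ ρ c) {i i' : ℤ} {z : ℍ}
    (h : coordT z₀ z ≤ inner ℝ (ρ ^ i * c) (coordW z₀ z))
    (h' : coordT z₀ z ≤ inner ℝ (ρ ^ i' * c) (coordW z₀ z)) : ρ ^ i = ρ ^ i' := by
  obtain ⟨j, j', hj, -⟩ := R.exists_exponents
  have hm : m ≠ 0 := by have := R.two_le; omega
  obtain ⟨t, ht⟩ := exists_isDir hm R.c_ne_zero (coordW z₀ z)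
  rw [coordT_eq_sqrt] at h h'
  obtain ⟨k, hk⟩ := R.exists_direction hj h ht
  obtain ⟨k', hk'⟩ := R.exists_direction hj h' ht
  have e : i * j + k * m = i' * j + k' * m := by
    have h1 : |((i * j + k * m - (i' * j + k' * m) : ℤ) : ℝ)| < 1 := by
      push_cast
      rw [abs_lt] at *
      constructor <;> linarith [hk.1, hk.2, hk'.1, hk'.2]
    have h2 : |i * j + k * m - (i' * j + k' * m)| < 1 := by exact_mod_cast h1
    have := Int.abs_lt_one_iff.1 h2
    linarith
  have h3 : unitDir m (i * j - i' * j : ℝ) = 1 := by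
    rw [unitDir_eq_one_iff hm]
    refine ⟨k' - k, ?_⟩
    have : (i * j + k * m : ℝ) = i' * j + k' * m := by exact_mod_cast e
    push_cast
    linarith
  rw [hj, unitDir_zpow, unitDir_zpow]
  rw [sub_eq_add_neg, unitDir_add, unitDir_neg, mul_inv_eq_one₀
    (norm_ne_zero_iff.1 (by simp))] at h3
  exact h3

lemma smul_eq (R : RotationData m γ 𝒢₀ z₀ ρ c) {i i' : ℤ} (h : ρ ^ i = ρ ^ i') (z : ℍ) :
    γ ^ i • z = γ ^ i' • z := by
  apply coordW_injective z₀
  rw [coordW_zpow R.norm_rot R.rot, coordW_zpow R.norm_rot R.rot, h]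

lemma smul_set_eq (R : RotationData m γ 𝒢₀ z₀ ρ c) {i i' : ℤ} (h : ρ ^ i = ρ ^ i') (S : Set ℍ) :
    γ ^ i • S = γ ^ i' • S := Set.image_congr fun z _ => R.smul_eq h z

lemma dvd_of_mem (R : RotationData m γ 𝒢₀ z₀ ρ c) {i i' : ℤ} {ℓ ℓ' : Set ℍ} (hℓ : ℓ ∈ 𝒢₀)
    (hℓ' : ℓ' ∈ 𝒢₀) {z : ℍ} (hz : z ∈ γ ^ i • ℓ) (hz' : z ∈ γ ^ i' • ℓ') :
    (m : ℤ) ∣ i - i' := by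
  rw [← R.prim.zpow_eq_one_iff_dvd, zpow_sub₀ R.rot_ne_zero,
    R.rot_zpow_eq (R.mem_sector hℓ hz) (R.mem_sector hℓ' hz'),
    div_self (zpow_ne_zero _ R.rot_ne_zero)]

lemma translates_geodesic (R : RotationData m γ 𝒢₀ z₀ ρ c) {N : ℕ} (X : Finset (Fin N)) :
    ∀ ℓ ∈ translates γ 𝒢₀ X, IsGeodesic ℓ := by
  rintro _ ⟨i, -, ℓ₀, hℓ₀, rfl⟩
  exact (R.geodesic ℓ₀ hℓ₀).smul _

lemma translates_disjoint (R : RotationData m γ 𝒢₀ z₀ ρ c) {N : ℕ} (X : Finset (Fin N)) :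
    (translates γ 𝒢₀ X).PairwiseDisjoint id := by
  rintro _ ⟨i, -, ℓ, hℓ, rfl⟩ _ ⟨i', -, ℓ', hℓ', rfl⟩ hne
  refine Set.disjoint_left.2 fun z hz hz' => hne ?_
  have hρ := R.rot_zpow_eq (R.mem_sector hℓ hz) (R.mem_sector hℓ' hz')
  simp only [id] at hz hz'
  rw [R.smul_set_eq hρ] at hz ⊢
  rw [Set.mem_smul_set_iff_inv_smul_mem] at hz hz'
  by_contra hne'
  exact Set.disjoint_left.1 (R.disjoint hℓ hℓ' (fun h => hne' (by rw [h]))) hz hz'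

/-- A single translate of `𝒢₀` does not decide on which side `D` lies; a second one does. It is on
the positive side of the given geodesic and is joined to `z₀` inside the half-plane T > ⟨ρ^i c, W⟩,
which the given geodesic does not enter. -/
lemma base_mem (R : RotationData m γ 𝒢₀ z₀ ρ c) {N : ℕ} {X : Finset (Fin N)} {D : Set ℍ}
    (hD : IsRegionOf D (translates γ 𝒢₀ X))
    (h : ∀ i ∈ liftToInt X, ∃ i' ∈ liftToInt X, ρ ^ i ≠ ρ ^ i') : z₀ ∈ D := by
  obtain ⟨q, hq, rfl, hdis⟩ := hD.exists_forms (R.translates_geodesic X) (R.translates_disjoint X)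
  rintro ⟨_, i, hi, ℓ, hℓ, rfl⟩
  obtain ⟨i', hi', hii'⟩ := h i hi
  set a : translates γ 𝒢₀ X := ⟨γ ^ i • ℓ, i, hi, ℓ, hℓ, rfl⟩ with ha
  set a' : translates γ 𝒢₀ X := ⟨γ ^ i' • ℓ, i', hi', ℓ, hℓ, rfl⟩ with ha'
  obtain ⟨p, hp⟩ : (γ ^ i' • ℓ).Nonempty := ((R.geodesic ℓ hℓ).smul _).nonempty
  have hne : a' ≠ a := by
    intro h0
    have : p ∈ γ ^ i • ℓ := by
      have := congrArg Subtype.val h0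
      simp only [ha, ha'] at this
      rwa [this] at hp
    exact hii' (R.rot_zpow_eq (R.mem_sector hℓ this) (R.mem_sector hℓ hp))
  obtain ⟨q', -, hq'⟩ := exists_quadForm_eq_linForm z₀ 1 (-(ρ ^ i * c))
  have hq'' (z) : quadForm q' z = coordT z₀ z - inner ℝ (ρ ^ i * c) (coordW z₀ z) := by
    rw [hq', linForm, inner_neg_left]; ring
  refine pos_of_isPreconnected (isPreconnected_halfPlane q') (continuous_quadForm (q a)) ?_
    (x := p) ?_ ?_ z₀ ?_
  · intro z hz h0
    have h1 : z ∈ γ ^ i • ℓ := by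
      have := (hq a).2
      simp only [ha] at this
      rw [this]; exact h0
    have h2 := R.mem_sector hℓ h1
    have h3 : 0 < quadForm q' z := hz
    rw [hq''] at h3
    linarith
  · by_contra h0
    refine hii' (R.rot_zpow_eq (z := p) ?_ (R.mem_sector hℓ hp))
    simp only [Set.mem_ofPred_eq, hq''] at h0
    linarith
  · refine hdis a' a hne p (le_of_eq ?_)
    have := (hq a').2
    simp only [ha'] at this
    rw [this] at hp
    exact hp
  · simp [hq'']

lemma base_mem_of_lt (R : RotationData m γ 𝒢₀ z₀ ρ c) {N : ℕ} {X : Finset (Fin N)} {D : Set ℍ}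
    (hD : IsRegionOf D (translates γ 𝒢₀ X)) (hN : N ≠ 0) (hNm : N < m) : z₀ ∈ D := by
  refine R.base_mem hD fun i hi => ⟨i + N, liftToInt_add hi dvd_rfl, fun h => ?_⟩
  rw [zpow_add₀ R.rot_ne_zero, eq_comm, mul_eq_left₀ (zpow_ne_zero _ R.rot_ne_zero),
    R.prim.zpow_eq_one_iff_dvd] at h
  have := Int.le_of_dvd (by omega) h
  omega

lemma zpow_smul_eq_self (R : RotationData m γ 𝒢₀ z₀ ρ c) {k : ℤ} (hk : (m : ℤ) ∣ k) (z : ℍ) :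
    γ ^ k • z = z := by
  have h1 : ρ ^ k = ρ ^ (0 : ℤ) := by rw [zpow_zero, R.prim.zpow_eq_one_iff_dvd]; exact hk
  rw [R.smul_eq h1]; simp

lemma fixes_base (R : RotationData m γ 𝒢₀ z₀ ρ c) (k : ℤ) : γ ^ k • z₀ = z₀ := by
  apply coordW_injective z₀
  rw [coordW_zpow R.norm_rot R.rot]; simp

lemma isOfFinOrder (R : RotationData m γ 𝒢₀ z₀ ρ c) : IsOfFinOrder γ := by
  have h : γ ^ m * γ ^ m = 1 := sl_sq_eq_one fun z => by
    have := R.zpow_smul_eq_self (dvd_refl (m : ℤ)) z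
    rwa [zpow_natCast] at this
  rw [← pow_add] at h
  exact isOfFinOrder_iff_pow_eq_one.2 ⟨m + m, by have := R.two_le; omega, h⟩

lemma finite_zpowers (R : RotationData m γ 𝒢₀ z₀ ρ c) (N : ℕ) :
    Finite (Subgroup.zpowers (γ ^ N)) :=
  (R.isOfFinOrder.pow (n := N)).finite_zpowers

/-- If N < m, then `D` is the component containing the common fixed point `z₀`, and the rotations
preserve the union of the geodesics. If N = m, the group acts trivially, and `z₀` need not lie in
`D`. -/
lemma smul_region (R : RotationData m γ 𝒢₀ z₀ ρ c) {N : ℕ} {X : Finset (Fin N)} {D : Set ℍ}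
    (hD : IsRegionOf D (translates γ 𝒢₀ X)) (hNm : N ∣ m) {A : SL(2, ℝ)}
    (hA : A ∈ Subgroup.zpowers (γ ^ N)) : A • D = D := by
  obtain ⟨k, rfl⟩ := hA
  have e : (γ ^ N) ^ k = γ ^ ((N : ℤ) * k) := by rw [zpow_mul, zpow_natCast]
  simp only [e]
  have hm : 0 < m := by have := R.two_le; omega
  rcases (Nat.le_of_dvd hm hNm).eq_or_lt with rfl | hlt
  · have : γ ^ ((N : ℤ) * k) • D = (id : ℍ → ℍ) '' D :=
      Set.image_congr fun z _ => R.zpow_smul_eq_self (dvd_mul_right _ _) z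
    rw [this, Set.image_id]
  · have hz₀ := R.base_mem_of_lt hD (Nat.pos_of_dvd_of_pos hNm hm).ne' hlt
    have hcomp : D = connectedComponentIn (⋃₀ translates γ 𝒢₀ X)ᶜ z₀ := by
      obtain ⟨⟨x, hx, rfl⟩, -⟩ := hD
      exact (connectedComponentIn_eq hz₀)
    have hmem : z₀ ∈ (⋃₀ translates γ 𝒢₀ X)ᶜ := by
      obtain ⟨⟨x, hx, rfl⟩, -⟩ := hD
      exact connectedComponentIn_subset _ _ hz₀
    rw [hcomp]
    have := (Homeomorph.smul (γ ^ ((N : ℤ) * k)) : ℍ ≃ₜ ℍ).image_connectedComponentIn hmem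
    rw [Homeomorph.smul_apply, R.fixes_base] at this
    change (Homeomorph.smul (γ ^ ((N : ℤ) * k)) : ℍ ≃ₜ ℍ) '' _ = _
    rw [this]
    congr 1
    change γ ^ ((N : ℤ) * k) • (⋃₀ translates γ 𝒢₀ X)ᶜ = _
    rw [Set.smul_set_compl, smul_translates (dvd_mul_right _ _)]

lemma isHypOrbifold (R : RotationData m γ 𝒢₀ z₀ ρ c) {N : ℕ} {X : Finset (Fin N)} {D : Set ℍ}
    (hD : IsRegionOf D (translates γ 𝒢₀ X)) (hNm : N ∣ m) :
    IsHypOrbifold D (translates γ 𝒢₀ X) (Subgroup.zpowers (γ ^ N)) where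
  isOpen := hD.isOpen (R.translates_geodesic X) (R.translates_disjoint X)
  nonempty := hD.nonempty
  convex := hD.isGeodConvex (R.translates_geodesic X) (R.translates_disjoint X)
  geodesic := R.translates_geodesic X
  disjoint := R.translates_disjoint X
  frontier_eq := hD.frontier_eq (R.translates_geodesic X) (R.translates_disjoint X)
  invariant _ hA := R.smul_region hD hNm hA
  properlyDiscontinuous := by
    have := R.finite_zpowers N
    infer_instance

end RotationData

/-! ### Subsets of `ZMod (2 n)` and their complements contain equally many pairs -/

/-- The weight f a + f b - 1 of a pair is 1 inside V, -1 outside V and 0 for a mixed pair. Over the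
2n translates of one pair it sums to n + n - 2n = 0. As `O` is invariant under translation, its
total weight is zero. -/
lemma card_pairs_eq {n : ℕ} [NeZero (2 * n)] {V : Finset (ZMod (2 * n))} (hV : V.card = n)
    {O : Finset (Sym2 (ZMod (2 * n)))} (hO : ∀ t, ∀ p ∈ O, p.map (· + t) ∈ O) :
    (O.filter fun p => ∀ a ∈ p, a ∈ V).card = (O.filter fun p => ∀ a ∈ p, a ∉ V).card := by
  set f : ZMod (2 * n) → ℤ := fun a => if a ∈ V then 1 else 0 with hf
  set w : Sym2 (ZMod (2 * n)) → ℤ :=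
    Sym2.lift ⟨fun a b => f a + f b - 1, fun a b => by ring⟩ with hw
  have hsum : ∑ t, f t = n := by simp [hf, hV]
  have hshift (t) : ∑ p ∈ O, w (p.map (· + t)) = ∑ p ∈ O, w p := by
    refine Finset.sum_nbij' (fun p => p.map (· + t)) (fun p => p.map (· + (-t)))
      (fun p hp => hO t p hp) (fun p hp => hO (-t) p hp) ?_ ?_ fun p _ => rfl
    · intro p _; simp [Sym2.map_map]
    · intro p _; simp [Sym2.map_map]
  have hzero (p : Sym2 (ZMod (2 * n))) : ∑ t, w (p.map (· + t)) = 0 := by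
    induction p with
    | _ a b =>
      have h1 (a) : ∑ t, f (a + t) = n := by
        rw [← hsum]; exact Fintype.sum_equiv (Equiv.addLeft a) _ _ fun t => rfl
      simp only [hw, Sym2.map_mk, Sym2.lift_mk, Finset.sum_sub_distrib, Finset.sum_add_distrib, h1]
      simp [ZMod.card]
      ring
  have h1 : ∑ p ∈ O, w p = 0 := by
    have h2 : ∑ t : ZMod (2 * n), ∑ p ∈ O, w (p.map (· + t)) = 0 := by
      rw [Finset.sum_comm]; exact Finset.sum_eq_zero fun p _ => hzero p
    simp only [hshift, Finset.sum_const, Finset.card_univ, ZMod.card] at h2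
    have h3 := NeZero.ne (2 * n)
    rcases smul_eq_zero.1 h2 with h | h
    · omega
    · exact h
  have h4 : ∑ p ∈ O, w p = (O.filter fun p => ∀ a ∈ p, a ∈ V).card -
      (O.filter fun p => ∀ a ∈ p, a ∉ V).card := by
    rw [Finset.card_filter, Finset.card_filter]
    push_cast
    rw [← Finset.sum_sub_distrib]
    refine Finset.sum_congr rfl fun p _ => ?_
    induction p with
    | _ a b =>
      simp only [hw, Sym2.lift_mk, hf, Sym2.mem_iff, forall_eq_or_imp, forall_eq]
      by_cases ha : a ∈ V <;> by_cases hb : b ∈ V <;> simp [ha, hb]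
  have := h1 ▸ h4
  omega

/-- The pairs in `V` can be moved injectively to pairs in the complement of `V` by translations. -/
lemma exists_pair_translation {n : ℕ} [NeZero (2 * n)] {V : Finset (ZMod (2 * n))}
    (hV : V.card = n) : ∃ k : Sym2 (ZMod (2 * n)) → ZMod (2 * n),
      (∀ p : Sym2 (ZMod (2 * n)), (∀ a ∈ p, a ∈ V) → ∀ a ∈ p, a + k p ∉ V) ∧
      ∀ p p' : Sym2 (ZMod (2 * n)), (∀ a ∈ p, a ∈ V) → (∀ a ∈ p', a ∈ V) →
        p.map (· + k p) = p'.map (· + k p') → p = p' := by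
  classical
  set orb : Sym2 (ZMod (2 * n)) → Finset (Sym2 (ZMod (2 * n))) :=
    fun p => Finset.univ.image fun t => Sym2.map (· + t) p with horb
  have hmem (p q) : q ∈ orb p ↔ ∃ t, p.map (· + t) = q := by simp [horb]
  have hself (p) : p ∈ orb p := (hmem p p).2 ⟨0, by simp⟩
  have hinv (p) : ∀ t, ∀ q ∈ orb p, q.map (· + t) ∈ orb p := by
    intro t q hq
    obtain ⟨s, rfl⟩ := (hmem p q).1 hq
    exact (hmem _ _).2 ⟨s + t, by simp [Sym2.map_map, add_assoc]⟩
  have horb_sub (p q) (hq : q ∈ orb p) : orb q ⊆ orb p := by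
    intro r hr
    obtain ⟨t, rfl⟩ := (hmem q r).1 hr
    exact hinv p t q hq
  have horb_eq (p q) (hq : q ∈ orb p) : orb q = orb p := by
    refine Finset.Subset.antisymm (horb_sub p q hq) (horb_sub q p ?_)
    obtain ⟨t, rfl⟩ := (hmem p q).1 hq
    exact (hmem _ _).2 ⟨-t, by simp [Sym2.map_map]⟩
  -- Equal counts within each translation orbit provide an injection from the pairs inside V to
  -- those outside; k records a translation that realises it. Pairs from different orbits cannot
  -- collide, since translations preserve orbits.
  have hex (O : Finset (Sym2 (ZMod (2 * n)))) (hO : ∀ t, ∀ p ∈ O, p.map (· + t) ∈ O) :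
      ∃ e : Sym2 (ZMod (2 * n)) → Sym2 (ZMod (2 * n)),
        Set.MapsTo e (O.filter fun p => ∀ a ∈ p, a ∈ V) (O.filter fun p => ∀ a ∈ p, a ∉ V) ∧
        Set.InjOn e (O.filter fun p => ∀ a ∈ p, a ∈ V) := by
    have h := card_pairs_eq hV hO
    generalize (O.filter fun p => ∀ a ∈ p, a ∈ V) = S at *
    generalize (O.filter fun p => ∀ a ∈ p, a ∉ V) = S' at *
    have hle : (S : Set (Sym2 (ZMod (2 * n)))).encard ≤ (S' : Set (Sym2 (ZMod (2 * n)))).encard := by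
      rw [Set.encard_coe_eq_coe_finsetCard, Set.encard_coe_eq_coe_finsetCard, h]
    exact S.finite_toSet.exists_injOn_of_encard_le hle
  choose! e he hinj using hex
  have hfilt (p) (hp : ∀ a ∈ p, a ∈ V) : p ∈ ((orb p).filter fun p => ∀ a ∈ p, a ∈ V) :=
    Finset.mem_filter.2 ⟨hself p, hp⟩
  have hk (p) : ∃ t, (∀ a ∈ p, a ∈ V) → p.map (· + t) = e (orb p) p := by
    by_cases hp : ∀ a ∈ p, a ∈ V
    · obtain ⟨t, ht⟩ := (hmem _ _).1 (Finset.mem_filter.1 (he (orb p) (hinv p) (hfilt p hp))).1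
      exact ⟨t, fun _ => ht⟩
    · exact ⟨0, fun h => (hp h).elim⟩
  choose k hk using hk
  refine ⟨k, fun p hp a ha => ?_, fun p p' hp hp' h => ?_⟩
  · have h1 := (Finset.mem_filter.1 (he (orb p) (hinv p) (hfilt p hp))).2
    rw [← hk p hp] at h1
    exact h1 _ (Sym2.mem_map.2 ⟨a, ha, rfl⟩)
  · rw [hk p hp, hk p' hp'] at h
    have h1 := (Finset.mem_filter.1 (he (orb p) (hinv p) (hfilt p hp))).1
    have h2 := (Finset.mem_filter.1 (he (orb p') (hinv p') (hfilt p' hp'))).1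
    have h3 : orb p = orb p' := by
      rw [← horb_eq p _ h1, ← horb_eq p' _ h2, h]
    have h4 := hfilt p hp
    rw [h3] at h h4
    exact hinj (orb p') (hinv p') h4 (hfilt p' hp') h

/-! ### The residues of `X` -/

/-- The subset of `ZMod N` corresponding to `X`. -/
noncomputable def residues {N : ℕ} (X : Finset (Fin N)) : Finset (ZMod N) :=
  X.image fun a : Fin N => ((a : ℕ) : ZMod N)

lemma natCast_fin_injective (N : ℕ) : Function.Injective fun a : Fin N => ((a : ℕ) : ZMod N) := by
  intro a b h
  have h1 := (ZMod.natCast_eq_natCast_iff' _ _ _).1 h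
  rw [Nat.mod_eq_of_lt a.2, Nat.mod_eq_of_lt b.2] at h1
  exact Fin.ext h1

lemma card_residues {N : ℕ} (X : Finset (Fin N)) : (residues X).card = X.card :=
  Finset.card_image_of_injective _ (natCast_fin_injective N)

lemma mem_liftToInt_iff {N : ℕ} {X : Finset (Fin N)} {i : ℤ} :
    i ∈ liftToInt X ↔ (i : ZMod N) ∈ residues X := by
  simp only [liftToInt, residues, Set.mem_ofPred_eq, Finset.mem_image]
  refine exists_congr fun a => and_congr_right fun _ => ?_
  rw [← ZMod.intCast_eq_intCast_iff, eq_comm]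
  norm_cast

lemma residues_compl {N : ℕ} [NeZero N] (X : Finset (Fin N)) :
    residues Xᶜ = (residues X)ᶜ := by
  refine Finset.eq_of_subset_of_card_le (fun b hb => ?_) ?_
  · obtain ⟨a, ha, rfl⟩ := Finset.mem_image.1 hb
    rw [Finset.mem_compl]
    intro h
    obtain ⟨a', ha', h⟩ := Finset.mem_image.1 h
    rw [natCast_fin_injective N h] at ha'
    exact Finset.mem_compl.1 ha ha'
  · rw [Finset.card_compl, card_residues, card_residues, Finset.card_compl, Fintype.card_fin,
      ZMod.card]

lemma mem_liftToInt_compl {N : ℕ} [NeZero N] {X : Finset (Fin N)} {i : ℤ} :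
    i ∈ liftToInt Xᶜ ↔ i ∉ liftToInt X := by
  rw [mem_liftToInt_iff, mem_liftToInt_iff, residues_compl, Finset.mem_compl]

/-! ### Comparison of the ortho spectra -/

namespace RotationData

variable {m : ℕ} {γ : SL(2, ℝ)} {𝒢₀ : Set (Set ℍ)} {z₀ : ℍ} {ρ c : ℂ}

/-- Different translates of the sector are disjoint, so a point on a translate determines its
exponent modulo m, and hence modulo N. -/
lemma exists_index (R : RotationData m γ 𝒢₀ z₀ ρ c) {N : ℕ} (hN : N ∣ m) :
    ∃ idx : ℍ → ZMod N, ∀ i : ℤ, ∀ ℓ ∈ 𝒢₀, ∀ z ∈ γ ^ i • ℓ, idx z = i := by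
  have h (z : ℍ) : ∃ a : ZMod N, ∀ i : ℤ, ∀ ℓ ∈ 𝒢₀, z ∈ γ ^ i • ℓ → a = i := by
    by_cases hz : ∃ i : ℤ, ∃ ℓ ∈ 𝒢₀, z ∈ γ ^ i • ℓ
    · obtain ⟨i, ℓ, hℓ, hz⟩ := hz
      refine ⟨i, fun i' ℓ' hℓ' hz' => ?_⟩
      have h1 := R.dvd_of_mem hℓ' hℓ hz' hz
      exact (ZMod.intCast_eq_intCast_iff_dvd_sub i i' N).2 ((Int.natCast_dvd_natCast.2 hN).trans h1)
    · exact ⟨0, fun i ℓ hℓ hz' => (hz ⟨i, ℓ, hℓ, hz'⟩).elim⟩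
  choose idx hidx using h
  exact ⟨idx, fun i ℓ hℓ z hz => hidx z i ℓ hℓ hz⟩

end RotationData

/-- Only geodesics through the endpoints have to be carried into `𝒢'`. This matters because the
chosen power of γ moves the two sectors of the endpoints from X into its complement, but not all of
X. -/
lemma IsOrthoGeodesic.smul {𝒢 : Set (Set ℍ)} {L : ℝ} {s : Sym2 ℍ} (h : IsOrthoGeodesic 𝒢 L s)
    (A : SL(2, ℝ)) {𝒢' : Set (Set ℍ)} (hG : ∀ g ∈ 𝒢, ∀ z ∈ s, z ∈ g → A • g ∈ 𝒢') :
    IsOrthoGeodesic 𝒢' L (s.map fun z => A • z) := by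
  obtain ⟨x, y, rfl, hxy, hL, c, hc, ⟨g, hg, hcg⟩, ⟨g', hg', hcg'⟩⟩ := h
  have hx : x ∈ g := by obtain ⟨_, _, _, ⟨h, -⟩, -⟩ := hcg; exact h
  have hy : y ∈ g' := by obtain ⟨_, _, _, ⟨h, -⟩, -⟩ := hcg'; exact h
  exact ⟨A • x, A • y, by simp, fun h => hxy (smul_left_cancel A h), by rw [dist_smul, hL], A • c,
    hc.smul A, ⟨A • g, hG g hg x (by simp) hx, hcg.smul A⟩,
    ⟨A • g', hG g' hg' y (by simp) hy, hcg'.smul A⟩⟩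

lemma IsOrthoGeodesic.exists_mem {𝒢 : Set (Set ℍ)} {L : ℝ} {s : Sym2 ℍ}
    (h : IsOrthoGeodesic 𝒢 L s) : ∀ z ∈ s, ∃ g ∈ 𝒢, z ∈ g := by
  obtain ⟨x, y, rfl, -, -, c, -, ⟨g, hg, _, _, -, ⟨hx, -⟩, -⟩, ⟨g', hg', _, _, -, ⟨hy, -⟩, -⟩⟩ := h
  intro z hz
  rcases Sym2.mem_iff.1 hz with rfl | rfl
  exacts [⟨g, hg, hx⟩, ⟨g', hg', hy⟩]

/-- Each ortho geodesic is moved by the power of γ assigned to its pair of indices. One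
representative is chosen per orbit, so only injectivity matters: Γ consists of powers of γ^(2n),
which preserve indices; hence the orbit of the image determines the translated pair, then the
original pair, then the power used, and finally the original orbit. -/
lemma RotationData.orthoSpectrum_le {m : ℕ} {γ : SL(2, ℝ)} {𝒢₀ : Set (Set ℍ)} {z₀ : ℍ} {ρ c : ℂ}
    (R : RotationData m γ 𝒢₀ z₀ ρ c) {n : ℕ} (hn : 2 * n ∣ m) {X : Finset (Fin (2 * n))}
    (hX : X.card = n) {Γ : Subgroup SL(2, ℝ)} (hΓ : Γ ≤ Subgroup.zpowers (γ ^ (2 * n))) (L : ℝ) :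
    orthoSpectrum (translates γ 𝒢₀ X) Γ L ≤ orthoSpectrum (translates γ 𝒢₀ Xᶜ) Γ L := by
  have hm : 0 < m := by have := R.two_le; omega
  have : NeZero (2 * n) := ⟨(Nat.pos_of_dvd_of_pos hn hm).ne'⟩
  obtain ⟨idx, hidx⟩ := R.exists_index hn
  obtain ⟨k, hk1, hk2⟩ := exists_pair_translation (n := n) (V := residues X)
    (by rw [card_residues, hX])
  set κ : Sym2 ℍ → ℤ := fun s => ((k (s.map idx)).val : ℤ) with hκ
  have hκc (s) : ((κ s : ℤ) : ZMod (2 * n)) = k (s.map idx) := by simp [hκ]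
  set Φ : Sym2 ℍ → Sym2 ℍ := fun s => s.map fun z => γ ^ κ s • z with hΦ
  set orb : Sym2 ℍ → Set (Sym2 ℍ) := fun s => {t | ∃ A ∈ Γ, t = Sym2.map (fun z => A • z) s} with horb
  -- orthogeodesics and their indices
  have hpt {s : Sym2 ℍ} (hs : IsOrthoGeodesic (translates γ 𝒢₀ X) L s) (z) (hz : z ∈ s) :
      ∃ i ∈ liftToInt X, ∃ ℓ ∈ 𝒢₀, z ∈ γ ^ i • ℓ := by
    obtain ⟨_, ⟨i, hi, ℓ, hℓ, rfl⟩, hz⟩ := hs.exists_mem z hz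
    exact ⟨i, hi, ℓ, hℓ, hz⟩
  have hidxV {s : Sym2 ℍ} (hs : IsOrthoGeodesic (translates γ 𝒢₀ X) L s) :
      ∀ a ∈ s.map idx, a ∈ residues X := by
    intro a ha
    obtain ⟨z, hz, rfl⟩ := Sym2.mem_map.1 ha
    obtain ⟨i, hi, ℓ, hℓ, hz⟩ := hpt hs z hz
    rw [hidx i ℓ hℓ z hz]
    exact mem_liftToInt_iff.1 hi
  have hidxΦ {s : Sym2 ℍ} (hs : IsOrthoGeodesic (translates γ 𝒢₀ X) L s) (j : ℤ) :
      (s.map fun z => γ ^ j • z).map idx = (s.map idx).map (· + (j : ZMod (2 * n))) := by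
    rw [Sym2.map_map, Sym2.map_map]
    refine Sym2.map_congr fun z hz => ?_
    obtain ⟨i, -, ℓ, hℓ, hz⟩ := hpt hs z hz
    have h1 : γ ^ j • z ∈ γ ^ (j + i) • ℓ := by
      rw [zpow_add, mul_smul]; exact Set.smul_mem_smul_set hz
    simp only [Function.comp_apply]
    rw [hidx _ ℓ hℓ z hz, hidx _ ℓ hℓ _ h1]
    push_cast
    ring
  have hΦ_ortho {s : Sym2 ℍ} (hs : IsOrthoGeodesic (translates γ 𝒢₀ X) L s) :
      IsOrthoGeodesic (translates γ 𝒢₀ Xᶜ) L (Φ s) := by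
    refine hs.smul _ ?_
    rintro _ ⟨i, hi, ℓ, hℓ, rfl⟩ z hz hzg
    refine ⟨κ s + i, ?_, ℓ, hℓ, by rw [zpow_add, mul_smul]⟩
    rw [mem_liftToInt_iff, residues_compl, Finset.mem_compl]
    have h1 := hk1 (s.map idx) (hidxV hs) (idx z) (Sym2.mem_map.2 ⟨z, hz, rfl⟩)
    rw [hidx i ℓ hℓ z hzg] at h1
    push_cast
    rw [hκc, add_comm]
    exact h1
  have hinj {s s' : Sym2 ℍ} (hs : IsOrthoGeodesic (translates γ 𝒢₀ X) L s)
      (hs' : IsOrthoGeodesic (translates γ 𝒢₀ X) L s') (h : orb (Φ s) = orb (Φ s')) :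
      orb s = orb s' := by
    have h1 : Φ s' ∈ orb (Φ s) := by
      rw [h]; exact ⟨1, Γ.one_mem, by simp⟩
    obtain ⟨A, hA, h2⟩ := h1
    obtain ⟨l, hl⟩ := hΓ hA
    have hAγ : A = γ ^ ((2 * n : ℕ) * l : ℤ) := by rw [← hl, zpow_mul, zpow_natCast]
    have h3 : Φ s' = s.map fun z => γ ^ ((2 * n : ℕ) * l + κ s : ℤ) • z := by
      rw [h2, hΦ, Sym2.map_map, hAγ]
      refine Sym2.map_congr fun z _ => ?_
      rw [zpow_add, mul_smul]; rfl
    have h4 := congrArg (Sym2.map idx) h3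
    rw [hΦ, hidxΦ hs', hidxΦ hs] at h4
    have h5 : (((2 * n : ℕ) * l + κ s : ℤ) : ZMod (2 * n)) = k (s.map idx) := by
      rw [Int.cast_add, Int.cast_mul, hκc, Int.cast_natCast, ZMod.natCast_self]; simp
    rw [hκc, h5] at h4
    have h6 := hk2 _ _ (hidxV hs') (hidxV hs) h4
    have h7 : κ s' = κ s := by simp only [hκ, h6]
    have h8 : s' = s.map fun z => A • z := by
      have h9 : Function.Injective (Sym2.map fun z : ℍ => γ ^ κ s • z) :=
        Sym2.map.injective (MulAction.injective _)
      apply h9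
      have : Φ s' = s'.map fun z => γ ^ κ s • z := by simp only [hΦ, h7]
      rw [← this, h3, Sym2.map_map, hAγ]
      refine Sym2.map_congr fun z _ => ?_
      simp only [Function.comp_apply, smul_smul, ← zpow_add]
      rw [add_comm]
    ext t
    constructor
    · rintro ⟨B, hB, rfl⟩
      refine ⟨B * A⁻¹, Γ.mul_mem hB (Γ.inv_mem hA), ?_⟩
      rw [h8, Sym2.map_map]
      refine Sym2.map_congr fun z _ => ?_
      simp [mul_smul]
    · rintro ⟨B, hB, rfl⟩
      refine ⟨B * A, Γ.mul_mem hB hA, ?_⟩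
      rw [h8, Sym2.map_map]
      refine Sym2.map_congr fun z _ => ?_
      simp [mul_smul]
  choose! rep hrep1 hrep2 using fun (O : Set (Sym2 ℍ))
    (hO : ∃ s, IsOrthoGeodesic (translates γ 𝒢₀ X) L s ∧ O = orb s) => hO
  refine Cardinal.mk_le_of_injective (f := fun O : {O : Set (Sym2 ℍ) | ∃ s,
    IsOrthoGeodesic (translates γ 𝒢₀ X) L s ∧ O = orb s} =>
    (⟨orb (Φ (rep O.1)), Φ (rep O.1), hΦ_ortho (hrep1 O.1 O.2), rfl⟩ :
      {O : Set (Sym2 ℍ) | ∃ s, IsOrthoGeodesic (translates γ 𝒢₀ Xᶜ) L s ∧ O = orb s})) ?_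
  intro O O' h
  apply Subtype.ext
  rw [hrep2 O.1 O.2, hrep2 O'.1 O'.2]
  exact hinj (hrep1 O.1 O.2) (hrep1 O'.1 O'.2) (congrArg Subtype.val h)

lemma RotationData.orthoSpectrum_eq {m : ℕ} {γ : SL(2, ℝ)} {𝒢₀ : Set (Set ℍ)} {z₀ : ℍ} {ρ c : ℂ}
    (R : RotationData m γ 𝒢₀ z₀ ρ c) {n : ℕ} (hn : 2 * n ∣ m) {X : Finset (Fin (2 * n))}
    (hX : X.card = n) {Γ : Subgroup SL(2, ℝ)} (hΓ : Γ ≤ Subgroup.zpowers (γ ^ (2 * n))) :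
    orthoSpectrum (translates γ 𝒢₀ X) Γ = orthoSpectrum (translates γ 𝒢₀ Xᶜ) Γ := by
  funext L
  refine le_antisymm (R.orthoSpectrum_le hn hX hΓ L) ?_
  have hX' : Xᶜ.card = n := by rw [Finset.card_compl, Fintype.card_fin, hX]; omega
  have := R.orthoSpectrum_le hn hX' hΓ L
  rwa [compl_compl] at this

/-! ### Automorphisms of the cycle graph -/

/-- The rotations and reflections of the cycle. -/
lemma exists_iso_cycleGraph {N : ℕ} (hN : 2 ≤ N) (ε : ℤ) (hε : ε = 1 ∨ ε = -1) (s : ℤ) :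
    ∃ σ : SimpleGraph.cycleGraph N ≃g SimpleGraph.cycleGraph N,
      ∀ a : Fin N, (((σ a : Fin N) : ℕ) : ZMod N) = ε * ((a : ℕ) : ZMod N) + s := by
  obtain ⟨k, rfl⟩ : ∃ k, N = k + 2 := ⟨N - 2, by omega⟩
  have hadj (u v : ZMod (k + 2)) :
      (SimpleGraph.cycleGraph (k + 2)).Adj u v ↔ u - v = 1 ∨ v - u = 1 :=
    SimpleGraph.cycleGraph_adj
  have hval (a : ZMod (k + 2)) : ((ZMod.val a : ℕ) : ZMod (k + 2)) = a :=
    ZMod.natCast_zmod_val a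
  have hεε : (ε : ZMod (k + 2)) * ε = 1 := by rcases hε with rfl | rfl <;> simp
  let e : ZMod (k + 2) ≃ ZMod (k + 2) :=
    { toFun := fun a => ε * a + s
      invFun := fun a => ε * (a - s)
      left_inv := fun a => by linear_combination a * hεε
      right_inv := fun a => by linear_combination (a - s) * hεε }
  refine ⟨⟨e, ?_⟩, fun a => ?_⟩
  · intro a b
    have h1 : (SimpleGraph.cycleGraph (k + 2)).Adj (e a) (e b) ↔
        (SimpleGraph.cycleGraph (k + 2)).Adj a b := by
      have e1 (a b : ZMod (k + 2)) : e a - e b = ε * (a - b) := by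
        simp only [e, Equiv.coe_fn_mk]; ring
      have e2 (a b : ZMod (k + 2)) : e a - e b = 1 ∨ e b - e a = 1 ↔ a - b = 1 ∨ b - a = 1 := by
        rw [e1, e1]
        rcases hε with rfl | rfl
        · simp
        · simp [or_comm]
      exact (hadj (e a) (e b)).trans ((e2 a b).trans (hadj a b).symm)
    exact h1
  · have h2 := hval a
    have h3 := hval (e a)
    exact h3.trans (congrArg (fun x : ZMod (k + 2) => ε * x + s) h2.symm)

lemma congruent_compl {N : ℕ} (hN : 2 ≤ N) {X : Finset (Fin N)} {ε s : ℤ} (hε : ε = 1 ∨ ε = -1)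
    (h : ∀ i, i ∈ liftToInt Xᶜ ↔ ε * i + s ∈ liftToInt X) : Congruent X Xᶜ := by
  have : NeZero N := ⟨by omega⟩
  obtain ⟨σ, hσ⟩ := exists_iso_cycleGraph hN ε hε s
  have key (a : Fin N) : a ∈ Xᶜ ↔ σ a ∈ X := by
    have hmem (Y : Finset (Fin N)) (a : Fin N) : a ∈ Y ↔ ((a : ℕ) : ZMod N) ∈ residues Y := by
      rw [residues, (natCast_fin_injective N).mem_finset_image]
    rw [hmem, hmem, hσ]
    have := h (a : ℕ)
    rw [mem_liftToInt_iff, mem_liftToInt_iff] at this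
    simpa using this
  refine ⟨σ.symm, ?_⟩
  ext a
  constructor
  · rintro ⟨b, hb, rfl⟩
    have : σ.symm b ∈ Xᶜ := (key _).2 (by simpa using hb)
    simpa using this
  · intro ha
    exact ⟨σ a, (key a).1 (by simpa using ha), by simp⟩

/-! ### Translates of a short pattern -/

/-- Otherwise A would be closed under successors, although by periodicity its complement contains
arbitrarily large integers. -/
lemma exists_transition {A : Set ℤ} {N : ℤ} (hN : 0 < N) (hA : ∀ x, x ∈ A ↔ x + N ∈ A) {x y : ℤ}
    (hx : x ∈ A) (hy : y ∉ A) : ∃ i, i ∈ A ∧ i + 1 ∉ A := by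
  by_contra! h
  have h1 (k : ℕ) : x + k ∈ A := by
    induction k with
    | zero => simpa
    | succ k ih => have := h _ ih; push_cast; rwa [add_assoc] at this
  have h2 (k : ℕ) : y + k * N ∉ A := by
    induction k with
    | zero => simpa
    | succ k ih =>
      rw [hA] at ih
      push_cast
      rwa [add_one_mul, ← add_assoc]
  refine h2 (x - y).natAbs ?_
  have h3 : y + (x - y).natAbs * N = x + (y + (x - y).natAbs * N - x).toNat := by
    rw [Int.toNat_of_nonneg]
    · ring
    · have : x - y ≤ (x - y).natAbs := Int.le_natAbs
      nlinarith [Int.natCast_nonneg (x - y).natAbs]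
  rw [h3]
  exact h1 _

lemma eq_of_abs_sub_lt {x y : ℤ} {t : ℝ} (hx : |t - x| < 1 / 2) (hy : |t - y| < 1 / 2) : x = y := by
  have h1 : |((x - y : ℤ) : ℝ)| < 1 := by
    push_cast
    rw [abs_lt] at *
    constructor <;> linarith [hx.1, hx.2, hy.1, hy.2]
  have h2 : |x - y| < 1 := by exact_mod_cast h1
  have := Int.abs_lt_one_iff.1 h2
  linarith

/-- If two patterns of length less than `1`, repeated at integer places `B` and `A`, agree up to a
translation, then `B` is an integer translate of `A`. -/
lemma exists_translate_eq {A B : Set ℤ} {N : ℤ} (hN : 0 < N) (hA : ∀ x, x ∈ A ↔ x + N ∈ A)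
    (hA1 : A.Nonempty) (hA2 : ∃ y, y ∉ A) {P P' : Set ℝ} (hP : ∀ p ∈ P, |p| < 1 / 2)
    (hP' : ∀ p ∈ P', |p| < 1 / 2) (hP0 : P.Nonempty) (hP'0 : P'.Nonempty) {θ : ℝ}
    (h : ∀ t, (∃ b ∈ B, ∃ p ∈ P, t = b + p) ↔ ∃ a ∈ A, ∃ p ∈ P', t = a + p + θ) :
    ∃ s : ℤ, ∀ x, x ∈ B ↔ x - s ∈ A := by
  obtain ⟨x, hx⟩ := hA1
  obtain ⟨y, hy⟩ := hA2
  -- Relative to the integer part f, the point a + p + θ belongs to the unit interval around a + f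
  -- if p + φ < 1/2, and to the one around a + f + 1 otherwise. These two cases are `hlt` and `hge`.
  set f : ℤ := ⌊θ⌋ with hf
  set φ : ℝ := θ - f with hφ
  have hφ0 : 0 ≤ φ := by have := Int.floor_le θ; linarith
  have hφ1 : φ < 1 := by have := Int.lt_floor_add_one θ; linarith
  have hmk {a : ℤ} (ha : a ∈ A) {p : ℝ} (hp : p ∈ P') :
      ∃ b ∈ B, ∃ p' ∈ P, (a + f : ℤ) + p + φ = b + p' := by
    obtain ⟨b, hb, p', hp', h1⟩ := (h (a + p + θ)).2 ⟨a, ha, p, hp, rfl⟩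
    exact ⟨b, hb, p', hp', by rw [← h1]; push_cast; linarith⟩
  have hmk' {b : ℤ} (hb : b ∈ B) {p : ℝ} (hp : p ∈ P) :
      ∃ a ∈ A, ∃ p' ∈ P', (b : ℝ) + p = (a + f : ℤ) + p' + φ := by
    obtain ⟨a, ha, p', hp', h1⟩ := (h (b + p)).1 ⟨b, hb, p, hp, rfl⟩
    exact ⟨a, ha, p', hp', by rw [h1]; push_cast; linarith⟩
  have hlt {a : ℤ} (ha : a ∈ A) {p : ℝ} (hp : p ∈ P') (hs : p + φ < 1 / 2) :
      a + f ∈ B ∧ p + φ ∈ P := by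
    obtain ⟨b, hb, p', hp', e⟩ := hmk ha hp
    have h1 := abs_lt.1 (hP' p hp)
    have h2 : a + f = b := eq_of_abs_sub_lt (t := (a + f : ℤ) + p + φ)
      (by rw [abs_lt]; constructor <;> linarith [h1.1])
      (by rw [e]; simpa using hP p' hp')
    refine ⟨h2 ▸ hb, ?_⟩
    have : p + φ = p' := by rw [h2] at e; linarith
    rwa [this]
  have hge {a : ℤ} (ha : a ∈ A) {p : ℝ} (hp : p ∈ P') (hs : 1 / 2 ≤ p + φ) :
      a + f + 1 ∈ B ∧ p + φ - 1 ∈ P := by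
    obtain ⟨b, hb, p', hp', e⟩ := hmk ha hp
    have h1 := abs_lt.1 (hP' p hp)
    have h3 := abs_lt.1 (hP p' hp')
    have h2 : b = a + f + 1 := by
      have h4 : ((b - (a + f) : ℤ) : ℝ) > 0 := by push_cast at e ⊢; linarith [h3.2]
      have h5 : ((b - (a + f) : ℤ) : ℝ) < 2 := by push_cast at e ⊢; linarith [h3.1]
      have h6 : 0 < b - (a + f) := by exact_mod_cast h4
      have h7 : b - (a + f) < 2 := by exact_mod_cast h5
      omega
    refine ⟨h2 ▸ hb, ?_⟩
    have : p + φ - 1 = p' := by rw [h2] at e; push_cast at e; linarith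
    rwa [this]
  have hB {b : ℤ} (hb : b ∈ B) {p : ℝ} (hp : p ∈ P) :
      (b - f ∈ A ∧ ∃ p' ∈ P', p = p' + φ) ∨ b - f - 1 ∈ A ∧ ∃ p' ∈ P', p = p' + φ - 1 := by
    obtain ⟨a, ha, p', hp', e⟩ := hmk' hb hp
    have h1 := abs_lt.1 (hP' p' hp')
    have h3 := abs_lt.1 (hP p hp)
    have h4 : ((b - (a + f) : ℤ) : ℝ) > -1 := by push_cast at e ⊢; linarith [h3.2, h1.1]
    have h5 : ((b - (a + f) : ℤ) : ℝ) < 2 := by push_cast at e ⊢; linarith [h3.1, h1.2]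
    have h6 : -1 < b - (a + f) := by exact_mod_cast h4
    have h7 : b - (a + f) < 2 := by exact_mod_cast h5
    rcases (show b = a + f ∨ b = a + f + 1 by omega) with rfl | rfl
    · left
      exact ⟨by simpa using ha, p', hp', by linarith⟩
    · right
      refine ⟨by convert ha using 1; ring, p', hp', ?_⟩
      push_cast at e
      linarith
  obtain ⟨p₀, hp₀⟩ := hP0
  obtain ⟨p₁, hp₁⟩ := hP'0
  by_cases h0 : ∃ p ∈ P', p + φ < 1 / 2
  · obtain ⟨q, hq, hqs⟩ := h0
    by_cases h1 : ∃ p ∈ P', 1 / 2 ≤ p + φ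
    -- Here the shifted pattern straddles a border. Just after a run of A ends, the interval i + f +
    -- 1 receives only overflow, so p₀ < φ - 1/2; where a run begins, the interval i' + 1 + f
    -- receives no overflow, so φ - 1/2 < p₀. Both intervals carry the same pattern P containing p₀.
    · exfalso
      obtain ⟨q', hq', hqs'⟩ := h1
      obtain ⟨i, hi, hi'⟩ := exists_transition hN hA hx hy
      obtain ⟨i', hi1, hi2⟩ := exists_transition (A := Aᶜ) hN (fun x => not_congr (hA x)) hy
        (by simpa using hx)
      simp only [Set.mem_compl_iff, not_not] at hi1 hi2
      have hb := (hge hi hq' hqs').1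
      have hb' := (hlt hi2 hq hqs).1
      have e1 : p₀ < φ - 1 / 2 := by
        rcases hB hb hp₀ with ⟨h, -⟩ | ⟨-, p', hp', e⟩
        · exact (hi' (by convert h using 1; ring)).elim
        · have := abs_lt.1 (hP' p' hp')
          linarith
      have e2 : φ - 1 / 2 < p₀ := by
        rcases hB hb' hp₀ with ⟨-, p', hp', e⟩ | ⟨h, -⟩
        · have := abs_lt.1 (hP' p' hp')
          linarith
        · exact (hi1 (by convert h using 1; ring)).elim
      linarith
    · push Not at h1
      refine ⟨f, fun x => ⟨fun hx => ?_, fun hx => ?_⟩⟩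
      · rcases hB hx hp₀ with ⟨h, -⟩ | ⟨-, p', hp', e⟩
        · exact h
        · have := h1 p' hp'
          have := abs_lt.1 (hP p₀ hp₀)
          linarith
      · simpa using (hlt hx hq hqs).1
  · push Not at h0
    refine ⟨f + 1, fun x => ⟨fun hx => ?_, fun hx => ?_⟩⟩
    · rcases hB hx hp₀ with ⟨-, p', hp', e⟩ | ⟨h, -⟩
      · have := h0 p' hp'
        have := abs_lt.1 (hP p₀ hp₀)
        linarith
      · convert h using 1; ring
    · have := (hge hx hp₁ (h0 p₁ hp₁)).1
      convert this using 1; ring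

/-! ### Rotations and reflections relating the boundaries -/

namespace RotationData

variable {m : ℕ} {γ : SL(2, ℝ)} {𝒢₀ : Set (Set ℍ)} {z₀ : ℍ} {ρ c : ℂ}

lemma liftToInt_congr {N : ℕ} {X : Finset (Fin N)} {i k : ℤ} (h : (N : ℤ) ∣ k - i) :
    i ∈ liftToInt X ↔ k ∈ liftToInt X := by
  constructor
  · intro hi; simpa using liftToInt_add hi h
  · intro hk; simpa using liftToInt_add hk (k := i - k) (by rw [← neg_sub]; exact h.neg_right)

/-- The directions of the points on the translates. -/
lemma direction_iff (R : RotationData m γ 𝒢₀ z₀ ρ c) {N : ℕ} (hN : N ∣ m) (X : Finset (Fin N))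
    {j j' : ℤ} (hj : ρ = unitDir m j) (hj' : ρ ^ j' = unitDir m 1) (hjj : (m : ℤ) ∣ j * j' - 1)
    (t : ℝ) :
    (∃ z ∈ ⋃₀ translates γ 𝒢₀ X, IsDir m c (coordW z₀ z) t) ↔
      ∃ y ∈ {y : ℤ | y * j' ∈ liftToInt X},
        ∃ p ∈ {p : ℝ | |p| < 1 / 2 ∧ ∃ z ∈ ⋃₀ 𝒢₀, IsDir m c (coordW z₀ z) p}, t = y + p := by
  have hm : m ≠ 0 := by have := R.two_le; omega
  have hNm : (N : ℤ) ∣ m := Int.natCast_dvd_natCast.2 hN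
  constructor
  · rintro ⟨z, ⟨_, ⟨i, hi, ℓ, hℓ, rfl⟩, hz⟩, ht⟩
    have h1 := R.mem_sector hℓ hz
    rw [coordT_eq_sqrt] at h1
    obtain ⟨k, hk⟩ := R.exists_direction hj h1 ht
    refine ⟨i * j + k * m, ?_, t - (i * j + k * m : ℤ), ⟨?_, ?_⟩, by ring⟩
    · refine (liftToInt_congr ?_).1 hi
      have : (i * j + k * m) * j' - i = i * (j * j' - 1) + k * j' * m := by ring
      rw [this]
      exact dvd_add ((hNm.trans hjj).mul_left _) (hNm.mul_left _)
    · push_cast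
      rwa [← sub_sub]
    · refine ⟨(γ ^ i)⁻¹ • z, ⟨ℓ, hℓ, Set.mem_smul_set_iff_inv_smul_mem.1 hz⟩, ?_⟩
      rw [← zpow_neg, coordW_zpow R.norm_rot R.rot, hj, unitDir_zpow]
      have h2 : unitDir m ((-i : ℤ) * j) = unitDir m (-(i * j + k * m : ℤ)) := by
        have h3 : unitDir m (-k * m) = 1 := (unitDir_eq_one_iff hm).2 ⟨-k, by push_cast; ring⟩
        have : (-(i * j + k * m : ℤ) : ℝ) = (-i : ℤ) * j + (-k * m) := by push_cast; ring
        rw [this, unitDir_add, h3, mul_one]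
      rw [h2, sub_eq_neg_add]
      exact ht.mul _
  · rintro ⟨y, hy, p, ⟨-, z, ⟨ℓ, hℓ, hz⟩, hp⟩, rfl⟩
    refine ⟨γ ^ (y * j') • z, ⟨_, ⟨_, hy, ℓ, hℓ, rfl⟩, Set.smul_mem_smul_set hz⟩, ?_⟩
    rw [coordW_zpow R.norm_rot R.rot, mul_comm y, zpow_mul, hj', unitDir_zpow, mul_one]
    exact hp.mul _

lemma _root_.OrthoSpec.IsDir.conj {m : ℕ} {c w : ℂ} {t φ : ℝ} (hφ : starRingEnd ℂ c = unitDir m φ * c)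
    (h : IsDir m c w t) : IsDir m c (starRingEnd ℂ w) (φ - t) := by
  have h1 := congrArg (starRingEnd ℂ) h
  rw [IsDir, RCLike.norm_conj, sub_eq_add_neg, unitDir_add, h1]
  simp only [map_mul, map_div₀, Complex.conj_ofReal, conj_unitDir, hφ]
  ring

/-- If a rotation or reflection about the base point maps the boundary belonging to `X` to the
one belonging to the complement of `X`, then these sets are congruent. -/
lemma congruent_of_rotation (R : RotationData m γ 𝒢₀ z₀ ρ c) {n : ℕ} (hn : 2 * n ∣ m)
    {X : Finset (Fin (2 * n))} (hX : X.card = n) (h0 : 𝒢₀.Nonempty) {η : ℂ} (hη : ‖η‖ = 1)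
    {F : ℂ → ℂ} (hF : F = (fun w => η * w) ∨ F = fun w => η * starRingEnd ℂ w)
    (h : coordW z₀ '' ⋃₀ translates γ 𝒢₀ Xᶜ = F '' (coordW z₀ '' ⋃₀ translates γ 𝒢₀ X)) :
    Congruent X Xᶜ := by
  have hm : 0 < m := by have := R.two_le; omega
  have hn0 : 0 < 2 * n := Nat.pos_of_dvd_of_pos hn hm
  have : NeZero (2 * n) := ⟨hn0.ne'⟩
  have hnm : ((2 * n : ℕ) : ℤ) ∣ m := Int.natCast_dvd_natCast.2 hn
  obtain ⟨j, j', hj, hj', hjj⟩ := R.exists_exponents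
  have hjN : ((2 * n : ℕ) : ℤ) ∣ j * j' - 1 := hnm.trans hjj
  obtain ⟨θ, rfl⟩ := exists_unitDir hm.ne' hη
  -- `Y X` lists the occupied positions in their cyclic order around `z₀`; multiplication by j'
  -- turns a position back into an exponent of γ.
  set Y : Finset (Fin (2 * n)) → Set ℤ := fun X => {y : ℤ | y * j' ∈ liftToInt X} with hY
  set P : Set ℝ := {p : ℝ | |p| < 1 / 2 ∧ ∃ z ∈ ⋃₀ 𝒢₀, IsDir m c (coordW z₀ z) p} with hP
  have hdir (X) (t) := R.direction_iff hn X hj hj' hjj t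
  have hYX {X} {i : ℤ} : i ∈ liftToInt X ↔ i * j ∈ Y X := by
    refine liftToInt_congr ?_
    have : i * j * j' - i = i * (j * j' - 1) := by ring
    rw [this]; exact hjN.mul_left _
  have hper (x : ℤ) : x ∈ Y X ↔ x + (2 * n : ℕ) ∈ Y X := by
    refine liftToInt_congr ?_
    have : (x + (2 * n : ℕ)) * j' - x * j' = (2 * n : ℕ) * j' := by ring
    rw [this]; exact dvd_mul_right _ _
  have hne : (Y X).Nonempty := by
    obtain ⟨a, ha⟩ : X.Nonempty := Finset.card_pos.1 (by omega)
    exact ⟨_, hYX.1 ⟨a, ha, Int.ModEq.refl _⟩⟩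
  have hne' : ∃ y, y ∉ Y X := by
    obtain ⟨a, ha⟩ : Xᶜ.Nonempty := Finset.card_pos.1 (by
      rw [Finset.card_compl, Fintype.card_fin]; omega)
    exact ⟨(a : ℤ) * j, fun h => mem_liftToInt_compl.1 ⟨a, ha, Int.ModEq.refl _⟩ (hYX.2 h)⟩
  have hPne : P.Nonempty := by
    obtain ⟨ℓ, hℓ⟩ := h0
    obtain ⟨z, hz⟩ := (R.geodesic ℓ hℓ).nonempty
    obtain ⟨i, hi⟩ := hne
    obtain ⟨t, ht⟩ := exists_isDir hm.ne' R.c_ne_zero (coordW z₀ (γ ^ (i * j') • z))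
    obtain ⟨-, -, p, hp, -⟩ := (hdir X t).1
      ⟨_, ⟨_, ⟨_, hi, ℓ, hℓ, rfl⟩, Set.smul_mem_smul_set hz⟩, ht⟩
    exact ⟨p, hp⟩
  have hn2 : 2 ≤ 2 * n := by omega
  have hN : (0 : ℤ) < (2 * n : ℕ) := by exact_mod_cast hn0
  have himg (G : ℂ → ℂ) (S : Set ℍ) (t : ℝ) : (∃ z ∈ S, IsDir m c (G (coordW z₀ z)) t) ↔
      ∃ w ∈ G '' (coordW z₀ '' S), IsDir m c w t := by simp
  have hconv {s ε : ℤ} (hε : ε = 1 ∨ ε = -1) (hs : ∀ x, x ∈ Y Xᶜ ↔ ε * x + s ∈ Y X) :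
      Congruent X Xᶜ := by
    refine congruent_compl hn2 (ε := ε) (s := s * j') hε fun i => ?_
    rw [hYX, hs, hYX]
    refine liftToInt_congr ?_
    have : (ε * i + s * j') * j * j' - (ε * (i * j) + s) * j' = s * j' * (j * j' - 1) := by ring
    rw [this]; exact hjN.mul_left _
  rcases hF with rfl | rfl
  · obtain ⟨s, hs⟩ := exists_translate_eq (B := Y Xᶜ) (A := Y X) (P := P) (P' := P) (θ := θ)
      hN hper hne hne' (fun p hp => hp.1) (fun p hp => hp.1) hPne hPne fun t => by
        rw [← hdir Xᶜ t]
        have e1 := himg id (⋃₀ translates γ 𝒢₀ Xᶜ) t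
        simp only [id, Set.image_id'] at e1
        rw [e1, h, ← himg]
        have e2 : (∃ z ∈ ⋃₀ translates γ 𝒢₀ X, IsDir m c (unitDir m θ * coordW z₀ z) t) ↔
            ∃ z ∈ ⋃₀ translates γ 𝒢₀ X, IsDir m c (coordW z₀ z) (t - θ) := by
          refine exists_congr fun z => and_congr_right fun _ => ⟨fun h => ?_, fun h => ?_⟩
          · have := h.mul (-θ)
            rwa [← mul_assoc, ← unitDir_add, neg_add_cancel, unitDir_zero, one_mul,
              neg_add_eq_sub] at this
          · have := h.mul θ
            rwa [add_sub_cancel] at this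
        rw [e2, hdir X]
        refine exists_congr fun y => and_congr_right fun _ => exists_congr fun p =>
          and_congr_right fun _ => ?_
        rw [sub_eq_iff_eq_add]
    exact hconv (ε := 1) (s := -s) (Or.inl rfl) fun x => by rw [hs x, one_mul, sub_eq_add_neg]
  -- A reflection acts on directions by t ↦ φ - t up to rotation, where φ accounts for the argument
  -- of c. Positions and pattern are therefore both negated before they are compared.
  · obtain ⟨φ, hφ⟩ : ∃ φ, starRingEnd ℂ c = unitDir m φ * c := by
      obtain ⟨φ, hφ⟩ := exists_unitDir hm.ne' (u := starRingEnd ℂ c / c) (by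
        rw [norm_div, RCLike.norm_conj, div_self (norm_ne_zero_iff.2 R.c_ne_zero)])
      exact ⟨φ, by rw [← hφ, div_mul_cancel₀ _ R.c_ne_zero]⟩
    obtain ⟨s, hs⟩ := exists_translate_eq (B := Y Xᶜ) (A := {y | -y ∈ Y X}) (P := P)
      (P' := {p | -p ∈ P}) (θ := θ + φ) hN
      (fun x => by
        have := hper (-x - (2 * n : ℕ))
        rw [sub_add_cancel] at this
        simp only [Set.mem_ofPred_eq, neg_add, ← sub_eq_add_neg]
        exact this.symm)
      (by obtain ⟨y, hy⟩ := hne; exact ⟨-y, by simpa using hy⟩)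
      (by obtain ⟨y, hy⟩ := hne'; exact ⟨-y, by simpa using hy⟩)
      (fun p hp => hp.1) (fun p hp => by simpa using (show -p ∈ P from hp).1) hPne
      (by obtain ⟨p, hp⟩ := hPne; exact ⟨-p, by simpa using hp⟩) fun t => by
        rw [← hdir Xᶜ t]
        have e1 := himg id (⋃₀ translates γ 𝒢₀ Xᶜ) t
        simp only [id, Set.image_id'] at e1
        rw [e1, h, ← himg]
        have e2 : (∃ z ∈ ⋃₀ translates γ 𝒢₀ X,
            IsDir m c (unitDir m θ * starRingEnd ℂ (coordW z₀ z)) t) ↔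
            ∃ z ∈ ⋃₀ translates γ 𝒢₀ X, IsDir m c (coordW z₀ z) (θ + φ - t) := by
          refine exists_congr fun z => and_congr_right fun _ => ⟨fun h => ?_, fun h => ?_⟩
          · have := h.mul (-θ)
            rw [← mul_assoc, ← unitDir_add, neg_add_cancel, unitDir_zero, one_mul] at this
            have := this.conj hφ
            rw [Complex.conj_conj] at this
            convert this using 1; ring
          · have := (h.conj hφ).mul θ
            convert this using 1; ring
        rw [e2, hdir X]
        constructor
        · rintro ⟨y, hy, p, hp, e⟩
          exact ⟨-y, show - -y ∈ Y X by rwa [neg_neg], -p, show - -p ∈ P by rwa [neg_neg],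
            by push_cast; linarith⟩
        · rintro ⟨y, hy, p, hp, e⟩
          exact ⟨-y, hy, -p, hp, by push_cast; linarith⟩
    exact hconv (ε := -1) (s := s) (Or.inr rfl) fun x => by
      rw [hs x, Set.mem_ofPred_eq, neg_one_mul, neg_sub, sub_eq_neg_add]

end RotationData

/-! ### The quotient distance -/

lemma dist_smul_smul_sl (A : SL(2, ℝ)) (x y : ℍ) : dist (A • x) (A • y) = dist x y := dist_smul _ _ _

/-- Moving both points by one group element keeps the first one fixed, and the infimum over a finite
orbit is attained. -/
lemma isLeast_quotientDist {Γ : Subgroup SL(2, ℝ)} [Finite Γ] (x y : ℍ) :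
    IsLeast {r | ∃ w ∈ MulAction.orbit Γ y, dist x w = r}
      (quotientDist (MulAction.orbit Γ x) (MulAction.orbit Γ y)) := by
  have h : {r | ∃ x' ∈ MulAction.orbit Γ x, ∃ y' ∈ MulAction.orbit Γ y, dist x' y' = r} =
      {r | ∃ w ∈ MulAction.orbit Γ y, dist x w = r} := by
    ext r
    constructor
    · rintro ⟨_, ⟨A, rfl⟩, _, ⟨B, rfl⟩, rfl⟩
      refine ⟨(A⁻¹ * B) • y, ⟨_, rfl⟩, ?_⟩
      rw [← dist_smul_smul_sl A, mul_smul]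
      congr 1
      exact smul_inv_smul A (B • y)
    · rintro ⟨w, hw, rfl⟩
      exact ⟨x, MulAction.mem_orbit_self x, w, hw, rfl⟩
  rw [quotientDist, h]
  have hfin : {r | ∃ w ∈ MulAction.orbit Γ y, dist x w = r}.Finite :=
    (Set.finite_range fun A : Γ => A • y).image (dist x)
  have hne : {r | ∃ w ∈ MulAction.orbit Γ y, dist x w = r}.Nonempty :=
    ⟨_, y, MulAction.mem_orbit_self y, rfl⟩
  exact ⟨hne.csInf_mem hfin, fun r hr => csInf_le hfin.bddBelow hr⟩

/-- An isometry of quotients lifts to a map. -/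
lemma QuotientsIsometric.exists_lift {S S' : Set ℍ} {Γ Γ' : Subgroup SL(2, ℝ)}
    (h : QuotientsIsometric S Γ S' Γ') : ∃ f : ℍ → ℍ, (∀ x ∈ S, f x ∈ S') ∧
      (∀ x ∈ S, ∀ y ∈ S, quotientDist (MulAction.orbit Γ' (f x)) (MulAction.orbit Γ' (f y)) =
        quotientDist (MulAction.orbit Γ x) (MulAction.orbit Γ y)) ∧
      ∀ y ∈ S', ∃ x ∈ S, MulAction.orbit Γ' (f x) = MulAction.orbit Γ' y := by
  classical
  obtain ⟨F, hF⟩ := h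
  let mk (x : ℍ) (hx : x ∈ S) : quotientPoints S Γ := ⟨MulAction.orbit Γ x, x, hx, rfl⟩
  have hch (x : ℍ) (hx : x ∈ S) :
      ∃ y ∈ S', (F (mk x hx) : Set ℍ) = MulAction.orbit Γ' y := (F (mk x hx)).2
  choose! f hf hfo using hch
  refine ⟨f, hf, fun x hx y hy => ?_, fun y hy => ?_⟩
  · rw [← hfo x hx, ← hfo y hy, hF]
  · obtain ⟨⟨_, x, hx, rfl⟩, hO⟩ := F.surjective ⟨MulAction.orbit Γ' y, y, hy, rfl⟩
    refine ⟨x, hx, ?_⟩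
    rw [← hfo x hx]
    exact congrArg Subtype.val hO

/-! ### Maps of sets of plane vectors that preserve inner products -/

lemma eq_or_eq_conj {u v : ℂ} (hn : ‖u‖ = ‖v‖) (hre : u.re = v.re) :
    u = v ∨ u = starRingEnd ℂ v := by
  have h : u.im ^ 2 = v.im ^ 2 := by
    have h1 := Complex.sq_norm u
    have h2 := Complex.sq_norm v
    rw [Complex.normSq_apply] at h1 h2
    rw [hn, h2, hre] at h1
    linarith
  rcases sq_eq_sq_iff_eq_or_eq_neg.1 h with h | h
  · exact Or.inl (Complex.ext hre h)
  · exact Or.inr (Complex.ext hre h)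

lemma inner_eq_re (u v : ℂ) : inner ℝ u v = (starRingEnd ℂ u * v).re := by
  rw [inner_eq_re_im]; simp

/-- After multiplication by the conjugate of one fixed nonzero vector on each side, every V i agrees
with U i up to conjugation. If one index really needs conjugation, its inner products with the
others force conjugation for all. -/
lemma exists_rotation_or_reflection {ι : Type*} {U V : ι → ℂ}
    (h : ∀ i j, inner ℝ (V i) (V j) = inner ℝ (U i) (U j)) :
    ∃ η : ℂ, ‖η‖ = 1 ∧ ((∀ i, V i = η * U i) ∨ ∀ i, V i = η * starRingEnd ℂ (U i)) := by
  have hnorm (i) : ‖V i‖ = ‖U i‖ := by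
    have := h i i
    rw [real_inner_self_eq_norm_sq, real_inner_self_eq_norm_sq] at this
    exact (pow_left_inj₀ (norm_nonneg _) (norm_nonneg _) two_ne_zero).1 this
  by_cases h0 : ∀ i, U i = 0
  · refine ⟨1, norm_one, Or.inl fun i => ?_⟩
    rw [h0, mul_zero, ← norm_eq_zero, hnorm, h0, norm_zero]
  push Not at h0
  obtain ⟨i₀, h0⟩ := h0
  have hV0 : V i₀ ≠ 0 := by rw [← norm_ne_zero_iff, hnorm]; exact norm_ne_zero_iff.2 h0
  have hcU : starRingEnd ℂ (U i₀) ≠ 0 := (map_ne_zero _).2 h0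
  have hcV : starRingEnd ℂ (V i₀) ≠ 0 := (map_ne_zero _).2 hV0
  have hVU : starRingEnd ℂ (V i₀) * V i₀ = starRingEnd ℂ (U i₀) * U i₀ := by
    rw [mul_comm, Complex.mul_conj, mul_comm, Complex.mul_conj, Complex.normSq_eq_norm_sq,
      Complex.normSq_eq_norm_sq, hnorm]
  have hdich (i) := eq_or_eq_conj (u := starRingEnd ℂ (V i₀) * V i)
    (v := starRingEnd ℂ (U i₀) * U i) (by simp [hnorm])
    (by rw [← inner_eq_re, ← inner_eq_re, h])
  by_cases h1 : ∀ i, starRingEnd ℂ (V i₀) * V i = starRingEnd ℂ (U i₀) * U i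
  · refine ⟨V i₀ / U i₀, by rw [norm_div, hnorm, div_self (norm_ne_zero_iff.2 h0)],
      Or.inl fun i => mul_left_cancel₀ hcV ?_⟩
    rw [h1, div_mul_eq_mul_div, mul_div_assoc', eq_div_iff h0, ← mul_assoc, hVU]
    ring
  · push Not at h1
    obtain ⟨i₁, h1⟩ := h1
    have e1 := (hdich i₁).resolve_left h1
    refine ⟨V i₀ / starRingEnd ℂ (U i₀), by
      rw [norm_div, RCLike.norm_conj, hnorm, div_self (norm_ne_zero_iff.2 h0)],
      Or.inr fun i => mul_left_cancel₀ hcV ?_⟩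
    have e2 : starRingEnd ℂ (V i₀) * V i = starRingEnd ℂ (starRingEnd ℂ (U i₀) * U i) := by
      rcases hdich i with e | e
      · have h2 : inner ℝ (starRingEnd ℂ (V i₀) * V i) (starRingEnd ℂ (V i₀) * V i₁) =
            inner ℝ (starRingEnd ℂ (U i₀) * U i) (starRingEnd ℂ (U i₀) * U i₁) := by
          have key (a b c : ℂ) : inner ℝ (starRingEnd ℂ a * b) (starRingEnd ℂ a * c) =
              ‖a‖ ^ 2 * inner ℝ b c := by
            rw [← Complex.normSq_eq_norm_sq, Complex.normSq_apply]
            simp only [inner_eq_re_im, Complex.mul_re, Complex.mul_im, Complex.conj_re,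
              Complex.conj_im]
            ring
          rw [key, key, h, hnorm]
        rw [e, e1, inner_eq_re_im, inner_eq_re_im, Complex.conj_re, Complex.conj_im] at h2
        have h3 : (starRingEnd ℂ (U i₀) * U i₁).im ≠ 0 := by
          intro h3
          apply h1
          rw [e1]
          exact Complex.conj_eq_iff_im.2 h3
        have h4 : (starRingEnd ℂ (U i₀) * U i).im * (starRingEnd ℂ (U i₀) * U i₁).im = 0 := by
          linarith
        rw [e]
        exact (Complex.conj_eq_iff_im.2 ((mul_eq_zero.1 h4).resolve_right h3)).symm
      · exact e
    rw [e2, map_mul, Complex.conj_conj, div_mul_eq_mul_div, mul_div_assoc', eq_div_iff hcU,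
      ← mul_assoc, hVU]
    ring

/-! ### Midpoints -/

/-- Every point of `S` is the midpoint of arbitrarily short segments with endpoints in `S`. -/
def HasMidpoints (S : Set ℍ) : Prop :=
  ∀ p ∈ S, ∃ ε₀ > 0, ∀ ε, 0 < ε → ε < ε₀ →
    ∃ x ∈ S, ∃ y ∈ S, dist p x = ε ∧ dist p y = ε ∧ dist x y = 2 * ε

lemma cosh_inj_of_nonneg {a b : ℝ} (ha : 0 ≤ a) (hb : 0 ≤ b) (h : Real.cosh a = Real.cosh b) : a = b := by
  rw [← abs_of_nonneg ha, ← abs_of_nonneg hb]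
  exact le_antisymm (Real.cosh_le_cosh.1 h.le) (Real.cosh_le_cosh.1 h.ge)

lemma exists_opposite (p : ℍ) {u : ℂ} (hu : ‖u‖ = 1) {ε : ℝ} (hε : 0 < ε) :
    ∃ x y, coordW p x = Real.sinh ε * u ∧ coordW p y = -(Real.sinh ε * u) ∧
      dist p x = ε ∧ dist p y = ε ∧ dist x y = 2 * ε := by
  have hT (w : ℂ) (hw : ‖w‖ = Real.sinh ε) : √(1 + ‖w‖ ^ 2) = Real.cosh ε := by
    rw [hw, ← Real.cosh_sq', Real.sqrt_sq (Real.cosh_pos _).le]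
  have hs : 0 ≤ Real.sinh ε := (Real.sinh_pos_iff.2 hε).le
  have hn : ‖(Real.sinh ε * u : ℂ)‖ = Real.sinh ε := by
    rw [norm_mul, hu, mul_one, Complex.norm_real, Real.norm_of_nonneg hs]
  refine ⟨(coordHomeo p).symm (Real.sinh ε * u), (coordHomeo p).symm (-(Real.sinh ε * u)),
    coordW_symm _ _, coordW_symm _ _, cosh_inj_of_nonneg dist_nonneg hε.le ?_, cosh_inj_of_nonneg dist_nonneg hε.le ?_,
    cosh_inj_of_nonneg dist_nonneg (by linarith) ?_⟩
  · rw [cosh_dist_base, coordT_symm, hT _ hn]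
  · rw [cosh_dist_base, coordT_symm, hT _ (by rw [norm_neg, hn])]
  · rw [cosh_dist_eq p, coordT_symm, coordT_symm, hT _ hn, hT _ (by rw [norm_neg, hn]), coordW_symm,
      coordW_symm, inner_neg_right, real_inner_self_eq_norm_sq, hn, Real.cosh_two_mul]
    ring

lemma hasMidpoints_of_isOpen {D : Set ℍ} (hD : IsOpen D) : HasMidpoints D := by
  intro p hp
  obtain ⟨ε₀, h0, hb⟩ := Metric.isOpen_iff.1 hD p hp
  refine ⟨ε₀, h0, fun ε h1 h2 => ?_⟩
  obtain ⟨x, y, -, -, hx, hy, hxy⟩ := exists_opposite p norm_one h1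
  exact ⟨x, hb (by rw [Metric.mem_ball, dist_comm, hx]; exact h2), y,
    hb (by rw [Metric.mem_ball, dist_comm, hy]; exact h2), hx, hy, hxy⟩

/-- A boundary point is the midpoint of segments on its own boundary geodesic, in the direction
orthogonal to the normal vector b. -/
lemma IsHypOrbifold.hasMidpoints_closure {D : Set ℍ} {𝒢 : Set (Set ℍ)} {Γ : Subgroup SL(2, ℝ)}
    (h : IsHypOrbifold D 𝒢 Γ) : HasMidpoints (closure D) := by
  intro p hp
  by_cases hpD : p ∈ D
  · obtain ⟨ε₀, h0, hm⟩ := hasMidpoints_of_isOpen h.isOpen p hpD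
    refine ⟨ε₀, h0, fun ε h1 h2 => ?_⟩
    obtain ⟨x, hx, y, hy, e⟩ := hm ε h1 h2
    exact ⟨x, subset_closure hx, y, subset_closure hy, e⟩
  · have hfr : p ∈ frontier D := by rw [h.isOpen.frontier_eq]; exact ⟨hp, hpD⟩
    rw [h.frontier_eq] at hfr
    obtain ⟨ℓ, hℓ, hpℓ⟩ := hfr
    have hsub : ℓ ⊆ closure D :=
      (Set.subset_sUnion_of_mem hℓ).trans (h.frontier_eq.superset.trans frontier_subset_closure)
    obtain ⟨q, hq, rfl⟩ := isGeodesic_iff.1 (h.geodesic ℓ hℓ)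
    obtain ⟨a, b, hab, hlin⟩ := exists_linForm_eq_quadForm p q
    have ha : a = 0 := by
      have : quadForm q p = 0 := hpℓ
      rwa [hlin, linForm_self] at this
    have hb : b ≠ 0 := by
      rintro rfl
      rw [ha] at hab
      simp only [norm_zero] at hab
      linarith
    have hu : ‖Complex.I * (b / ‖b‖)‖ = 1 := by
      rw [norm_mul, norm_div, Complex.norm_I, Complex.norm_real, norm_norm, one_mul,
        div_self (norm_ne_zero_iff.2 hb)]
    have hin (s : ℝ) : inner ℝ b (s * (Complex.I * (b / ‖b‖))) = 0 := by
      have : (s * (Complex.I * (b / ‖b‖)) : ℂ) = ((s / ‖b‖ : ℝ) : ℂ) * (Complex.I * b) := by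
        push_cast; ring
      rw [this, inner_eq_re_im]
      simp
      ring
    refine ⟨1, one_pos, fun ε h1 _ => ?_⟩
    obtain ⟨x, y, hWx, hWy, hx, hy, hxy⟩ := exists_opposite p hu h1
    refine ⟨x, hsub ?_, y, hsub ?_, hx, hy, hxy⟩
    · rw [Set.mem_ofPred_eq, hlin, linForm, ha, hWx, hin]; simp
    · rw [Set.mem_ofPred_eq, hlin, linForm, ha, hWy, inner_neg_right, hin]; simp

/-! ### Isometries of quotients by rotation groups -/

section Rotations

variable {z₀ : ℍ} {k : ℕ} {Γ : Subgroup SL(2, ℝ)}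

/-- The rotates of v by all k-th roots of unity sum to zero, so their inner products with u cannot
all be negative. -/
lemma exists_inner_nonneg (hk : 2 ≤ k) (u v : ℂ) : ∃ ζ : ℂ, ζ ^ k = 1 ∧ 0 ≤ inner ℝ u (ζ * v) := by
  set ω := Complex.exp (2 * Real.pi * Complex.I / k)
  have hω : IsPrimitiveRoot ω k := Complex.isPrimitiveRoot_exp k (by omega)
  have hsum : ∑ i ∈ Finset.range k, inner ℝ u (ω ^ i * v) = 0 := by
    rw [← inner_sum, ← Finset.sum_mul, hω.geom_sum_eq_zero (by omega), zero_mul, inner_zero_right]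
  by_contra! hneg
  have : ∑ i ∈ Finset.range k, inner ℝ u (ω ^ i * v) < 0 :=
    Finset.sum_neg (fun i _ => hneg _ (by rw [← pow_mul, mul_comm, pow_mul, hω.pow_eq_one, one_pow]))
      (by simp; omega)
  linarith

/-- `Γ` acts as the rotations about `z₀` whose order divides `k`. -/
def IsRotationGroup (z₀ : ℍ) (k : ℕ) (Γ : Subgroup SL(2, ℝ)) : Prop :=
  (∀ A : Γ, ∃ ζ : ℂ, ζ ^ k = 1 ∧ ∀ z : ℍ, coordW z₀ (A • z) = ζ * coordW z₀ z) ∧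
    ∀ ζ : ℂ, ζ ^ k = 1 → ∃ A : Γ, ∀ z : ℍ, coordW z₀ (A • z) = ζ * coordW z₀ z

lemma IsRotationGroup.mem_orbit_iff (hΓ : IsRotationGroup z₀ k Γ) {z w : ℍ} :
    w ∈ MulAction.orbit Γ z ↔ ∃ ζ : ℂ, ζ ^ k = 1 ∧ coordW z₀ w = ζ * coordW z₀ z := by
  constructor
  · rintro ⟨A, rfl⟩
    obtain ⟨ζ, h, hA⟩ := hΓ.1 A
    exact ⟨ζ, h, hA z⟩
  · rintro ⟨ζ, h, hw⟩
    obtain ⟨A, hA⟩ := hΓ.2 ζ h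
    exact ⟨A, coordW_injective z₀ ((hA z).trans hw.symm)⟩

lemma norm_eq_one_of_pow {ζ : ℂ} (hk : 2 ≤ k) (h : ζ ^ k = 1) : ‖ζ‖ = 1 :=
  Complex.norm_eq_one_of_pow_eq_one h (by omega)

variable [Finite Γ]

lemma IsRotationGroup.quotientDist_base (hΓ : IsRotationGroup z₀ k Γ) (hk : 2 ≤ k) (x : ℍ) :
    quotientDist (MulAction.orbit Γ z₀) (MulAction.orbit Γ x) = dist z₀ x := by
  obtain ⟨⟨w, hw, e⟩, -⟩ := isLeast_quotientDist (Γ := Γ) z₀ x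
  rw [← e]
  obtain ⟨ζ, hζ, hW⟩ := hΓ.mem_orbit_iff.1 hw
  refine cosh_inj_of_nonneg dist_nonneg dist_nonneg ?_
  rw [cosh_dist_base, cosh_dist_base, coordT_eq_sqrt, coordT_eq_sqrt, hW, norm_mul,
    norm_eq_one_of_pow hk hζ, one_mul]

/-- The fixed point of the rotations is not a midpoint in the quotient. -/
lemma IsRotationGroup.quotientDist_lt (hΓ : IsRotationGroup z₀ k Γ) (hk : 2 ≤ k) {x y : ℍ} {ε : ℝ}
    (hε : 0 < ε) (hx : dist z₀ x = ε) (hy : dist z₀ y = ε) :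
    quotientDist (MulAction.orbit Γ x) (MulAction.orbit Γ y) < 2 * ε := by
  -- Some rotate of y is seen from `z₀` within a right angle of x, so its distance d to x satisfies
  -- cosh d ≤ cosh² ε < cosh 2ε.
  obtain ⟨ζ, hζ, hin⟩ := exists_inner_nonneg hk (coordW z₀ x) (coordW z₀ y)
  set w := (coordHomeo z₀).symm (ζ * coordW z₀ y)
  have hw : w ∈ MulAction.orbit Γ y := hΓ.mem_orbit_iff.2 ⟨ζ, hζ, coordW_symm _ _⟩
  refine ((isLeast_quotientDist (Γ := Γ) x y).2 ⟨w, hw, rfl⟩).trans_lt ?_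
  have hTy : coordT z₀ w = Real.cosh ε := by
    rw [coordT_symm, norm_mul, norm_eq_one_of_pow hk hζ, one_mul, ← coordT_eq_sqrt,
      ← cosh_dist_base, hy]
  have h1 : Real.cosh (dist x w) < Real.cosh (2 * ε) := by
    rw [cosh_dist_eq z₀, hTy, ← cosh_dist_base, hx, coordW_symm, Real.cosh_two_mul]
    have := Real.sinh_pos_iff.2 hε
    nlinarith
  have h2 := Real.cosh_lt_cosh.1 h1
  rwa [abs_of_nonneg dist_nonneg, abs_of_pos (by linarith)] at h2

/-- Away from `z₀` stabilisers act trivially, so at small scale the quotient looks like `ℍ` and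
midpoints survive in it. By `quotientDist_lt` this never happens at `z₀`. -/
lemma IsRotationGroup.exists_small (hΓ : IsRotationGroup z₀ k Γ) {p : ℍ} (hp : p ≠ z₀)
    {S : Set ℍ} (hS : HasMidpoints S) (hpS : p ∈ S) :
    ∃ ε > 0, ∃ x ∈ S, ∃ y ∈ S,
      quotientDist (MulAction.orbit Γ p) (MulAction.orbit Γ x) = ε ∧
      quotientDist (MulAction.orbit Γ p) (MulAction.orbit Γ y) = ε ∧
      quotientDist (MulAction.orbit Γ x) (MulAction.orbit Γ y) = 2 * ε := by
  obtain ⟨ε₀, h0, hm⟩ := hS p hpS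
  have hWp : coordW z₀ p ≠ 0 := by rwa [Ne, coordW_eq_zero_iff]
  have htriv (A : Γ) (hA : A • p = p) (z : ℍ) : A • z = z := by
    obtain ⟨ζ, -, hζ⟩ := hΓ.1 A
    have h1 : ζ = 1 := by
      have := hζ p
      rw [hA] at this
      exact (mul_eq_right₀ hWp).1 this.symm
    apply coordW_injective z₀
    rw [hζ, h1, one_mul]
  obtain ⟨δ, hmin, hδ⟩ : ∃ δ : ℝ, (∀ A : Γ, A • p ≠ p → δ ≤ dist p (A • p)) ∧ 0 < δ := by
    have h1 : ∀ᶠ δ : ℝ in nhdsWithin 0 (Set.Ioi 0), ∀ A : Γ, A • p ≠ p → δ ≤ dist p (A • p) := by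
      rw [Filter.eventually_all]
      intro A
      by_cases hA : A • p = p
      · simp [hA]
      · have h2 : 0 < dist p (A • p) := dist_pos.2 (Ne.symm hA)
        filter_upwards [Ioo_mem_nhdsGT h2] with δ hδ _ using hδ.2.le
    exact (h1.and self_mem_nhdsWithin).exists
  -- Since 4ε < δ, a translate of y by an element that moves p has distance at least δ - 2ε > 2ε
  -- from x.
  obtain ⟨ε, hε, hε'⟩ : ∃ ε, 0 < ε ∧ ε < min ε₀ (δ / 4) :=
    exists_between (lt_min h0 (by linarith))
  obtain ⟨hε1, hε2⟩ := lt_min_iff.1 hε'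
  obtain ⟨x, hxS, y, hyS, hx, hy, hxy⟩ := hm ε hε hε1
  have hdist (A : Γ) (u v : ℍ) : dist (A • u) (A • v) = dist u v := dist_smul_smul_sl A u v
  have hbase {z : ℍ} (hz : dist p z = ε) :
      quotientDist (MulAction.orbit Γ p) (MulAction.orbit Γ z) = ε := by
    refine (isLeast_quotientDist p z).unique ⟨⟨z, MulAction.mem_orbit_self z, hz⟩, ?_⟩
    rintro _ ⟨_, ⟨A, rfl⟩, rfl⟩
    by_cases hA : A • p = p
    · simp only [htriv A hA, hz, le_refl]
    · have h1 := hmin A hA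
      have h2 := dist_triangle_right p (A • p) (A • z)
      rw [hdist, hz] at h2
      simp only
      linarith
  refine ⟨ε, hε, x, hxS, y, hyS, hbase hx, hbase hy,
    (isLeast_quotientDist x y).unique ⟨⟨y, MulAction.mem_orbit_self y, hxy⟩, ?_⟩⟩
  rintro _ ⟨_, ⟨A, rfl⟩, rfl⟩
  by_cases hA : A • p = p
  · simp only [htriv A hA, hxy, le_refl]
  · have h1 := hmin A hA
    have h2 := dist_triangle_right p (A • p) (A • y)
    have h3 := dist_triangle p x (A • y)
    rw [hdist, hy] at h2
    simp only
    linarith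

lemma re_pow_eq {u v : ℂ} (hn : ‖u‖ = ‖v‖) (hre : u.re = v.re) (k : ℕ) :
    (u ^ k).re = (v ^ k).re := by
  rcases eq_or_eq_conj hn hre with rfl | rfl
  · rfl
  · rw [← map_pow, Complex.conj_re]

/-- An isometry between the quotients of two sets that contain the centre `z₀` of the rotations
is induced by a rotation or reflection. -/
lemma IsRotationGroup.exists_of_isometric (hΓ : IsRotationGroup z₀ k Γ) (hk : 2 ≤ k)
    {S S' : Set ℍ} (hS' : HasMidpoints S') (hz : z₀ ∈ S) (hinv : ∀ A ∈ Γ, A • S = S)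
    (hinv' : ∀ A ∈ Γ, A • S' = S') (h : QuotientsIsometric S Γ S' Γ) :
    ∃ (η : ℂ) (F : ℂ → ℂ), ‖η‖ = 1 ∧ (F = (fun w => η * w) ∨ F = fun w => η * starRingEnd ℂ w) ∧
      coordW z₀ '' S' = F '' (coordW z₀ '' S) := by
  obtain ⟨f, hf, hfd, hfs⟩ := h.exists_lift
  have hmem {S : Set ℍ} (hinv : ∀ A ∈ Γ, A • S = S) {x w : ℍ} (hx : x ∈ S)
      (hw : w ∈ MulAction.orbit Γ x) : w ∈ S := by
    obtain ⟨A, rfl⟩ := hw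
    rw [← hinv A A.2]
    exact Set.smul_mem_smul_set hx
  have hf0 : f z₀ = z₀ := by
    by_contra hne
    obtain ⟨ε, hε, x', hx', y', hy', e1, e2, e3⟩ := hΓ.exists_small hne hS' (hf _ hz)
    obtain ⟨x, hx, hxx⟩ := hfs x' hx'
    obtain ⟨y, hy, hyy⟩ := hfs y' hy'
    rw [← hxx, hfd _ hz _ hx, hΓ.quotientDist_base hk] at e1
    rw [← hyy, hfd _ hz _ hy, hΓ.quotientDist_base hk] at e2
    rw [← hxx, ← hyy, hfd _ hx _ hy] at e3
    exact (hΓ.quotientDist_lt hk hε e1 e2).ne e3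
  have hT {x : ℍ} (hx : x ∈ S) : coordT z₀ (f x) = coordT z₀ x := by
    have := hfd _ hz _ hx
    rw [hf0, hΓ.quotientDist_base hk, hΓ.quotientDist_base hk] at this
    rw [← cosh_dist_base, this, cosh_dist_base]
  have hW {x : ℍ} (hx : x ∈ S) : ‖coordW z₀ (f x)‖ = ‖coordW z₀ x‖ := by
    have h1 := coordT_sq z₀ (f x)
    rw [hT hx, coordT_sq] at h1
    exact (pow_left_inj₀ (norm_nonneg _) (norm_nonneg _) two_ne_zero).1 (by linarith)
  -- Quotient distances are attained at some roots of unity ζ and ζ', so the numbers conj(u) ζ v for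
  -- i, j and for their images have equal modulus and equal real part. They agree up to conjugation,
  -- hence so do their k-th powers, in which the unknown ζ and ζ' disappear.
  have hinner (i j : S) : inner ℝ (coordW z₀ (f i) ^ k) (coordW z₀ (f j) ^ k) =
      inner ℝ (coordW z₀ i ^ k) (coordW z₀ j ^ k) := by
    obtain ⟨⟨w, hw, e⟩, -⟩ := isLeast_quotientDist (Γ := Γ) (i : ℍ) j
    obtain ⟨⟨w', hw', e'⟩, -⟩ := isLeast_quotientDist (Γ := Γ) (f i) (f j)
    rw [hfd i i.2 j j.2, ← e] at e'
    obtain ⟨ζ, hζ, hww⟩ := hΓ.mem_orbit_iff.1 hw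
    obtain ⟨ζ', hζ', hww'⟩ := hΓ.mem_orbit_iff.1 hw'
    have e2 := congrArg Real.cosh e'
    have hTw : coordT z₀ w = coordT z₀ (j : ℍ) := by
      rw [coordT_eq_sqrt, hww, norm_mul, norm_eq_one_of_pow hk hζ, one_mul, ← coordT_eq_sqrt]
    have hTw' : coordT z₀ w' = coordT z₀ (f j) := by
      rw [coordT_eq_sqrt, hww', norm_mul, norm_eq_one_of_pow hk hζ', one_mul, ← coordT_eq_sqrt]
    rw [cosh_dist_eq z₀, cosh_dist_eq z₀, hTw, hTw', hT i.2, hT j.2, sub_right_inj, hww, hww',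
      inner_eq_re, inner_eq_re] at e2
    have e3 := re_pow_eq (by
      simp only [norm_mul, RCLike.norm_conj, hW i.2, hW j.2, norm_eq_one_of_pow hk hζ,
        norm_eq_one_of_pow hk hζ']) e2 k
    rw [mul_pow, mul_pow, mul_pow, mul_pow, hζ, hζ', one_mul, one_mul, ← map_pow, ← map_pow,
      ← inner_eq_re, ← inner_eq_re] at e3
    exact e3
  obtain ⟨ξ, hξ, hUV⟩ := exists_rotation_or_reflection (ι := S)
    (U := fun i => coordW z₀ i ^ k) (V := fun i => coordW z₀ (f i) ^ k) hinner
  -- A k-th root of ξ brings the orthogonal map from W^k down to W. The remaining ambiguity is a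
  -- k-th root of unity, that is, the action of Γ.
  obtain ⟨η, hη⟩ : ∃ η : ℂ, η ^ k = ξ := IsAlgClosed.exists_pow_nat_eq ξ (by omega)
  have hηn : ‖η‖ = 1 := by
    rw [← hη, norm_pow] at hξ
    exact (pow_eq_one_iff_of_nonneg (norm_nonneg _) (by omega)).1 hξ
  have hη0 : η ≠ 0 := norm_ne_zero_iff.1 (by rw [hηn]; exact one_ne_zero)
  obtain ⟨F, hF, hFζ, hFk⟩ : ∃ F : ℂ → ℂ,
      (F = (fun w => η * w) ∨ F = fun w => η * starRingEnd ℂ w) ∧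
      (∀ ζ : ℂ, ζ ^ k = 1 → ∃ ζ' : ℂ, ζ' ^ k = 1 ∧ ∀ w, ζ * F w = F (ζ' * w)) ∧
      ∀ x ∈ S, coordW z₀ (f x) ^ k = F (coordW z₀ x) ^ k := by
    rcases hUV with hUV | hUV
    · refine ⟨_, Or.inl rfl, fun ζ hζ => ⟨ζ, hζ, fun w => by ring⟩, fun x hx => ?_⟩
      rw [mul_pow, hη]
      exact hUV ⟨x, hx⟩
    · refine ⟨_, Or.inr rfl, fun ζ hζ => ⟨starRingEnd ℂ ζ, by rw [← map_pow, hζ, map_one],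
        fun w => by rw [map_mul, Complex.conj_conj]; ring⟩, fun x hx => ?_⟩
      rw [mul_pow, hη, ← map_pow]
      exact hUV ⟨x, hx⟩
  refine ⟨η, F, hηn, hF, ?_⟩
  have hroot {x : ℍ} (hx : x ∈ S) :
      ∃ ζ : ℂ, ζ ^ k = 1 ∧ coordW z₀ (f x) = ζ * F (coordW z₀ x) := by
    have h1 := hFk x hx
    rcases eq_or_ne (F (coordW z₀ x)) 0 with h0 | h0
    · refine ⟨1, one_pow k, ?_⟩
      rw [h0, zero_pow (by omega)] at h1
      rw [h0, mul_zero]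
      exact pow_eq_zero_iff (by omega) |>.1 h1
    · exact ⟨coordW z₀ (f x) / F (coordW z₀ x), by
        rw [div_pow, h1, div_self (pow_ne_zero _ h0)], by rw [div_mul_cancel₀ _ h0]⟩
  ext v
  constructor
  · rintro ⟨y, hy, rfl⟩
    obtain ⟨x, hx, hxy⟩ := hfs y hy
    obtain ⟨ζ₁, h₁, e₁⟩ := hΓ.mem_orbit_iff.1 (hxy ▸ MulAction.mem_orbit_self y)
    obtain ⟨ζ₂, h₂, e₂⟩ := hroot hx
    obtain ⟨ζ, hζ, e⟩ := hFζ (ζ₁ * ζ₂) (by rw [mul_pow, h₁, h₂, one_mul])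
    refine ⟨_, ⟨(coordHomeo z₀).symm (ζ * coordW z₀ x), hmem hinv hx
      (hΓ.mem_orbit_iff.2 ⟨ζ, hζ, coordW_symm _ _⟩), rfl⟩, ?_⟩
    rw [coordW_symm, ← e, e₁, e₂, mul_assoc]
  · rintro ⟨_, ⟨x, hx, rfl⟩, rfl⟩
    obtain ⟨ζ, hζ, e⟩ := hroot hx
    have hζ0 : ζ ≠ 0 := by rintro rfl; rw [zero_pow (by omega)] at hζ; exact zero_ne_one hζ
    refine ⟨(coordHomeo z₀).symm (ζ⁻¹ * coordW z₀ (f x)), hmem hinv' (hf x hx)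
      (hΓ.mem_orbit_iff.2 ⟨ζ⁻¹, by rw [inv_pow, hζ, inv_one], coordW_symm _ _⟩), ?_⟩
    rw [coordW_symm, e, inv_mul_cancel_left₀ hζ0]

end Rotations

/-! ### Transport of frontiers; the case of a non-trivial action -/

lemma exists_homeomorph {η : ℂ} {F : ℂ → ℂ} (hη : ‖η‖ = 1)
    (hF : F = (fun w => η * w) ∨ F = fun w => η * starRingEnd ℂ w) : ∃ e : ℂ ≃ₜ ℂ, ⇑e = F := by
  have h0 : η ≠ 0 := norm_ne_zero_iff.1 (by rw [hη]; exact one_ne_zero)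
  rcases hF with rfl | rfl
  · exact ⟨Homeomorph.mulLeft₀ η h0, rfl⟩
  · exact ⟨Complex.conjLIE.toHomeomorph.trans (Homeomorph.mulLeft₀ η h0), rfl⟩

lemma image_frontier_of_image {z₀ p : ℍ} {S S' : Set ℍ} {η : ℂ} {F : ℂ → ℂ} (hη : ‖η‖ = 1)
    (hF : F = (fun w => η * w) ∨ F = fun w => η * starRingEnd ℂ w)
    (h : coordW p '' S' = F '' (coordW z₀ '' S)) :
    coordW p '' frontier S' = F '' (coordW z₀ '' frontier S) := by
  obtain ⟨e, rfl⟩ := exists_homeomorph hη hF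
  have h1 (z : ℍ) (S : Set ℍ) : frontier (coordW z '' S) = coordW z '' frontier S :=
    ((coordHomeo z).image_frontier S).symm
  rw [← h1, h, ← e.image_frontier, h1]

namespace RotationData

variable {m : ℕ} {γ : SL(2, ℝ)} {𝒢₀ : Set (Set ℍ)} {z₀ : ℍ} {ρ c : ℂ}

lemma isRotationGroup (R : RotationData m γ 𝒢₀ z₀ ρ c) {N k : ℕ} (hk : m = N * k) :
    IsRotationGroup z₀ k (Subgroup.zpowers (γ ^ N)) := by
  have hm : 0 < m := by have := R.two_le; omega
  have hk0 : k ≠ 0 := by rintro rfl; omega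
  have hprim := R.prim.pow hm hk
  have hact (i : ℤ) (z : ℍ) : coordW z₀ ((γ ^ N) ^ i • z) = (ρ ^ N) ^ i * coordW z₀ z := by
    have e : (γ ^ N) ^ i = γ ^ ((N : ℤ) * i) := by rw [zpow_mul, zpow_natCast]
    rw [e, coordW_zpow R.norm_rot R.rot, zpow_mul, zpow_natCast]
  constructor
  · rintro ⟨_, i, rfl⟩
    refine ⟨(ρ ^ N) ^ i, ?_, hact i⟩
    rw [← zpow_natCast, ← zpow_mul, mul_comm, zpow_mul, zpow_natCast, hprim.pow_eq_one, one_zpow]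
  · intro ζ hζ
    have : NeZero k := ⟨hk0⟩
    obtain ⟨i, -, hi⟩ := hprim.eq_pow_of_pow_eq_one hζ
    refine ⟨⟨(γ ^ N) ^ (i : ℤ), i, rfl⟩, fun z => ?_⟩
    rw [← hi, ← zpow_natCast (ρ ^ N) i]
    exact hact i z

section

variable {n : ℕ} {X : Finset (Fin (2 * n))} {S S' : Set ℍ}

/-- Only frontiers, midpoints and invariance enter, so the sets S and S' can be the open regions as
well as their closures. -/
lemma not_isometric_of_lt (R : RotationData m γ 𝒢₀ z₀ ρ c) (hn : 2 * n ∣ m) (hlt : 2 * n < m)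
    (hX : X.card = n) (h0 : 𝒢₀.Nonempty) (hc : ¬ Congruent X Xᶜ) (hz : z₀ ∈ S)
    (hS : ∀ A ∈ Subgroup.zpowers (γ ^ (2 * n)), A • S = S)
    (hS' : ∀ A ∈ Subgroup.zpowers (γ ^ (2 * n)), A • S' = S') (hmid : HasMidpoints S')
    (hfr : frontier S = ⋃₀ translates γ 𝒢₀ X) (hfr' : frontier S' = ⋃₀ translates γ 𝒢₀ Xᶜ) :
    ¬ QuotientsIsometric S (Subgroup.zpowers (γ ^ (2 * n))) S'
      (Subgroup.zpowers (γ ^ (2 * n))) := by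
  intro h
  have := R.finite_zpowers (2 * n)
  obtain ⟨k, hk⟩ := hn
  have hk2 : 2 ≤ k := by
    by_contra! h
    interval_cases k <;> omega
  obtain ⟨η, F, hη, hF, himg⟩ :=
    (R.isRotationGroup hk).exists_of_isometric hk2 hmid hz hS hS' h
  have := image_frontier_of_image hη hF himg
  rw [hfr, hfr'] at this
  exact hc (R.congruent_of_rotation ⟨k, hk⟩ hX h0 hη hF this)

end

end RotationData

/-! ### Small cycles -/

lemma congruent_of_add {N : ℕ} {X Y : Finset (Fin (N + 2))} (s : Fin (N + 2))
    (h : X.image (· + s) = Y) : Congruent X Y := by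
  refine ⟨⟨Equiv.addRight s, fun {a b} => ?_⟩, ?_⟩
  · simp [SimpleGraph.cycleGraph_adj]
  · rw [← h]; ext; simp

/-- In these small cycles some rotation exchanges X and its complement. Excluding them gives n ≥ 3,
so that there are at least three boundary geodesics when `𝒢₀ = {g}`. -/
lemma congruent_compl_of_le_two {n : ℕ} (hn0 : n ≠ 0) (hn : n ≤ 2) {X : Finset (Fin (2 * n))}
    (hX : X.card = n) : Congruent X Xᶜ := by
  obtain rfl | rfl : n = 1 ∨ n = 2 := by omega
  · have key : ∀ X : Finset (Fin 2), X.card = 1 → ∃ s : Fin 2, X.image (· + s) = Xᶜ := by decide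
    obtain ⟨s, hs⟩ := key X hX
    exact congruent_of_add (N := 0) s hs
  · have key : ∀ X : Finset (Fin 4), X.card = 2 → ∃ s : Fin 4, X.image (· + s) = Xᶜ := by decide
    obtain ⟨s, hs⟩ := key X hX
    exact congruent_of_add (N := 2) s hs

/-! ### Finite collections of geodesics -/

lemma IsGeodesic.isClosed {ℓ : Set ℍ} (h : IsGeodesic ℓ) : IsClosed ℓ := by
  obtain ⟨q, -, rfl⟩ := isGeodesic_iff.1 h
  exact isClosed_eq (continuous_quadForm q) continuous_const

lemma IsGeodesic.isPreconnected {ℓ : Set ℍ} (h : IsGeodesic ℓ) : IsPreconnected ℓ := by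
  obtain ⟨q, -, rfl⟩ := isGeodesic_iff.1 h
  exact isPreconnected_zeroSet q

/-- A geodesic of `𝒢` and the union of the others are disjoint closed sets, the latter by
finiteness, and a connected subset of their union cannot meet both. -/
lemma exists_subset_of_subset_sUnion {𝒢 : Set (Set ℍ)} (hg : ∀ ℓ ∈ 𝒢, IsGeodesic ℓ)
    (hd : 𝒢.PairwiseDisjoint id) (hfin : 𝒢.Finite) {C : Set ℍ} (hC : IsPreconnected C)
    (hne : C.Nonempty) (h : C ⊆ ⋃₀ 𝒢) : ∃ ℓ ∈ 𝒢, C ⊆ ℓ := by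
  obtain ⟨x, hx⟩ := hne
  obtain ⟨ℓ, hℓ, hxℓ⟩ := h hx
  refine ⟨ℓ, hℓ, ?_⟩
  have hdisj : ∀ z ∈ ℓ, z ∉ ⋃₀ (𝒢 \ {ℓ}) := by
    rintro z hz ⟨ℓ', ⟨hℓ', hne⟩, hz'⟩
    exact Set.disjoint_left.1 (hd hℓ hℓ' (Ne.symm hne)) hz hz'
  have hcl : IsClosed (⋃₀ (𝒢 \ {ℓ})) :=
    Set.sUnion_eq_biUnion (s := 𝒢 \ {ℓ}) ▸
      (hfin.subset Set.sdiff_subset).isClosed_biUnion fun ℓ' h' => (hg ℓ' h'.1).isClosed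
  have hcov : C ⊆ ℓ ∪ ⋃₀ (𝒢 \ {ℓ}) := by
    intro z hz
    obtain ⟨ℓ', hℓ', hz'⟩ := h hz
    by_cases e : ℓ' = ℓ
    · exact Or.inl (e ▸ hz')
    · exact Or.inr ⟨ℓ', ⟨hℓ', e⟩, hz'⟩
  rcases isPreconnected_iff_subset_of_disjoint_closed.1 hC _ _ (hg ℓ hℓ).isClosed hcl hcov (by
    ext z
    simp only [Set.mem_inter_iff, Set.mem_empty_iff_false, iff_false]
    exact fun hz => hdisj z hz.2.1 hz.2.2) with h1 | h1
  · exact h1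
  · exact (hdisj x hxℓ (h1 hx)).elim

lemma exists_image_eq {𝒢 𝒢' : Set (Set ℍ)} (hg : ∀ ℓ ∈ 𝒢, IsGeodesic ℓ)
    (hd : 𝒢.PairwiseDisjoint id) (hfin : 𝒢.Finite) (hg' : ∀ ℓ ∈ 𝒢', IsGeodesic ℓ)
    (hd' : 𝒢'.PairwiseDisjoint id) (hfin' : 𝒢'.Finite) (Φ : ℍ ≃ₜ ℍ) (h : Φ '' ⋃₀ 𝒢 = ⋃₀ 𝒢')
    {ℓ' : Set ℍ} (hℓ' : ℓ' ∈ 𝒢') : ∃ ℓ ∈ 𝒢, Φ '' ℓ = ℓ' := by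
  have h1 : Φ.symm '' ℓ' ⊆ ⋃₀ 𝒢 := by
    have : ℓ' ⊆ Φ '' ⋃₀ 𝒢 := by rw [h]; exact Set.subset_sUnion_of_mem hℓ'
    rintro _ ⟨z, hz, rfl⟩
    obtain ⟨w, hw, rfl⟩ := this hz
    simpa using hw
  obtain ⟨ℓ, hℓ, hsub⟩ := exists_subset_of_subset_sUnion hg hd hfin
    ((hg' ℓ' hℓ').isPreconnected.image _ Φ.symm.continuous.continuousOn)
    ((hg' ℓ' hℓ').nonempty.image _) h1
  have hsub' : ℓ' ⊆ Φ '' ℓ := fun z hz => ⟨Φ.symm z, hsub ⟨z, hz, rfl⟩, by simp⟩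
  obtain ⟨ℓ'', hℓ'', hsub''⟩ := exists_subset_of_subset_sUnion hg' hd' hfin'
    ((hg ℓ hℓ).isPreconnected.image _ Φ.continuous.continuousOn)
    ((hg ℓ hℓ).nonempty.image _) (h ▸ Set.image_mono (Set.subset_sUnion_of_mem hℓ))
  have e : ℓ'' = ℓ' := by
    by_contra hne
    obtain ⟨z, hz⟩ := (hg' ℓ' hℓ').nonempty
    exact Set.disjoint_left.1 (hd' hℓ'' hℓ' hne) (hsub'' (hsub' hz)) hz
  exact ⟨ℓ, hℓ, Set.Subset.antisymm (e ▸ hsub'') hsub'⟩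

lemma norm_le_of_zeroSet_eq {p : ℍ} {c c' : ℂ} (hc : 1 < ‖c‖)
    (h : {z | coordT p z = inner ℝ c (coordW p z)} = {z | coordT p z = inner ℝ c' (coordW p z)}) :
    ‖c‖ ≤ ‖c'‖ := by
  obtain ⟨z, τ, hτ, hW, hT⟩ := exists_nearest hc p
  have h1 : z ∈ {z | coordT p z = inner ℝ c (coordW p z)} := by
    rw [Set.mem_ofPred_eq, hW, hT, inner_smul_right, real_inner_self_eq_norm_sq]
  rw [h, Set.mem_ofPred_eq, hW, hT, inner_smul_right] at h1
  have h2 := mul_left_cancel₀ hτ.ne' h1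
  have h3 := real_inner_le_norm c' c
  nlinarith

/-- A form whose zero set is a geodesic of the same discriminant in normal position. -/
lemma sq_eq_one_of_zeroSet {p : ℍ} {a : ℝ} {b c : ℂ} (hc : 1 < ‖c‖)
    (hdisc : ‖b‖ ^ 2 - a ^ 2 = ‖c‖ ^ 2 - 1)
    (h : {z | linForm p a b z = 0} = {z | coordT p z = inner ℝ c (coordW p z)}) : a ^ 2 = 1 := by
  have ha : a ≠ 0 := by
    rintro rfl
    have : p ∈ {z | linForm p 0 b z = 0} := by simp [linForm_self]
    rw [h] at this
    simp at this
  set c' : ℂ := -((a⁻¹ : ℝ) • b) with hc'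
  have h' : {z | linForm p a b z = 0} = {z | coordT p z = inner ℝ c' (coordW p z)} := by
    ext z
    simp only [Set.mem_ofPred_eq, linForm, hc', inner_neg_left, real_inner_smul_left]
    field_simp
    constructor <;> intro h <;> linarith
  -- A geodesic determines the norm of its normal vector, so ‖b‖ = |a| ‖c‖, and the prescribed
  -- discriminant leaves a² (‖c‖² - 1) = ‖c‖² - 1.
  have hn : ‖c'‖ = ‖c‖ := by
    have h1 := norm_le_of_zeroSet_eq hc (h.symm.trans h')
    exact le_antisymm (norm_le_of_zeroSet_eq (hc.trans_le h1) (h'.symm.trans h)) h1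
  have e : ‖c'‖ = |a|⁻¹ * ‖b‖ := by rw [hc', norm_neg, norm_smul, Real.norm_eq_abs, abs_inv]
  rw [hn, ← div_eq_inv_mul, eq_div_iff (abs_ne_zero.2 ha)] at e
  have e2 : ‖c‖ ^ 2 * a ^ 2 = ‖b‖ ^ 2 := by rw [← e, mul_pow, sq_abs]
  have h1 : ‖c‖ ^ 2 - 1 ≠ 0 := by nlinarith
  exact mul_left_cancel₀ h1 (by linarith)

/-! ### The case of a trivial action -/

/-- For w ≠ 0 the three distinct points would lie on a circle and on a line, which share at most two
points. -/
lemma eq_zero_of_inner_eq {w c₁ c₂ c₃ : ℂ} {r t : ℝ} (h1 : ‖c₁‖ = r) (h2 : ‖c₂‖ = r)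
    (h3 : ‖c₃‖ = r) (e1 : inner ℝ w c₁ = t) (e2 : inner ℝ w c₂ = t) (e3 : inner ℝ w c₃ = t)
    (h12 : c₁ ≠ c₂) (h13 : c₁ ≠ c₃) (h23 : c₂ ≠ c₃) : w = 0 := by
  by_contra hw
  have hcw : starRingEnd ℂ w ≠ 0 := (map_ne_zero _).2 hw
  rw [inner_eq_re] at e1 e2 e3
  have key {a b : ℂ} (ha : ‖a‖ = r) (hb : ‖b‖ = r) (ea : (starRingEnd ℂ w * a).re = t)
      (eb : (starRingEnd ℂ w * b).re = t) (hab : a ≠ b) :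
      starRingEnd ℂ w * a = starRingEnd ℂ (starRingEnd ℂ w * b) :=
    (eq_or_eq_conj (by simp [ha, hb]) (ea.trans eb.symm)).resolve_left
      fun h => hab (mul_left_cancel₀ hcw h)
  have k1 := key h2 h1 e2 e1 h12.symm
  have k2 := key h3 h1 e3 e1 h13.symm
  exact h23 (mul_left_cancel₀ hcw (k1.trans k2.symm))

lemma quotientDist_of_trivial {Γ : Subgroup SL(2, ℝ)} (hΓ : ∀ A ∈ Γ, ∀ z : ℍ, A • z = z)
    (x y : ℍ) : quotientDist (MulAction.orbit Γ x) (MulAction.orbit Γ y) = dist x y := by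
  have h (x : ℍ) : MulAction.orbit Γ x = {x} := by
    refine Set.eq_singleton_iff_unique_mem.2 ⟨MulAction.mem_orbit_self x, ?_⟩
    rintro _ ⟨A, rfl⟩
    exact hΓ A A.2 x
  simp [quotientDist, h]

/-- An isometry between subsets of the plane is given by a rotation or reflection in suitable
coordinates. -/
lemma exists_of_isometric_of_trivial {Γ : Subgroup SL(2, ℝ)} (hΓ : ∀ A ∈ Γ, ∀ z : ℍ, A • z = z)
    {S S' : Set ℍ} {z₀ : ℍ} (hz : z₀ ∈ S) (h : QuotientsIsometric S Γ S' Γ) :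
    ∃ p ∈ S', ∃ (η : ℂ) (F : ℂ → ℂ), ‖η‖ = 1 ∧
      (F = (fun w => η * w) ∨ F = fun w => η * starRingEnd ℂ w) ∧
      coordW p '' S' = F '' (coordW z₀ '' S) := by
  obtain ⟨f, hf, hfd, hfs⟩ := h.exists_lift
  simp only [quotientDist_of_trivial hΓ] at hfd
  have hfs' : ∀ y ∈ S', ∃ x ∈ S, f x = y := by
    intro y hy
    obtain ⟨x, hx, hxy⟩ := hfs y hy
    refine ⟨x, hx, dist_eq_zero.1 ?_⟩
    rw [← quotientDist_of_trivial hΓ, hxy, quotientDist_of_trivial hΓ, dist_self]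
  have hT {x : ℍ} (hx : x ∈ S) : coordT (f z₀) (f x) = coordT z₀ x := by
    rw [← cosh_dist_base, hfd _ hz _ hx, cosh_dist_base]
  obtain ⟨η, hη, hUV⟩ := exists_rotation_or_reflection (ι := S) (U := fun i => coordW z₀ i)
    (V := fun i => coordW (f z₀) (f i)) fun i j => by
      have h1 := cosh_dist_eq (f z₀) (f i) (f j)
      rw [hfd _ i.2 _ j.2, cosh_dist_eq z₀, hT i.2, hT j.2] at h1
      linarith
  have himg {F : ℂ → ℂ} (hF : ∀ i : S, coordW (f z₀) (f i) = F (coordW z₀ i)) :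
      coordW (f z₀) '' S' = F '' (coordW z₀ '' S) := by
    ext v
    constructor
    · rintro ⟨y, hy, rfl⟩
      obtain ⟨x, hx, rfl⟩ := hfs' y hy
      exact ⟨_, ⟨x, hx, rfl⟩, (hF ⟨x, hx⟩).symm⟩
    · rintro ⟨_, ⟨x, hx, rfl⟩, rfl⟩
      exact ⟨f x, hf x hx, hF ⟨x, hx⟩⟩
  rcases hUV with hUV | hUV
  · exact ⟨f z₀, hf _ hz, η, _, hη, Or.inl rfl, himg (F := fun w => η * w) hUV⟩
  · exact ⟨f z₀, hf _ hz, η, _, hη, Or.inr rfl, himg (F := fun w => η * starRingEnd ℂ w) hUV⟩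

namespace RotationData

variable {m : ℕ} {γ : SL(2, ℝ)} {g : Set ℍ} {z₀ : ℍ} {ρ c : ℂ}

lemma exists_three (R : RotationData m γ {g} z₀ ρ c) {n : ℕ} (hnm : m = 2 * n) (hn : 3 ≤ n)
    {Y : Finset (Fin (2 * n))} (hY : Y.card = n) : ∃ i₁ ∈ liftToInt Y, ∃ i₂ ∈ liftToInt Y,
      ∃ i₃ ∈ liftToInt Y, ρ ^ i₁ ≠ ρ ^ i₂ ∧ ρ ^ i₁ ≠ ρ ^ i₃ ∧ ρ ^ i₂ ≠ ρ ^ i₃ := by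
  obtain ⟨a₁, a₂, a₃, h1, h2, h3, h12, h13, h23⟩ := Finset.two_lt_card_iff.1 (by omega : 2 < Y.card)
  have hmem {a : Fin (2 * n)} (ha : a ∈ Y) : (a : ℤ) ∈ liftToInt Y := ⟨a, ha, Int.ModEq.refl _⟩
  have hne {a b : Fin (2 * n)} (hab : a ≠ b) : ρ ^ (a : ℤ) ≠ ρ ^ (b : ℤ) := by
    intro h
    rw [zpow_natCast, zpow_natCast] at h
    exact hab (Fin.ext (R.prim.pow_inj (by omega) (by omega) h))
  exact ⟨_, hmem h1, _, hmem h2, _, hmem h3, hne h12, hne h13, hne h23⟩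

/-- The isometry extends to a homeomorphism Φ of `ℍ` that sends `z₀` to p and boundary geodesics to
boundary geodesics. All geodesics involved are equally far from `z₀`, so p is as far from every
boundary geodesic of `D'`. Three of them force p = `z₀`, and the comparison of directions applies.
-/
lemma not_isometric_of_eq (R : RotationData m γ {g} z₀ ρ c)
    (hg : g = {z | coordT z₀ z = inner ℝ c (coordW z₀ z)}) {n : ℕ} (hnm : m = 2 * n) (hn : 3 ≤ n)
    {X : Finset (Fin (2 * n))} (hX : X.card = n) (hc : ¬ Congruent X Xᶜ) {S S' D' : Set ℍ}
    (hz : z₀ ∈ S) (hD' : IsRegionOf D' (translates γ {g} Xᶜ)) (hz' : z₀ ∈ D')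
    (hSD : S' ⊆ closure D')
    (hfr : frontier S = ⋃₀ translates γ {g} X) (hfr' : frontier S' = ⋃₀ translates γ {g} Xᶜ) :
    ¬ QuotientsIsometric S (Subgroup.zpowers (γ ^ (2 * n))) S'
      (Subgroup.zpowers (γ ^ (2 * n))) := by
  intro h
  have hcn (i : ℤ) : ‖ρ ^ i * c‖ = ‖c‖ := by simp [R.norm_rot]
  obtain ⟨p, hp, η, F, hη, hF, himg⟩ := exists_of_isometric_of_trivial (by
    rintro _ ⟨k, rfl⟩ z
    have e : (γ ^ (2 * n)) ^ k = γ ^ ((m : ℤ) * k) := by rw [zpow_mul, zpow_natCast, hnm]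
    simp only [e]
    exact R.zpow_smul_eq_self (dvd_mul_right _ _) z) hz h
  have hfimg := image_frontier_of_image hη hF himg
  rw [hfr, hfr'] at hfimg
  obtain ⟨e, he⟩ := exists_homeomorph hη hF
  have hFin (X : Finset (Fin (2 * n))) : (translates γ {g} X).Finite := by
    have h1 : Finite (Subgroup.zpowers γ) := R.isOfFinOrder.finite_zpowers
    refine (Set.finite_range fun A : Subgroup.zpowers γ => (A : SL(2, ℝ)) • g).subset ?_
    rintro _ ⟨i, -, ℓ, hℓ, rfl⟩
    exact ⟨⟨γ ^ i, i, rfl⟩, by rw [Set.mem_singleton_iff.1 hℓ]⟩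
  set Φ : ℍ ≃ₜ ℍ := ((coordHomeo z₀).trans e).trans (coordHomeo p).symm with hΦ
  have hWΦ (z : ℍ) : coordW p (Φ z) = F (coordW z₀ z) := by
    rw [← he]; exact coordW_symm _ _
  have hΦimg : Φ '' ⋃₀ translates γ {g} X = ⋃₀ translates γ {g} Xᶜ := by
    apply (coordW_injective p).image_injective
    rw [hfimg, Set.image_image, Set.image_image]
    simp only [hWΦ]
  -- The form T - ⟨ρ^j c, W⟩ has the value 1 at `z₀`. By equality of distances its value a at p
  -- satisfies a² = 1, and a is not negative because p lies in the closure of `D'`.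
  have hval {j : ℤ} (hj : j ∈ liftToInt Xᶜ) :
      inner ℝ (coordW z₀ p) (ρ ^ j * c) = coordT z₀ p - 1 := by
    have hmem : γ ^ j • g ∈ translates γ {g} Xᶜ := ⟨j, hj, g, rfl, rfl⟩
    obtain ⟨_, ⟨i, hi, ℓ₀, hℓ₀, rfl⟩, hij⟩ := exists_image_eq (R.translates_geodesic X)
      (R.translates_disjoint X) (hFin X) (R.translates_geodesic Xᶜ) (R.translates_disjoint Xᶜ)
      (hFin Xᶜ) Φ hΦimg hmem
    rw [Set.mem_singleton_iff.1 hℓ₀] at hij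
    obtain ⟨Q, hQd, hQ⟩ := exists_quadForm_eq_linForm z₀ (1 : ℝ) (-(ρ ^ j * c))
    obtain ⟨a, b, hab, hlin⟩ := exists_linForm_eq_quadForm p Q
    obtain ⟨c', hc', hcF⟩ : ∃ c', ‖c'‖ = ‖c‖ ∧ ∀ w, inner ℝ c' (F w) = inner ℝ (ρ ^ i * c) w := by
      rcases hF with rfl | rfl
      · refine ⟨η * (ρ ^ i * c), by rw [norm_mul, hη, one_mul, hcn],
          fun w => inner_mul_unit hη _ _⟩
      · refine ⟨η * starRingEnd ℂ (ρ ^ i * c), by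
          rw [norm_mul, hη, one_mul, RCLike.norm_conj, hcn], fun w => ?_⟩
        rw [inner_mul_unit hη, inner_eq_re_im, inner_eq_re_im, Complex.conj_re, Complex.conj_re,
          Complex.conj_im, Complex.conj_im, neg_mul_neg]
    have hzs : {z | linForm p a b z = 0} = {z | coordT p z = inner ℝ c' (coordW p z)} := by
      have h1 : {z | linForm p a b z = 0} = γ ^ j • g := by
        rw [hg, zpow_smul_geodesic R.norm_rot R.rot]
        ext z
        rw [Set.mem_ofPred_eq, Set.mem_ofPred_eq, ← hlin, hQ, linForm, inner_neg_left, one_mul,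
          ← sub_eq_add_neg, sub_eq_zero]
      rw [h1, ← hij]
      ext z
      obtain ⟨z, rfl⟩ := Φ.surjective z
      rw [Φ.injective.mem_set_image, Set.mem_ofPred_eq, hWΦ, hcF, hg,
        zpow_smul_geodesic R.norm_rot R.rot, Set.mem_ofPred_eq, coordT_eq_sqrt p, hWΦ]
      have hnF : ‖F (coordW z₀ z)‖ = ‖coordW z₀ z‖ := by
        rcases hF with rfl | rfl <;> simp [hη]
      rw [hnF, ← coordT_eq_sqrt]
    have ha2 := sq_eq_one_of_zeroSet (hc'.symm ▸ R.one_lt) (by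
      rw [hab, ← hQd, norm_neg, hcn, hc']; ring) hzs
    have hva : coordT z₀ p - inner ℝ (ρ ^ j * c) (coordW z₀ p) = a := by
      have h1 := hQ p
      rw [hlin, linForm_self, linForm, inner_neg_left] at h1
      linarith
    have hpos : 0 ≤ a := by
      have hcont : Continuous fun z => coordT z₀ z - inner ℝ (ρ ^ j * c) (coordW z₀ z) := by
        have h1 := continuous_coordT z₀
        have h2 := continuous_coordW z₀
        fun_prop
      have hne : ∀ z ∈ D', coordT z₀ z - inner ℝ (ρ ^ j * c) (coordW z₀ z) ≠ 0 := by
        intro z hz h0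
        obtain ⟨⟨x, -, rfl⟩, -⟩ := hD'
        refine connectedComponentIn_subset _ _ hz ⟨_, hmem, ?_⟩
        rw [hg, zpow_smul_geodesic R.norm_rot R.rot]
        exact sub_eq_zero.1 h0
      have hpre : IsPreconnected D' := by
        obtain ⟨⟨x, -, rfl⟩, -⟩ := hD'
        exact isPreconnected_connectedComponentIn
      have h1 := pos_of_isPreconnected hpre hcont hne hz' (by simp)
      rw [← hva]
      exact closure_minimal (fun z hz => (h1 z hz).le) (isClosed_le continuous_const hcont) (hSD hp)
    have ha : a = 1 := by nlinarith
    rw [real_inner_comm]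
    linarith
  obtain ⟨i₁, h1, i₂, h2, i₃, h3, h12, h13, h23⟩ := R.exists_three hnm hn (Y := Xᶜ)
    (by rw [Finset.card_compl, Fintype.card_fin]; omega)
  have hw := eq_zero_of_inner_eq (hcn i₁) (hcn i₂) (hcn i₃) (hval h1) (hval h2) (hval h3)
    (fun h => h12 (mul_right_cancel₀ R.c_ne_zero h))
    (fun h => h13 (mul_right_cancel₀ R.c_ne_zero h))
    (fun h => h23 (mul_right_cancel₀ R.c_ne_zero h))
  rw [coordW_eq_zero_iff] at hw
  rw [hw] at hfimg
  exact hc (R.congruent_of_rotation (by rw [hnm]) hX (Set.singleton_nonempty g) hη hF hfimg)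

end RotationData

/-! ### Conclusions for the construction -/

section

variable {n m : ℕ} {X : Finset (Fin (2 * n))} {γ : SL(2, ℝ)} {g H : Set ℍ} {𝒢₀ : Set (Set ℍ)}
  {D D' : Set ℍ}

lemma EllipticData.orthoSpectrum_eq (E : EllipticData n m X γ g H 𝒢₀ D D') :
    orthoSpectrum (translates γ 𝒢₀ X) (Subgroup.zpowers (γ ^ (2 * n))) =
        orthoSpectrum (translates γ 𝒢₀ Xᶜ) (Subgroup.zpowers (γ ^ (2 * n))) ∧
      orthoSpectrum (translates γ 𝒢₀ X) ⊥ = orthoSpectrum (translates γ 𝒢₀ Xᶜ) ⊥ := by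
  obtain ⟨z₀, ρ, c, R, -⟩ := E.exists_rotationData
  exact ⟨R.orthoSpectrum_eq E.dvd E.card le_rfl, R.orthoSpectrum_eq E.dvd E.card bot_le⟩

lemma EllipticData.isHypOrbifold (E : EllipticData n m X γ g H 𝒢₀ D D') :
    IsHypOrbifold D (translates γ 𝒢₀ X) (Subgroup.zpowers (γ ^ (2 * n))) ∧
      IsHypOrbifold D' (translates γ 𝒢₀ Xᶜ) (Subgroup.zpowers (γ ^ (2 * n))) := by
  obtain ⟨z₀, ρ, c, R, -⟩ := E.exists_rotationData
  exact ⟨R.isHypOrbifold E.region E.dvd, R.isHypOrbifold E.region_compl E.dvd⟩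

lemma EllipticData.not_isometric (E : EllipticData n m X γ g H 𝒢₀ D D') (h0 : 𝒢₀.Nonempty)
    (h : 2 * n < m ∨ 𝒢₀ = {g}) (hc : ¬ Congruent X Xᶜ) :
    ¬ QuotientsIsometric D (Subgroup.zpowers (γ ^ (2 * n))) D'
        (Subgroup.zpowers (γ ^ (2 * n))) ∧
      ¬ QuotientsIsometric (closure D) (Subgroup.zpowers (γ ^ (2 * n))) (closure D')
        (Subgroup.zpowers (γ ^ (2 * n))) := by
  obtain ⟨z₀, ρ, c, R, hg⟩ := E.exists_rotationData
  have hm : 0 < m := E.period.1.1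
  have hn0 : 0 < 2 * n := Nat.pos_of_dvd_of_pos E.dvd hm
  have hgeo := R.translates_geodesic (N := 2 * n)
  have hdis := R.translates_disjoint (N := 2 * n)
  have hfr := E.region.frontier_eq (hgeo X) (hdis X)
  have hfr' := E.region_compl.frontier_eq (hgeo Xᶜ) (hdis Xᶜ)
  have hfc := E.region.frontier_closure_eq (hgeo X) (hdis X)
  have hfc' := E.region_compl.frontier_closure_eq (hgeo Xᶜ) (hdis Xᶜ)
  rcases (Nat.le_of_dvd hm E.dvd).lt_or_eq with hlt | heq
  · have O := E.isHypOrbifold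
    have hz := R.base_mem_of_lt E.region hn0.ne' hlt
    have hcl {D : Set ℍ} (hD : ∀ A ∈ Subgroup.zpowers (γ ^ (2 * n)), A • D = D) :
        ∀ A ∈ Subgroup.zpowers (γ ^ (2 * n)), A • closure D = closure D := by
      intro A hA
      rw [← closure_smul, hD A hA]
    exact ⟨R.not_isometric_of_lt E.dvd hlt E.card h0 hc hz O.1.invariant O.2.invariant
        (hasMidpoints_of_isOpen O.2.isOpen) hfr hfr',
      R.not_isometric_of_lt E.dvd hlt E.card h0 hc (subset_closure hz) (hcl O.1.invariant)
        (hcl O.2.invariant) O.2.hasMidpoints_closure hfc hfc'⟩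
  · obtain rfl : 𝒢₀ = {g} := h.resolve_left (by omega)
    have hn3 : 3 ≤ n := by
      by_contra! hlt
      exact hc (congruent_compl_of_le_two (by omega) (by omega) E.card)
    have hbase {Y : Finset (Fin (2 * n))} (hY : Y.card = n) {D : Set ℍ}
        (hD : IsRegionOf D (translates γ {g} Y)) : z₀ ∈ D := by
      refine R.base_mem hD fun i hi => ?_
      obtain ⟨i₁, h1, i₂, h2, -, -, h12, -⟩ := R.exists_three heq.symm hn3 hY
      by_cases h : ρ ^ i = ρ ^ i₁
      · exact ⟨i₂, h2, h ▸ h12⟩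
      · exact ⟨i₁, h1, h⟩
    have hz := hbase E.card E.region
    have hz' := hbase (by rw [Finset.card_compl, Fintype.card_fin, E.card]; omega) E.region_compl
    exact ⟨R.not_isometric_of_eq hg heq.symm hn3 E.card hc hz E.region_compl hz' subset_closure
        hfr hfr',
      R.not_isometric_of_eq hg heq.symm hn3 E.card hc (subset_closure hz) E.region_compl hz'
        subset_rfl hfc hfc'⟩

lemma EllipticData.exists_conePoint (E : EllipticData n m X γ g H 𝒢₀ D D') (hlt : 2 * n < m) :
    (∃ A ∈ Subgroup.zpowers (γ ^ (2 * n)), (∃ z ∈ D, A • z = z) ∧ ∃ w ∈ D, A • w ≠ w) ∧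
      ∃ A ∈ Subgroup.zpowers (γ ^ (2 * n)), (∃ z ∈ D', A • z = z) ∧ ∃ w ∈ D', A • w ≠ w := by
  obtain ⟨z₀, ρ, c, R, -⟩ := E.exists_rotationData
  have hn0 : 0 < 2 * n := Nat.pos_of_dvd_of_pos E.dvd E.period.1.1
  have key {D : Set ℍ} (hD : IsOpen D) (hz : z₀ ∈ D) :
      ∃ A ∈ Subgroup.zpowers (γ ^ (2 * n)), (∃ z ∈ D, A • z = z) ∧ ∃ w ∈ D, A • w ≠ w := by
    refine ⟨γ ^ (2 * n), Subgroup.mem_zpowers _, ⟨z₀, hz, ?_⟩, ?_⟩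
    · have := R.fixes_base (2 * n : ℕ)
      rwa [zpow_natCast] at this
    · obtain ⟨ε₀, h0, hm⟩ := hasMidpoints_of_isOpen hD z₀ hz
      obtain ⟨w, hw, -, -, hd, -⟩ := hm (ε₀ / 2) (by linarith) (by linarith)
      refine ⟨w, hw, fun h => ?_⟩
      have hW : coordW z₀ w ≠ 0 := by
        rw [Ne, coordW_eq_zero_iff]
        rintro rfl
        rw [dist_self] at hd
        linarith
      have h1 := coordW_zpow R.norm_rot R.rot (2 * n : ℕ) w
      rw [zpow_natCast, h, zpow_natCast, eq_comm, mul_eq_right₀ hW, R.prim.pow_eq_one_iff_dvd] at h1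
      have := Nat.le_of_dvd hn0 h1
      omega
  exact ⟨key E.isHypOrbifold.1.isOpen (R.base_mem_of_lt E.region hn0.ne' hlt),
    key E.isHypOrbifold.2.isOpen (R.base_mem_of_lt E.region_compl hn0.ne' hlt)⟩

end

/-! ### Regions bounded by given forms -/

lemma isComponentOf_linForm {ι : Type*} (z₀ : ℍ) (a : ι → ℝ) (b : ι → ℂ) {x : ℍ}
    (hx : ∀ i, 0 < linForm z₀ (a i) (b i) x) :
    IsComponentOf {z | ∀ i, 0 < linForm z₀ (a i) (b i) z}
      (⋃₀ Set.range fun i => {z | linForm z₀ (a i) (b i) z = 0})ᶜ := by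
  have hsub {z : ℍ} (hz : ∀ i, 0 < linForm z₀ (a i) (b i) z) :
      z ∈ (⋃₀ Set.range fun i => {z | linForm z₀ (a i) (b i) z = 0})ᶜ := by
    rintro ⟨_, ⟨i, rfl⟩, h⟩
    exact (hz i).ne' h
  refine ⟨x, hsub hx, Set.Subset.antisymm ?_ fun z hz i => ?_⟩
  · choose q hq using fun i => exists_quadForm_eq_linForm z₀ (a i) (b i)
    have hpre := isPreconnected_forms (Set.range q) ∅
    have e : {z | (∀ p ∈ Set.range q, 0 < quadForm p z) ∧
        ∀ p ∈ (∅ : Set (ℝ × ℝ × ℝ)), quadForm p z = 0} =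
        {z | ∀ i, 0 < linForm z₀ (a i) (b i) z} := by
      ext z; simp [(hq _).2]
    rw [e] at hpre
    exact hpre.subset_connectedComponentIn hx fun z hz => hsub hz
  · refine pos_of_isPreconnected isPreconnected_connectedComponentIn (continuous_linForm z₀ _ _)
      (fun w hw h0 => ?_) (mem_connectedComponentIn (hsub hx)) (hx i) z hz
    exact connectedComponentIn_subset _ _ hw ⟨_, ⟨i, rfl⟩, h0⟩

lemma isComponentOf_halfPlane (z₀ : ℍ) (a : ℝ) (b : ℂ) {x : ℍ} (hx : 0 < linForm z₀ a b x) :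
    IsComponentOf {z | 0 < linForm z₀ a b z} {z | linForm z₀ a b z = 0}ᶜ := by
  simpa using isComponentOf_linForm (ι := Unit) z₀ (fun _ => a) (fun _ => b) fun _ => hx

lemma linForm_one_neg {z₀ : ℍ} {c : ℂ} (z : ℍ) :
    linForm z₀ 1 (-c) z = coordT z₀ z - inner ℝ c (coordW z₀ z) := by
  rw [linForm, inner_neg_left]; ring

namespace RotationData

variable {m : ℕ} {γ : SL(2, ℝ)} {g : Set ℍ} {z₀ : ℍ} {ρ c : ℂ}

/-- The part of the plane that contains `z₀` and is bounded by the translates belonging to `X`. -/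
def region (z₀ : ℍ) (ρ c : ℂ) {N : ℕ} (X : Finset (Fin N)) : Set ℍ :=
  {z | ∀ i : liftToInt X, 0 < linForm z₀ 1 (-(ρ ^ (i : ℤ) * c)) z}

lemma isRegionOf_region (R : RotationData m γ {g} z₀ ρ c)
    (hg : g = {z | coordT z₀ z = inner ℝ c (coordW z₀ z)}) {N : ℕ} (X : Finset (Fin N)) :
    IsRegionOf (region z₀ ρ c X) (translates γ {g} X) := by
  have htr (i : ℤ) : γ ^ i • g = {z | linForm z₀ 1 (-(ρ ^ i * c)) z = 0} := by
    rw [hg, zpow_smul_geodesic R.norm_rot R.rot]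
    ext z
    rw [Set.mem_ofPred_eq, Set.mem_ofPred_eq, linForm_one_neg, sub_eq_zero]
  have hrange : translates γ {g} X =
      Set.range fun i : liftToInt X => {z | linForm z₀ 1 (-(ρ ^ (i : ℤ) * c)) z = 0} := by
    ext ℓ
    constructor
    · rintro ⟨i, hi, ℓ₀, hℓ₀, rfl⟩
      exact ⟨⟨i, hi⟩, by rw [Set.mem_singleton_iff.1 hℓ₀, htr]⟩
    · rintro ⟨i, rfl⟩
      exact ⟨i, i.2, g, rfl, (htr i).symm⟩
  refine ⟨?_, ?_⟩
  · rw [hrange]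
    exact isComponentOf_linForm z₀ (fun _ => 1) _ (x := z₀) fun i => by
      rw [linForm_one_neg]; simp
  · rintro z ⟨_, ⟨i, hi, ℓ₀, hℓ₀, rfl⟩, hz⟩
    rw [Set.mem_singleton_iff.1 hℓ₀, htr, Set.mem_ofPred_eq, linForm_one_neg] at hz
    have hcn (i : ℤ) : ‖ρ ^ i * c‖ = ‖c‖ := by simp [R.norm_rot]
    have hle (j : ℤ) : inner ℝ (ρ ^ j * c) (coordW z₀ z) ≤ coordT z₀ z := by
      by_contra! hlt
      have := R.rot_zpow_eq hlt.le (sub_eq_zero.1 hz).le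
      rw [this] at hlt
      linarith
    -- The radial segment from `z₀` to z stays in the region before it reaches z: each ⟨ρ^j c, W⟩ is
    -- at most T at z and scales by s, while T at the point with coordinate sW exceeds s times its
    -- value at z.
    have hpos (s : ℝ) (h0 : 0 ≤ s) (h1 : s < 1) :
        (coordHomeo z₀).symm (s * coordW z₀ z) ∈ region z₀ ρ c X := by
      intro j
      rw [linForm_one_neg, coordT_symm, coordW_symm, ← Complex.real_smul, inner_smul_right,
        sub_pos]
      refine (mul_le_mul_of_nonneg_left (hle j) h0).trans_lt ?_
      rw [coordT_eq_sqrt]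
      refine Real.lt_sqrt_of_sq_lt ?_
      rw [mul_pow, Real.sq_sqrt (by positivity), norm_smul, Real.norm_of_nonneg h0]
      nlinarith
    refine ⟨?_, fun hint => ?_⟩
    · have hcont : Continuous fun s : ℝ => (coordHomeo z₀).symm (s * coordW z₀ z) :=
        (coordHomeo z₀).symm.continuous.comp (by fun_prop)
      have ht := (hcont.tendsto 1).mono_left (nhdsWithin_le_nhds (s := Set.Iio 1))
      have e : (coordHomeo z₀).symm ((1 : ℝ) * coordW z₀ z) = z := by
        rw [Complex.ofReal_one, one_mul]
        exact (coordHomeo z₀).symm_apply_apply z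
      rw [e] at ht
      refine mem_closure_of_tendsto ht ?_
      filter_upwards [Ioo_mem_nhdsLT (zero_lt_one' ℝ)] with s hs using hpos s hs.1.le hs.2
    · have := interior_subset hint ⟨i, hi⟩
      rw [linForm_one_neg] at this
      exact this.ne' hz

lemma ellipticData (R : RotationData m γ {g} z₀ ρ c)
    (hg : g = {z | coordT z₀ z = inner ℝ c (coordW z₀ z)}) (hγ : γ.val.IsElliptic) {n : ℕ}
    (hn : 2 * n ∣ m) {X : Finset (Fin (2 * n))} (hX : X.card = n) :
    EllipticData n m X γ g {z | 0 < linForm z₀ (-1) c z} {g} (region z₀ ρ c X)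
      (region z₀ ρ c Xᶜ) := by
  have hm : 0 < m := by have := R.two_le; omega
  have hcn (i : ℤ) : ‖ρ ^ i * c‖ = ‖c‖ := by simp [R.norm_rot]
  have hmem (i : ℤ) (z : ℍ) : z ∈ γ ^ i • g ↔ coordT z₀ z = inner ℝ (ρ ^ i * c) (coordW z₀ z) := by
    rw [hg, zpow_smul_geodesic R.norm_rot R.rot, Set.mem_ofPred_eq]
  have hg0 : {z | linForm z₀ (-1) c z = 0} = g := by
    rw [hg]
    ext z
    rw [Set.mem_ofPred_eq, Set.mem_ofPred_eq, linForm]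
    constructor <;> intro h <;> linarith
  have hg1 : {z | linForm z₀ 1 (-c) z = 0} = g := by
    rw [hg]
    ext z
    rw [Set.mem_ofPred_eq, Set.mem_ofPred_eq, linForm_one_neg, sub_eq_zero]
  have hone {i : ℤ} (h : ρ ^ i = 1) : γ ^ i • g = g := by
    have := R.smul_set_eq (i := i) (i' := 0) (by rw [h, zpow_zero]) g
    rwa [zpow_zero, one_smul] at this
  have hrot {i : ℤ} {z : ℍ} (hz : z ∈ γ ^ i • g)
      (h : coordT z₀ z ≤ inner ℝ c (coordW z₀ z)) : ρ ^ i = 1 := by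
    have := R.rot_zpow_eq (i' := 0) ((hmem i z).1 hz).le (by rwa [zpow_zero, one_mul])
    rwa [zpow_zero] at this
  exact
  { elliptic := hγ
    geodesic := R.geodesic g rfl
    condition := by
      refine ⟨fun i => ?_, {z | 0 < linForm z₀ 1 (-c) z}, ?_, fun i => ?_⟩
      · by_cases h : ρ ^ i = 1
        · exact Or.inr (hone h)
        · left
          refine Set.disjoint_left.2 fun z hz hz' => h (hrot hz' ?_)
          rw [hg] at hz
          exact hz.le
      · rw [← hg1]
        exact isComponentOf_halfPlane z₀ 1 (-c) (x := z₀) (by rw [linForm_one_neg]; simp)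
      · by_cases h : ρ ^ i = 1
        · exact Or.inl (hone h)
        · right
          intro z hz
          rw [Set.mem_ofPred_eq, linForm_one_neg, sub_pos]
          by_contra! hle
          exact h (hrot hz hle)
    halfPlane := by
      rw [← hg0]
      obtain ⟨z, τ, hτ, hW, hT⟩ := exists_nearest R.one_lt z₀
      refine isComponentOf_halfPlane z₀ (-1) c
        (x := (coordHomeo z₀).symm ((2 * τ) • c)) ?_
      have h1 := coordT_sq z₀ z
      rw [hT, hW, norm_smul, Real.norm_of_nonneg hτ.le] at h1
      rw [linForm, coordT_symm, coordW_symm, inner_smul_right, real_inner_self_eq_norm_sq,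
        norm_smul, Real.norm_of_nonneg (by positivity)]
      have h2 : √(1 + (2 * τ * ‖c‖) ^ 2) < 2 * τ * ‖c‖ ^ 2 := by
        rw [Real.sqrt_lt' (by have := R.one_lt; positivity)]
        nlinarith
      linarith
    disjoint_halfPlane := by
      intro i
      refine Set.disjoint_left.2 fun z hz hz' => ?_
      rw [Set.mem_ofPred_eq, linForm] at hz'
      have h1 := hrot hz (by linarith)
      rw [hmem, h1, one_mul] at hz
      linarith
    period := by
      refine ⟨⟨hm, ?_⟩, fun j hj => ?_⟩
      · have := hone (i := m) (by rw [zpow_natCast, R.prim.pow_eq_one])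
        rwa [zpow_natCast] at this
      · refine Nat.le_of_dvd hj.1 ((R.prim.pow_eq_one_iff_dvd j).1 ?_)
        obtain ⟨z, hz⟩ := (R.geodesic g rfl).nonempty
        have h1 := hrot (i := j) (z := z) (by rw [zpow_natCast, hj.2]; exact hz) (by
          rw [hg] at hz; exact hz.le)
        rwa [zpow_natCast] at h1
    dvd := hn
    collection_geodesic := R.geodesic
    collection_subset := by
      intro ℓ hℓ z hz
      rw [Set.mem_singleton_iff.1 hℓ, ← hg1] at hz
      obtain ⟨q, hq, hqe⟩ := exists_quadForm_eq_linForm z₀ 1 (-c)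
      have h1 := mem_closure_neg (q := q) (p := z) (by
        rw [← hq, norm_neg]; have := R.one_lt; nlinarith) (by rw [hqe]; exact hz)
      refine closure_mono (fun w hw => ?_) h1
      rw [Set.mem_ofPred_eq, hqe, linForm_one_neg] at hw
      rw [Set.mem_ofPred_eq, linForm]
      linarith
    collection_disjoint := R.disjoint
    card := hX
    region := R.isRegionOf_region hg X
    region_compl := R.isRegionOf_region hg Xᶜ }

end RotationData

/-! ### Rotations about `I` -/

/-- The elliptic matrix fixing `I` with angle `φ`. -/
noncomputable def rotMatrix (φ : ℝ) : SL(2, ℝ) :=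
  ⟨!![Real.cos φ, Real.sin φ; -Real.sin φ, Real.cos φ], by
    rw [Matrix.det_fin_two_of]; linarith [Real.sin_sq_add_cos_sq φ]⟩

lemma rotMatrix_pow (φ : ℝ) (j : ℕ) : rotMatrix φ ^ j = rotMatrix (j * φ) := by
  induction j with
  | zero =>
    apply Subtype.ext
    rw [pow_zero, Matrix.SpecialLinearGroup.coe_one]
    simp [rotMatrix, Matrix.one_fin_two]
  | succ j ih =>
    rw [pow_succ, ih]
    apply Subtype.ext
    rw [Matrix.SpecialLinearGroup.coe_mul]
    push_cast
    rw [add_mul, one_mul]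
    simp only [rotMatrix, Matrix.mul_fin_two, Real.cos_add, Real.sin_add]
    congr 1
    ext i k
    fin_cases i <;> fin_cases k <;> simp <;> ring

lemma isElliptic_rotMatrix {φ : ℝ} (h : Real.sin φ ≠ 0) : (rotMatrix φ).val.IsElliptic := by
  have := Real.sin_sq_add_cos_sq φ
  have := sq_pos_of_ne_zero h
  rw [Matrix.IsElliptic, Matrix.discr_fin_two]
  simp [rotMatrix, Matrix.trace_fin_two, Matrix.det_fin_two]
  nlinarith

lemma rotMatrix_smul_im (φ : ℝ) (z : ℍ) : (rotMatrix φ • z).im =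
    z.im / ((-Real.sin φ * z.re + Real.cos φ) ^ 2 + (-Real.sin φ * z.im) ^ 2) := by
  rw [sl_smul_im]; simp [rotMatrix]

lemma rotMatrix_smul_re (φ : ℝ) (z : ℍ) : (rotMatrix φ • z).re =
    ((Real.cos φ * z.re + Real.sin φ) * (-Real.sin φ * z.re + Real.cos φ) +
      Real.cos φ * (-Real.sin φ) * z.im ^ 2) /
      ((-Real.sin φ * z.re + Real.cos φ) ^ 2 + (-Real.sin φ * z.im) ^ 2) := by
  rw [sl_smul_re]; simp [rotMatrix]

lemma rotMatrix_smul_I (φ : ℝ) : rotMatrix φ • UpperHalfPlane.I = UpperHalfPlane.I := by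
  have h := Real.sin_sq_add_cos_sq φ
  apply UpperHalfPlane.ext_re_im
  · rw [rotMatrix_smul_re]; simp; ring
  · rw [rotMatrix_smul_im]; simp

/-- The half-circle about `0` that is given by a real normal vector. -/
lemma halfCircle_eq_coord {c r : ℝ} (hc : 1 < c) (hr : r ^ 2 * (c - 1) = c + 1) :
    halfCircle 0 r = {z | coordT UpperHalfPlane.I z =
      inner ℝ (c : ℂ) (coordW UpperHalfPlane.I z)} := by
  ext z
  have := z.im_ne_zero
  have h1 : c - 1 ≠ 0 := by linarith
  simp only [halfCircle, Set.mem_ofPred_eq, inner_eq_re_im, coordT, coordW, UpperHalfPlane.I_re,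
    UpperHalfPlane.I_im, Complex.ofReal_re, Complex.ofReal_im]
  field_simp
  constructor
  · intro h
    linear_combination (1 - c) * h - hr
  · intro h
    refine mul_left_cancel₀ h1 ?_
    linear_combination - h - hr

/-- `rotMatrix φ` turns the plane by the angle 2φ, so φ = π/m gives order m on `ℍ`, although the
matrix has order 2m. The choice c = 1 / cos(π/(2m)) satisfies both c > 1 and c cos(π/m) ≤ 1, and r²
= (c + 1) / (c - 1) is the radius of the geodesic with this normal vector. -/
lemma exists_rotationData_rotMatrix {m : ℕ} (hm : 2 ≤ m) : ∃ (r : ℝ) (ρ c : ℂ), 0 < r ∧ r ≠ 1 ∧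
    RotationData m (rotMatrix (Real.pi / m)) {halfCircle 0 r} UpperHalfPlane.I ρ c ∧
    halfCircle 0 r = {z | coordT UpperHalfPlane.I z =
      inner ℝ c (coordW UpperHalfPlane.I z)} := by
  have hm0 : (0 : ℝ) < m := by positivity
  have hm2 : (2 : ℝ) ≤ m := by exact_mod_cast hm
  have hπ := Real.pi_pos
  have hφ0 : 0 < Real.pi / (2 * m) := by positivity
  have hφ1 : Real.pi / (2 * m) < Real.pi / m := by
    apply div_lt_div_of_pos_left hπ hm0; linarith
  have hφ2 : Real.pi / m ≤ Real.pi / 2 := div_le_div_of_nonneg_left hπ.le two_pos hm2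
  set C := Real.cos (Real.pi / (2 * m)) with hC
  have hC0 : 0 < C := Real.cos_pos_of_mem_Ioo ⟨by linarith, by linarith⟩
  have hC1 : C < 1 := by
    rw [← Real.cos_zero]
    exact Real.cos_lt_cos_of_nonneg_of_le_pi_div_two le_rfl (by linarith) hφ0
  have hCm : Real.cos (Real.pi / m) ≤ C :=
    Real.cos_le_cos_of_nonneg_of_le_pi hφ0.le (by linarith) hφ1.le
  set c : ℝ := C⁻¹ with hc
  have hc1 : 1 < c := (one_lt_inv₀ hC0).2 hC1
  have hcn : ‖(c : ℂ)‖ = c := by rw [Complex.norm_real, Real.norm_of_nonneg (by linarith)]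
  have hr0 : 0 < (c + 1) / (c - 1) := div_pos (by linarith) (by linarith)
  set r := √((c + 1) / (c - 1)) with hr
  have hr2 : r ^ 2 * (c - 1) = c + 1 := by
    rw [hr, Real.sq_sqrt hr0.le, div_mul_cancel₀ _ (by linarith)]
  have hg := halfCircle_eq_coord hc1 hr2
  set φ := Real.pi / m with hφ
  have hmφ : m * φ = Real.pi := by rw [hφ]; field_simp
  obtain ⟨ρ, hρ, hrot⟩ := exists_rotation (rotMatrix_smul_I φ)
  set w : ℍ := ⟨⟨0, 2⟩, two_pos⟩ with hw
  have hwI : coordW UpperHalfPlane.I w ≠ 0 := by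
    rw [Ne, coordW_eq_zero_iff]
    intro h
    have := congrArg UpperHalfPlane.im h
    simp [hw] at this
  have hpow (j : ℕ) : ρ ^ j = 1 ↔ rotMatrix (j * φ) • w = w := by
    rw [← rotMatrix_pow, ← zpow_natCast (rotMatrix φ), ← (coordW_injective UpperHalfPlane.I).eq_iff,
      coordW_zpow hρ hrot, zpow_natCast, mul_eq_right₀ hwI]
  have hprim : IsPrimitiveRoot ρ m := by
    refine ⟨?_, fun j hj => ?_⟩
    · rw [hpow, hmφ]
      apply UpperHalfPlane.ext_re_im
      · rw [rotMatrix_smul_re]; simp [hw]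
      · rw [rotMatrix_smul_im]; simp [hw]
    · have h1 := congrArg UpperHalfPlane.im ((hpow j).1 hj)
      rw [rotMatrix_smul_im, div_eq_iff (by
        have := Real.sin_sq_add_cos_sq (j * φ)
        simp only [hw, UpperHalfPlane.mk_re, UpperHalfPlane.mk_im]
        nlinarith [sq_nonneg (Real.sin (j * φ))])] at h1
      simp only [hw, UpperHalfPlane.mk_re, UpperHalfPlane.mk_im] at h1
      have h2 : Real.sin (j * φ) = 0 := by
        have := Real.sin_sq_add_cos_sq (j * φ)
        nlinarith
      obtain ⟨k, hk⟩ := Real.sin_eq_zero_iff.1 h2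
      rw [← hmφ, ← mul_assoc] at hk
      have h3 := mul_right_cancel₀ (by positivity) hk
      have h4 : k * m = j := by exact_mod_cast h3
      exact Int.natCast_dvd_natCast.1 ⟨k, by rw [← h4, mul_comm]⟩
  have hrpos : 0 < r := Real.sqrt_pos.2 hr0
  refine ⟨r, ρ, c, hrpos, fun h => ?_, ?_, hg⟩
  · rw [h] at hr2; linarith
  · exact
    { two_le := hm
      norm_rot := hρ
      rot := hrot
      prim := hprim
      one_lt := by rwa [hcn]
      cos_le := by
        rw [hcn, hc, inv_mul_le_iff₀ hC0, mul_one]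
        exact hCm
      geodesic := by
        rintro _ rfl
        exact Or.inr ⟨0, r, hrpos, rfl⟩
      disjoint := Set.pairwiseDisjoint_singleton _ _
      sector := by
        intro ℓ hℓ z hz
        rw [Set.mem_singleton_iff.1 hℓ, hg] at hz
        exact hz.le }

/-! ### Non-isometric orbifolds with a cone point -/

lemma exists_ellipticData {n k : ℕ} {X : Finset (Fin (2 * n))} (hn : 0 < n) (hk : 0 < k)
    (hX : X.card = n) : ∃ (r : ℝ) (H D D' : Set ℍ), 0 < r ∧ r ≠ 1 ∧
      EllipticData n (2 * n * k) X (rotMatrix (Real.pi / (2 * n * k : ℕ))) (halfCircle 0 r) H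
        {halfCircle 0 r} D D' := by
  have hm : 2 ≤ 2 * n * k := by nlinarith [Nat.mul_pos hn hk]
  obtain ⟨r, ρ, c, h0, h1, R, hg⟩ := exists_rotationData_rotMatrix hm
  refine ⟨r, _, _, _, h0, h1, R.ellipticData hg (isElliptic_rotMatrix ?_) ⟨k, rfl⟩ hX⟩
  have hm2 : (2 : ℝ) ≤ (2 * n * k : ℕ) := by exact_mod_cast hm
  have hπ := Real.pi_pos
  refine (Real.sin_pos_of_pos_of_lt_pi (by positivity) ?_).ne'
  exact div_lt_self hπ (by linarith)

/-- The set {0, 1, 2, 5} contains a path on three vertices, whereas its complement {3, 4, 6, 7}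
induces two disjoint edges, in which every walk of length two returns to its start. -/
lemma exists_not_congruent : ∃ X : Finset (Fin (2 * 4)),
    X.card = 4 ∧ 0 ∈ X ∧ ¬ Congruent X Xᶜ := by
  refine ⟨{0, 1, 2, 5}, rfl, by decide, ?_⟩
  rintro ⟨σ, hσ⟩
  have hmem (a : Fin 8) (ha : a ∈ ({0, 1, 2, 5} : Finset (Fin 8))) :
      σ a ∈ ({3, 4, 6, 7} : Finset (Fin 8)) := by
    have h1 : σ a ∈ ((({0, 1, 2, 5} : Finset (Fin 8))ᶜ : Finset (Fin 8)) : Set (Fin 8)) :=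
      hσ.subset ⟨a, ha, rfl⟩
    have h2 : (({0, 1, 2, 5} : Finset (Fin 8))ᶜ : Finset (Fin 8)) = {3, 4, 6, 7} := by decide
    rw [h2] at h1
    exact h1
  have key : ∀ a ∈ ({3, 4, 6, 7} : Finset (Fin 8)), ∀ b ∈ ({3, 4, 6, 7} : Finset (Fin 8)),
      ∀ c ∈ ({3, 4, 6, 7} : Finset (Fin 8)), (a - b = 1 ∨ b - a = 1) → (b - c = 1 ∨ c - b = 1) →
      a = c := by decide
  have hadj (a b : Fin 8) (h : a - b = 1 ∨ b - a = 1) : σ a - σ b = 1 ∨ σ b - σ a = 1 :=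
    SimpleGraph.cycleGraph_adj.1 (σ.map_rel_iff.2 (SimpleGraph.cycleGraph_adj.2 h))
  have h1 := key _ (hmem 0 (by decide)) _ (hmem 1 (by decide)) _ (hmem 2 (by decide))
    (hadj 0 1 (by decide)) (hadj 1 2 (by decide))
  exact absurd (σ.injective h1) (by decide)

lemma orthogonalAt_verticalLine {r : ℝ} (hr : 0 < r) {z : ℍ} (hre : z.re = 0) (him : z.im = r) :
    OrthogonalAt (verticalLine 0) (halfCircle 0 r) z := by
  refine ⟨1, (z : ℂ) - (0 : ℝ), ⟨hre, Or.inl ⟨0, rfl, rfl⟩⟩,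
    ⟨by simp [halfCircle, hre, him], Or.inr ⟨0, r, hr, rfl, rfl⟩⟩, ?_⟩
  rw [inner_eq_re_im]
  simp [hre]

/-- The imaginary axis is orthogonal to the half-circle and is preserved by the half-turn about `I`,
so it is also orthogonal to the image of the half-circle. The resulting segment is non-degenerate
because r ≠ 1. -/
lemma orthoSpectrum_ne_zero {r : ℝ} (hr : 0 < r) (hr1 : r ≠ 1) {𝒢 : Set (Set ℍ)}
    (h : halfCircle 0 r ∈ 𝒢) (h' : rotMatrix (Real.pi / 2) • halfCircle 0 r ∈ 𝒢)
    (Γ : Subgroup SL(2, ℝ)) : ∃ L, orthoSpectrum 𝒢 Γ L ≠ 0 := by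
  set z : ℍ := ⟨⟨0, r⟩, hr⟩ with hz
  set A := rotMatrix (Real.pi / 2) with hA
  have hline : A • verticalLine 0 = verticalLine 0 := by
    have hsub (w : ℍ) (hw : w ∈ verticalLine 0) : A • w ∈ verticalLine 0 := by
      have hw : w.re = 0 := hw
      rw [verticalLine, Set.mem_ofPred_eq, hA, rotMatrix_smul_re]
      simp [hw]
    refine Set.Subset.antisymm (Set.smul_set_subset_iff.2 fun w hw => hsub w hw) fun w hw => ?_
    refine ⟨A • w, hsub w hw, ?_⟩
    have e : A * A = rotMatrix Real.pi := by
      rw [← pow_two, hA, rotMatrix_pow]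
      congr 1
      push_cast
      ring
    simp only [smul_smul, e]
    apply UpperHalfPlane.ext_re_im
    · rw [rotMatrix_smul_re]; simp
    · rw [rotMatrix_smul_im]; simp
  have ho := orthogonalAt_verticalLine (z := z) hr rfl rfl
  have ho' := ho.smul A
  rw [hline] at ho'
  have hne : z ≠ A • z := by
    intro h
    have h1 := congrArg UpperHalfPlane.im h
    rw [hA, rotMatrix_smul_im] at h1
    simp only [hz, UpperHalfPlane.mk_re, UpperHalfPlane.mk_im, Real.sin_pi_div_two,
      Real.cos_pi_div_two] at h1
    field_simp at h1
    exact hr1 (by nlinarith)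
  refine ⟨dist z (A • z), Cardinal.mk_ne_zero_iff.2 ⟨⟨_, s(z, A • z), ⟨z, A • z, rfl, hne, rfl,
    verticalLine 0, Or.inl ⟨0, rfl⟩, ⟨_, h, ho⟩, ⟨_, h', ho'⟩⟩, rfl⟩⟩⟩

end OrthoSpec

theorem mainTheorem5 :
    -- there are non-isometric hyperbolic orbifolds (with a cone point) with the same ortho spectrum
    (∃ (D D' : Set ℍ) (𝒢 𝒢' : Set (Set ℍ)) (Γ Γ' : Subgroup SL(2, ℝ)),
      OrthoSpec.IsHypOrbifold D 𝒢 Γ ∧ OrthoSpec.IsHypOrbifold D' 𝒢' Γ' ∧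
      (∃ A ∈ Γ, (∃ z ∈ D, A • z = z) ∧ ∃ w ∈ D, A • w ≠ w) ∧
      (∃ A ∈ Γ', (∃ z ∈ D', A • z = z) ∧ ∃ w ∈ D', A • w ≠ w) ∧
      OrthoSpec.orthoSpectrum 𝒢 Γ = OrthoSpec.orthoSpectrum 𝒢' Γ' ∧
      OrthoSpec.orthoSpectrum 𝒢 ⊥ = OrthoSpec.orthoSpectrum 𝒢' ⊥ ∧
      (∃ L : ℝ, OrthoSpec.orthoSpectrum 𝒢 Γ L ≠ 0) ∧
      ¬ OrthoSpec.QuotientsIsometric D Γ D' Γ' ∧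
      ¬ OrthoSpec.QuotientsIsometric (closure D) Γ (closure D') Γ') ∧
    -- the construction always yields such orbifolds
    (∀ (n m : ℕ) (X : Finset (Fin (2 * n))) (γ : SL(2, ℝ)) (g H : Set ℍ) (𝒢₀ : Set (Set ℍ))
      (D D' : Set ℍ), OrthoSpec.EllipticData n m X γ g H 𝒢₀ D D' →
      IsOfFinOrder γ ∧
      OrthoSpec.IsHypOrbifold D (OrthoSpec.translates γ 𝒢₀ X) (Subgroup.zpowers (γ ^ (2 * n))) ∧
      OrthoSpec.IsHypOrbifold D' (OrthoSpec.translates γ 𝒢₀ Xᶜ) (Subgroup.zpowers (γ ^ (2 * n))) ∧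
      OrthoSpec.orthoSpectrum (OrthoSpec.translates γ 𝒢₀ X) (Subgroup.zpowers (γ ^ (2 * n))) =
        OrthoSpec.orthoSpectrum (OrthoSpec.translates γ 𝒢₀ Xᶜ)
          (Subgroup.zpowers (γ ^ (2 * n))) ∧
      OrthoSpec.orthoSpectrum (OrthoSpec.translates γ 𝒢₀ X) ⊥ =
        OrthoSpec.orthoSpectrum (OrthoSpec.translates γ 𝒢₀ Xᶜ) ⊥ ∧
      (𝒢₀.Nonempty → (2 * n < m ∨ 𝒢₀ = {g}) → ¬ OrthoSpec.Congruent X Xᶜ →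
        ¬ OrthoSpec.QuotientsIsometric D (Subgroup.zpowers (γ ^ (2 * n)))
            D' (Subgroup.zpowers (γ ^ (2 * n))) ∧
        ¬ OrthoSpec.QuotientsIsometric (closure D) (Subgroup.zpowers (γ ^ (2 * n)))
            (closure D') (Subgroup.zpowers (γ ^ (2 * n))))) ∧
    -- the construction can be carried out for every `n`-element set and every order
    (∀ (n k : ℕ) (X : Finset (Fin (2 * n))), 0 < n → 0 < k → X.card = n →
      ∃ (γ : SL(2, ℝ)) (g H D D' : Set ℍ),
        OrthoSpec.EllipticData n (2 * n * k) X γ g H {g} D D') ∧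
    -- there are sets that are not congruent to their complements
    (∃ (n : ℕ) (X : Finset (Fin (2 * n))), X.card = n ∧ ¬ OrthoSpec.Congruent X Xᶜ) := by
  obtain ⟨X, hX, hX0, hc⟩ := OrthoSpec.exists_not_congruent
  refine ⟨?_, fun n m X γ g H 𝒢₀ D D' E => ?_, fun n k X hn hk hX => ?_, 4, X, hX, hc⟩
  · obtain ⟨r, H, D, D', hr, hr1, E⟩ :=
      OrthoSpec.exists_ellipticData (n := 4) (k := 2) (by norm_num) (by norm_num) hX
    have hiso := E.not_isometric (Set.singleton_nonempty _) (Or.inl (by norm_num)) hc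
    have hcone := E.exists_conePoint (by norm_num)
    refine ⟨D, D', _, _, _, _, E.isHypOrbifold.1, E.isHypOrbifold.2, hcone.1, hcone.2,
      E.orthoSpectrum_eq.1, E.orthoSpectrum_eq.2, ?_, hiso.1, hiso.2⟩
    -- The exponents 0 and 8 both lift the vertex 0 of X. As m = 16, γ^8 is the half-turn about `I`,
    -- so the collection contains the half-circle and its opposite.
    have h0 : (0 : ℤ) ∈ OrthoSpec.liftToInt X := ⟨0, hX0, by decide⟩
    have h8 : (8 : ℤ) ∈ OrthoSpec.liftToInt X := ⟨0, hX0, by decide⟩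
    refine OrthoSpec.orthoSpectrum_ne_zero hr hr1 (𝒢 := OrthoSpec.translates
      (OrthoSpec.rotMatrix (Real.pi / (2 * 4 * 2 : ℕ))) {OrthoSpec.halfCircle 0 r} X)
      ⟨0, h0, _, rfl, ?_⟩ ⟨8, h8, _, rfl, ?_⟩ _
    · rw [zpow_zero, one_smul]
    · have e : OrthoSpec.rotMatrix (Real.pi / (2 * 4 * 2 : ℕ)) ^ (8 : ℤ) =
          OrthoSpec.rotMatrix (Real.pi / 2) := by
        rw [show (8 : ℤ) = (8 : ℕ) from rfl, zpow_natCast, OrthoSpec.rotMatrix_pow]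
        congr 1
        push_cast
        ring
      rw [e]
  · obtain ⟨z₀, ρ, c, R, -⟩ := E.exists_rotationData
    exact ⟨R.isOfFinOrder, E.isHypOrbifold.1, E.isHypOrbifold.2, E.orthoSpectrum_eq.1,
      E.orthoSpectrum_eq.2, fun h0 h hc => E.not_isometric h0 h hc⟩
  · obtain ⟨r, H, D, D', -, -, E⟩ := OrthoSpec.exists_ellipticData hn hk hX
    exact ⟨_, _, H, D, D', E⟩
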